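/- Let $q,p:\mathbb Z\to\mathbb C$ be rapidly decreasing in the sense that $\sum_n|q(n)|<\infty$, $\sum_n|p(n)|<\infty$, and let $1-q(n)p(n)\neq0$ for all $n$. Put $f(n)=\sqrt{1-q(n)p(n)}$ and $\ln f(n)=\tfrac12\ln(1-q(n)p(n))$ (principal branches), $\mathcal C=\prod_{n\in\mathbb Z}f(n)$, $$L(n,z)=\frac1{f(n)}\begin{pmatrix}z&q(n)\\p(n)&z^{-1}\end{pmatrix},\qquad E(m,z)=\begin{pmatrix}z^m&0\\0&z^{-m}\end{pmatrix}.$$ Let $T(n,m,z)$ be the transition matrix, $T(n+1,m,z)=L(n,z)T(n,m,z)$, $T(m,m,z)=\mathbb I$, let $T_\pm(n,z)=\lim_{m\to\pm\infty}T(n,m,z)E(m,z)$ be the Jost solutions ($|z|=1$), and $$T_+(n,z)^{-1}T_-(n,z)=\begin{pmatrix}a(z)&\tilde b(z)\\b(z)&\tilde a(z)\end{pmatrix},\qquad|z|=1 .$$ The limits defining the columns $T_-^{(1)},T_+^{(2)}$ exist for $|z|\ge1$, those defining $T_-^{(2)},T_+^{(1)}$ exist for $0<|z|\le1$, the matrix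 above is independent of $n$, and $a(z)=\det(T_-^{(1)},T_+^{(2)})$ and $\tilde a(z)=-\det(T_-^{(2)},T_+^{(1)})$ extend continuously to $|z|\ge1$ and $|z|\le1$ (with a removable singularity of $\tilde a$ at $0$) and analytically to $|z|>1$ and $|z|<1$, respectively. Assume that the zeros of $a$ in $|z|\ge1$ are exactly $\pm z_1,\dots,\pm z_N$, those of $\tilde a$ in $|z|\le1$ are exactly $\pm\tilde z_1,\dots,\pm\tilde z_{\tilde N}$, all these zeros being distinct and simple, with $|z_j|>1$ and $|\tilde z_l|<1$. No relation between $N$ and $\tilde N$ is assumed. (1) Trace formulae. $\xi^{2(N-\tilde N)}(1+b(\xi)\tilde b(\xi))$ has a continuous logarithm along $|\xi|=1$; every continuous branch along $\xi=e^{i\theta}$, $0\le\theta\le2\pi$, takes the same value at $\theta=0$ and $\theta=2\pi$, and with any such branch $$a(z)=\frac1{\mathcal C}\frac{z^{2\tilde N}\prod_{j=1}^N(z^2-z_j^2)}{z^{2N}\prod_{j=1}^{\tilde N}(z^2-\tilde z_j^2)}\exp\Big\{-\frac1{2\pi i}\oint_{|\xi|=1}\frac{\xi\ln(\xi^{2(N-\tilde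 N)}(1+b(\xi)\tilde b(\xi)))}{\xi^2-z^2}d\xi\Big\},\quad|z|>1,$$ $$\tilde a(z)=\mathcal C\,\frac{\prod_{j=1}^{\tilde N}(z^2-\tilde z_j^2)}{\prod_{j=1}^N(z^2-z_j^2)}\exp\Big\{\frac1{2\pi i}\oint_{|\xi|=1}\frac{\xi\ln(\xi^{2(N-\tilde N)}(1+b(\xi)\tilde b(\xi)))}{\xi^2-z^2}d\xi\Big\},\quad|z|<1.$$ (2) Trace identities. Define $W_{21}^{(1)}(n)=p(n-1)$, $W_{21}^{(2j)}=0$, $$W_{21}^{(2j+1)}(n)=W_{21}^{(2j-1)}(n-1)-q(n-1)\sum_{k+l=2j,\;k,l\ge1}W_{21}^{(k)}(n-1)W_{21}^{(l)}(n),\qquad j\ge1,$$ and $W_{12}^{(j)}$ by the same formulae with $q$ and $p$ exchanged. Let $I_0=\tilde I_0=-\sum_n\ln f(n)$, and for $k\ge1$ $$I_{2k}=\sum_{n}\sum_{m=1}^k\frac{(-1)^{m-1}}m q(n)^m\sum_{k_1+\dots+k_m=k,\;k_i\ge1}W_{21}^{(2k_1-1)}(n)\cdots W_{21}^{(2k_m-1)}(n),$$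 with $\tilde I_{2k}$ given by the same formula with $q(n)$ replaced by $p(n)$ and $W_{21}$ by $W_{12}$; in particular $I_2=\sum_nq(n)p(n-1)$, $\tilde I_2=\sum_np(n)q(n-1)$. All these series converge absolutely. Let $\ln(1+b\tilde b)$ denote a continuous branch along $\xi=e^{i\theta}$, $0\le\theta\le2\pi$ (it need not be single-valued on the circle), used in all contour integrals below. For every such branch and every $k\ge1$, $$I_{2k}=\frac1k\Big(N-\tilde N+\sum_{j=1}^{\tilde N}\tilde z_j^{2k}-\sum_{j=1}^Nz_j^{2k}\Big)+\frac1{2\pi i}\oint_{|\xi|=1}\xi^{2k-1}\ln(1+b\tilde b)\,d\xi,$$ $$\tilde I_{2k}=\frac1k\Big(\tilde N-N+\sum_{j=1}^Nz_j^{-2k}-\sum_{j=1}^{\tilde N}\tilde z_j^{-2k}\Big)+\frac1{2\pi i}\oint_{|\xi|=1}\xi^{-2k-1}\ln(1+b\tilde b)\,d\xi .$$ Moreover, for any choice of the logarithms $\ln(-z_j^2)$, $\ln(-\tilde z_l^2)$ there is a continuous branch of $\ln(1+b\tilde b)$ with $$I_0=\tilde I_0=\frac12\Big(\sum_{l=1}^{\tilde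 N}\ln(-\tilde z_l^2)-\sum_{j=1}^N\ln(-z_j^2)\Big)+(N-\tilde N)\pi i+\frac1{4\pi i}\oint_{|\xi|=1}\frac1\xi\ln(1+b\tilde b)\,d\xi, \qquad(\ast)$$ and for every other continuous branch $(\ast)$ holds up to adding $m\pi i$ for some $m\in\mathbb Z$. (3) Hamiltonian. For $H=-\sum_n\big(q(n)(p(n-1)+p(n+1))+2\ln(1-q(n)p(n))\big)$ one has $H=4I_0-I_2-\tilde I_2$, and, with the same branch of $\ln(1+b\tilde b)$ as in the exact form of $(\ast)$ and with $\ln z_j^4=2\ln(-z_j^2)$, $\ln\tilde z_l^4=2\ln(-\tilde z_l^2)$, $$H=\sum_{j=1}^{\tilde N}\ln\tilde z_j^4-\sum_{j=1}^N\ln z_j^4+4(N-\tilde N)\pi i+\sum_{j=1}^N(z_j^2-z_j^{-2})-\sum_{j=1}^{\tilde N}(\tilde z_j^2-\tilde z_j^{-2})+\frac1{2\pi i}\oint_{|\xi|=1}(2\xi^{-1}-\xi^{-3}-\xi)\ln(1+b\tilde b)\,d\xi .$$ For any other continuous branch of $\ln(1+b\tilde b)$ this holds up to adding $4m\pi i$,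 with the same $m$ as in $(\ast)$; with arbitrary logarithms of $z_j^4$, $\tilde z_l^4$ and any continuous branch of $\ln(1+b\tilde b)$ it holds up to adding an element of $2\pi i\,\mathbb Z$. -/

import Mathlib

open Filter Topology
open scoped BigOperators

namespace AblowitzLadik

noncomputable section

/-- `f(n) = √(1 - q(n) p(n))`, the square root being the principal one. -/
def normF (q p : ℤ → ℂ) (n : ℤ) : ℂ := (1 - q n * p n) ^ (1 / 2 : ℂ)

/-- The constant `𝒞 = ∏_{n ∈ ℤ} f(n)`. -/
def prodC (q p : ℤ → ℂ) : ℂ := ∏' n : ℤ, normF q p n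

/-- The normalised Lax matrix `L(n, z) = f(n)⁻¹ (Z + Q(n))`. -/
def lax (q p : ℤ → ℂ) (n : ℤ) (z : ℂ) : Matrix (Fin 2) (Fin 2) ℂ :=
  (normF q p n)⁻¹ • !![z, q n; p n, z⁻¹]

/-- The product `L(m + k - 1, z) ⋯ L(m + 1, z) L(m, z)`. -/
def laxProd (q p : ℤ → ℂ) (m : ℤ) (z : ℂ) : ℕ → Matrix (Fin 2) (Fin 2) ℂ
  | 0 => 1
  | k + 1 => lax q p (m + k) z * laxProd q p m z k

/-- The transition matrix `T(n, m, z)`: `L(n-1) ⋯ L(m)` for `m ≤ n` and `T(m, n, z)⁻¹` for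
`n < m`. -/
def transition (q p : ℤ → ℂ) (n m : ℤ) (z : ℂ) : Matrix (Fin 2) (Fin 2) ℂ :=
  if m ≤ n then laxProd q p m z (n - m).toNat else (laxProd q p n z (m - n).toNat)⁻¹

/-- `E(m, z) = diag(z ^ m, z ^ (-m))`. -/
def freeE (m : ℤ) (z : ℂ) : Matrix (Fin 2) (Fin 2) ℂ := !![z ^ m, 0; 0, z ^ (-m)]

/-- The Jost solution `lim_m T(n, m, z) E(m, z)` along the filter `l` (`atBot` for `T₋`, `atTop`
for `T₊`). The limit is taken entry by entry, so that for `|z| ≠ 1` a column of it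
still makes sense where only that column converges: the first column of `T₋` and the second
of `T₊` for `|z| ≥ 1`, the other two for `0 < |z| ≤ 1`. -/
def jost (q p : ℤ → ℂ) (l : Filter ℤ) (n : ℤ) (z : ℂ) : Matrix (Fin 2) (Fin 2) ℂ :=
  Matrix.of fun i j => limUnder l (fun m : ℤ => (transition q p n m z * freeE m z) i j)

/-- The reduced monodromy matrix `T₊(n, z)⁻¹ T₋(n, z)`, for `|z| = 1`
(it does not depend on `n`). -/
def monodromy (q p : ℤ → ℂ) (n : ℤ) (z : ℂ) : Matrix (Fin 2) (Fin 2) ℂ :=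
  (jost q p atTop n z)⁻¹ * jost q p atBot n z

/-- `b(z)`, `|z| = 1`. -/
def bCoef (q p : ℤ → ℂ) (z : ℂ) : ℂ := monodromy q p 0 z 1 0

/-- `b̃(z)`, `|z| = 1`. -/
def bTilde (q p : ℤ → ℂ) (z : ℂ) : ℂ := monodromy q p 0 z 0 1

/-- `a(z) = det (T₋⁽¹⁾, T₊⁽²⁾)`, `|z| ≥ 1`. -/
def aCoef (q p : ℤ → ℂ) (z : ℂ) : ℂ :=
  Matrix.det !![jost q p atBot 0 z 0 0, jost q p atTop 0 z 0 1;
                jost q p atBot 0 z 1 0, jost q p atTop 0 z 1 1]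

/-- `- det (T₋⁽²⁾, T₊⁽¹⁾)`, `0 < |z| ≤ 1`. -/
def aTildeAux (q p : ℤ → ℂ) (z : ℂ) : ℂ :=
  - Matrix.det !![jost q p atBot 0 z 0 1, jost q p atTop 0 z 0 0;
                  jost q p atBot 0 z 1 1, jost q p atTop 0 z 1 0]

/-- `ã(z)`, `|z| ≤ 1`: the Wronskian for `z ≠ 0`, extended to the removable singularity `z = 0`. -/
def aTilde (q p : ℤ → ℂ) (z : ℂ) : ℂ :=
  if z = 0 then limUnder (𝓝[≠] (0 : ℂ)) (aTildeAux q p) else aTildeAux q p z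

/-- The coefficients `W⁽²ʲ⁺¹⁾(n)` (the even ones vanish): `W⁽¹⁾(n) = v(n-1)` and
`W⁽²ʲ⁺¹⁾(n) = W⁽²ʲ⁻¹⁾(n-1) - u(n-1) ∑_{k+l=2j} W⁽ᵏ⁾(n-1) W⁽ˡ⁾(n)`.
`W₂₁` is `wCoef q p` and `W₁₂` is `wCoef p q`. -/
def wCoef (u v : ℤ → ℂ) : ℕ → ℤ → ℂ
  | 0, n => v (n - 1)
  | j + 1, n => wCoef u v j (n - 1)
      - u (n - 1) * ∑ i : Fin (j + 1), wCoef u v i.1 (n - 1) * wCoef u v (j - i.1) n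
termination_by j => j
decreasing_by all_goals omega

/-- The density
`∑_{m=1}^k (-1)^(m-1)/m u(n)^m ∑_{k₁+⋯+k_m=k, kᵢ≥1} W⁽²ᵏ¹⁻¹⁾(n) ⋯ W⁽²ᵏᵐ⁻¹⁾(n)`;
the inner sum runs over `κᵢ = kᵢ - 1 ≥ 0`. -/
def density (u v : ℤ → ℂ) (k : ℕ) (n : ℤ) : ℂ :=
  ∑ m ∈ Finset.Icc 1 k, (-1 : ℂ) ^ (m - 1) / (m : ℂ) * u n ^ m *
    ∑ κ ∈ Finset.Nat.antidiagonalTuple m (k - m), ∏ i : Fin m, wCoef u v (κ i) n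

/-- `I₀ = Ĩ₀ = - ∑ ln f(n)`. -/
def conservedI0 (q p : ℤ → ℂ) : ℂ := - ∑' n : ℤ, Complex.log (normF q p n)

/-- `I_{2k}`, `k ≥ 1`. -/
def conservedI (q p : ℤ → ℂ) (k : ℕ) : ℂ := ∑' n : ℤ, density q p k n

/-- `Ĩ_{2k}`, `k ≥ 1`. -/
def conservedITilde (q p : ℤ → ℂ) (k : ℕ) : ℂ := ∑' n : ℤ, density p q k n

/-- Minus the summand of the Hamiltonian. -/
def hamDensity (q p : ℤ → ℂ) (n : ℤ) : ℂ :=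
  q n * (p (n - 1) + p (n + 1)) + 2 * Complex.log (1 - q n * p n)

/-- The Hamiltonian `H = - ∑ (q(n) (p(n-1) + p(n+1)) + 2 ln (1 - q(n) p(n)))`. -/
def hamiltonian (q p : ℤ → ℂ) : ℂ := - ∑' n : ℤ, hamDensity q p n

/-- `ℓ` is a continuous branch of `ln g(e^{iθ})` along the unit circle, `0 ≤ θ ≤ 2π`.
(It need not take the same value at `θ = 0` and `θ = 2π`.) -/
def IsLogBranch (g : ℂ → ℂ) (ℓ : ℝ → ℂ) : Prop :=
  ContinuousOn ℓ (Set.Icc 0 (2 * Real.pi)) ∧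
    ∀ θ ∈ Set.Icc (0 : ℝ) (2 * Real.pi), Complex.exp (ℓ θ) = g (Complex.exp (θ * Complex.I))

/-- `∮_{|ξ|=1} w(ξ) ℓ dξ` with `ξ = e^{iθ}`, `0 ≤ θ ≤ 2π`, where `ℓ` is a function of `θ`. -/
def contour (w : ℂ → ℂ) (ℓ : ℝ → ℂ) : ℂ :=
  ∫ θ in (0 : ℝ)..(2 * Real.pi),
    w (Complex.exp (θ * Complex.I)) * ℓ θ * (Complex.I * Complex.exp (θ * Complex.I))

/-- `1 + b(ξ) b̃(ξ)`. -/
def onePlusBB (q p : ℤ → ℂ) (ξ : ℂ) : ℂ := 1 + bCoef q p ξ * bTilde q p ξ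

/-- The scattering-data expression for `I₀ = Ĩ₀`; `lam j` and `lamT l` are
the chosen logarithms of `-z_j²` and `-z̃_l²`, `ℓ` that of `1 + b b̃`. -/
def traceC0 {N Nt : ℕ} (lam : Fin N → ℂ) (lamT : Fin Nt → ℂ) (ℓ : ℝ → ℂ) : ℂ :=
  1 / 2 * (∑ l, lamT l - ∑ j, lam j) + ((N : ℂ) - (Nt : ℂ)) * Real.pi * Complex.I
    + 1 / (4 * Real.pi * Complex.I) * contour (fun ξ => 1 / ξ) ℓ

/-- `c_{2k}`. -/
def traceC {N Nt : ℕ} (z : Fin N → ℂ) (zt : Fin Nt → ℂ) (ℓ : ℝ → ℂ) (k : ℕ) : ℂ :=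
  1 / (k : ℂ) * ((N : ℂ) - (Nt : ℂ) + ∑ l, zt l ^ (2 * k) - ∑ j, z j ^ (2 * k))
    + 1 / (2 * Real.pi * Complex.I) * contour (fun ξ => ξ ^ (2 * (k : ℤ) - 1)) ℓ

/-- `c̃_{2k}`. -/
def traceCTilde {N Nt : ℕ} (z : Fin N → ℂ) (zt : Fin Nt → ℂ) (ℓ : ℝ → ℂ) (k : ℕ) : ℂ :=
  1 / (k : ℂ) * ((Nt : ℂ) - (N : ℂ) + ∑ j, z j ^ (-(2 * (k : ℤ))) - ∑ l, zt l ^ (-(2 * (k : ℤ))))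
    + 1 / (2 * Real.pi * Complex.I) * contour (fun ξ => ξ ^ (-(2 * (k : ℤ)) - 1)) ℓ

/-- The scattering-data expression for the Hamiltonian; `mu j` and `muT l` are the chosen
logarithms of `z_j⁴` and `z̃_l⁴`, `ℓ` that of `1 + b b̃`. -/
def hamScattering {N Nt : ℕ} (z : Fin N → ℂ) (zt : Fin Nt → ℂ)
    (mu : Fin N → ℂ) (muT : Fin Nt → ℂ) (ℓ : ℝ → ℂ) : ℂ :=
  ∑ l, muT l - ∑ j, mu j + 4 * ((N : ℂ) - (Nt : ℂ)) * Real.pi * Complex.I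
    + ∑ j, (z j ^ 2 - (z j ^ 2)⁻¹) - ∑ l, (zt l ^ 2 - (zt l ^ 2)⁻¹)
    + 1 / (2 * Real.pi * Complex.I)
      * contour (fun ξ => 2 * ξ⁻¹ - ξ ^ (-3 : ℤ) - ξ) ℓ

end

end AblowitzLadik

/-!
Everything is expressed through one holomorphic function. The conjugation by `diag(1, z⁻¹)` turns
`z⁻¹ L(n, z)` into a matrix that depends on `z` only through `x = z⁻²` and is polynomial in `x`,
and for summable potentials the products over the two half-lines converge uniformly on `‖x‖ ≤ 1`.
Hence `a(z) = transm q p (z⁻²)`, where `transm q p` is holomorphic in the unit disc and continuous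
up to the boundary (`diffContOnCl_transm`, `aCoef_eq_transm`). Exchanging `q` with `p` and `z` with
`z⁻¹` permutes the two indices, so that `ã(z) = transm p q (z²)` needs no separate treatment
(`aTilde_eq_transm`). The monodromy matrix has determinant one, so `1 + b b̃ = a ã` on the circle
(`onePlusBB_eq`).

After division by the simple zeros the two functions have no zeros in the closed disc and therefore
have logarithms `U(x)` and `V(y)` there (`exists_spectralLogs`). The function `U(ξ⁻²) + V(ξ²)` is a
single-valued branch of `ln (ξ^{2(N-Ñ)} (1 + b b̃))`, and since two branches on an interval differ by
a constant in `2π i ℤ`, every branch has this form (`SpectralLogs.exists_eqOn`). A contour integral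
against such a function reduces, by the double covering `ξ ↦ ξ²`, to circle means of `U` and `V`.
The Cauchy kernel gives the trace formulae, and the powers of `ξ` give the Taylor coefficients of
`U` and `V` at the origin. For a branch of `ln (1 + b b̃)` the additional linear term in the angle is
integrated explicitly.

The other side of the trace identities is the expansion `ln a = I₀ + ∑_{k ≥ 1} I_{2k} x^k`
(`transm_mul_exp_isBigO`). For potentials cut off on the left, the ratio `s(n)` of the components of
the solution that starts as `(1, 0)` solves a Riccati difference equation, whose expansion
coefficients in powers of `x` are the `W₂₁^{(2j+1)}(n)` (`expandsTo_riccati`), and the first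
component of that solution is the product of the factors `f(n)⁻¹ (1 + x q(n) s(n))`. The remainders
are bounded by a summable sequence independent of the cut-off (`exists_bound_log_sub_density`), and
dominated convergence removes the cut-off. Comparison with the Taylor coefficients of `U`, and of
`V` after the exchange of `q` and `p`, is `conservedI_eq_of_factorization`; at order zero only the
exponentials are compared, whence the ambiguity by `π i ℤ`. The Hamiltonian is the combination
`4 I₀ - I₂ - Ĩ₂`.
-/

namespace AblowitzLadik

/-! ### Holomorphic functions on the unit disc that are continuous up to the boundary -/

/-- A continuous logarithm of a differentiable function is differentiable. -/
theorem differentiableAt_of_exp_comp {U P : ℂ → ℂ} {x : ℂ} (hU : ContinuousAt U x)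
    (hP : DifferentiableAt ℂ P x) (h : ∀ᶠ y in 𝓝 x, Complex.exp (U y) = P y) :
    DifferentiableAt ℂ U x := by
  have hx : P x ≠ 0 := by
    rw [← h.self_of_nhds]
    exact Complex.exp_ne_zero _
  have hev : U =ᶠ[𝓝 x] fun y => U x + Complex.log (P y / P x) := by
    have h1 : Tendsto (fun y => U y - U x) (𝓝 x) (𝓝 0) := by
      simpa using hU.tendsto.sub_const (U x)
    have h2 := h1.eventually (Metric.ball_mem_nhds 0 Real.pi_pos)
    filter_upwards [h, h2] with y hy hy2
    rw [← hy, ← h.self_of_nhds, ← Complex.exp_sub]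
    have h3 : |(U y - U x).im| < Real.pi := by
      refine lt_of_le_of_lt (Complex.abs_im_le_norm _) ?_
      simpa [dist_zero_right] using hy2
    rw [Complex.log_exp (abs_lt.1 h3).1 (abs_lt.1 h3).2.le]
    ring
  refine DifferentiableAt.congr_of_eventuallyEq ?_ hev
  refine (differentiableAt_const _).add (DifferentiableAt.clog (hP.div_const _) ?_)
  rw [div_self hx]
  exact Complex.one_mem_slitPlane

theorem exists_log_diffContOnCl {P : ℂ → ℂ} (hP : DiffContOnCl ℂ P (Metric.ball 0 1))
    (hne : ∀ x, ‖x‖ ≤ 1 → P x ≠ 0) :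
    ∃ U : ℂ → ℂ, DiffContOnCl ℂ U (Metric.ball 0 1) ∧
      ∀ x, ‖x‖ ≤ 1 → Complex.exp (U x) = P x := by
  -- the radial retraction of the plane onto the closed disc
  let ρ : ℂ → ℂ := fun x => ((max 1 ‖x‖ : ℝ) : ℂ)⁻¹ * x
  have hmax : ∀ x : ℂ, (0 : ℝ) < max 1 ‖x‖ := fun x => lt_of_lt_of_le one_pos (le_max_left _ _)
  have hρc : Continuous ρ := by
    refine Continuous.mul (Continuous.inv₀ (by fun_prop) fun x => ?_) continuous_id
    exact_mod_cast (hmax x).ne'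
  have hρn : ∀ x, ‖ρ x‖ ≤ 1 := by
    intro x
    simp only [ρ, norm_mul, norm_inv, Complex.norm_real, Real.norm_of_nonneg (hmax x).le]
    rw [inv_mul_le_iff₀ (hmax x), mul_one]
    exact le_max_right _ _
  have hρe : ∀ x, ‖x‖ ≤ 1 → ρ x = x := by
    intro x hx
    simp [ρ, max_eq_left hx]
  have hPc : ContinuousOn P (Metric.closedBall 0 1) := hP.continuousOn_ball
  have hPρ : Continuous (P ∘ ρ) :=
    hPc.comp_continuous hρc fun x => by simpa using hρn x
  have hsc : IsSimplyConnected (Set.univ : Set ℂ) :=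
    (Homeomorph.Set.univ ℂ).toHomotopyEquiv.simplyConnectedSpace
  obtain ⟨U, hUc, hUe⟩ := Complex.exists_continuousOn_eqOn_exp_comp (g := P ∘ ρ)
    hsc isOpen_univ hPρ.continuousOn (by
      rintro ⟨x, -, hx⟩
      exact hne _ (hρn x) hx)
  have hUc' : Continuous U := by simpa using hUc
  have hexp : ∀ x, ‖x‖ ≤ 1 → Complex.exp (U x) = P x := by
    intro x hx
    have := hUe (Set.mem_univ x)
    simpa [hρe x hx] using this
  refine ⟨U, ⟨fun x hx => ?_, hUc'.continuousOn⟩, hexp⟩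
  refine (differentiableAt_of_exp_comp hUc'.continuousAt
    (hP.differentiableAt Metric.isOpen_ball hx) ?_).differentiableWithinAt
  filter_upwards [Metric.isOpen_ball.mem_nhds hx] with y hy
  exact hexp y (by simpa using (Metric.mem_ball.1 hy).le)

/-- Removal of finitely many simple zeros. -/
theorem exists_factor_simple_zeros {ι : Type*} (s : Finset ι) (x : ι → ℂ)
    (hx : ∀ j ∈ s, ‖x j‖ < 1) (hinj : Set.InjOn x s) :
    ∀ G : ℂ → ℂ, DiffContOnCl ℂ G (Metric.ball 0 1) →
      (∀ y, ‖y‖ ≤ 1 → (G y = 0 ↔ ∃ j ∈ s, y = x j)) → (∀ j ∈ s, deriv G (x j) ≠ 0) →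
      ∃ g : ℂ → ℂ, DiffContOnCl ℂ g (Metric.ball 0 1) ∧ (∀ y, ‖y‖ ≤ 1 → g y ≠ 0) ∧
        ∀ y, G y = g y * ∏ j ∈ s, (y - x j) := by
  classical
  induction s using Finset.induction_on with
  | empty =>
    intro G hG hz _
    exact ⟨G, hG, fun y hy h => by simpa using (hz y hy).1 h, fun y => by simp⟩
  | insert i s his ih =>
    intro G hG hz hd
    have hi1 : ‖x i‖ < 1 := hx i (Finset.mem_insert_self _ _)
    have hib : x i ∈ Metric.ball (0 : ℂ) 1 := by simpa using hi1
    have hnhds : Metric.ball (0 : ℂ) 1 ∈ 𝓝 (x i) := Metric.isOpen_ball.mem_nhds hib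
    have hGi : G (x i) = 0 := (hz _ hi1.le).2 ⟨i, Finset.mem_insert_self _ _, rfl⟩
    have hfac : ∀ y, G y = (y - x i) * dslope G (x i) y := by
      intro y
      have := sub_smul_dslope G (x i) y
      rw [hGi, sub_zero, smul_eq_mul] at this
      exact this.symm
    have hdiff : DiffContOnCl ℂ (dslope G (x i)) (Metric.ball 0 1) := by
      refine ⟨(Complex.differentiableOn_dslope hnhds).2 hG.differentiableOn, ?_⟩
      exact (continuousOn_dslope (mem_of_superset hnhds subset_closure)).2
        ⟨hG.continuousOn, hG.differentiableAt Metric.isOpen_ball hib⟩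
    have hji : ∀ j ∈ s, x j ≠ x i := by
      intro j hj h
      have := hinj (Finset.mem_insert_of_mem hj) (Finset.mem_insert_self i s) h
      exact his (this ▸ hj)
    obtain ⟨g, hg, hg0, hgf⟩ := ih (fun j hj => hx j (Finset.mem_insert_of_mem hj))
      (hinj.mono (by simp)) (dslope G (x i)) hdiff
      (by
        intro y hy
        rcases eq_or_ne y (x i) with rfl | hyi
        · rw [dslope_same]
          constructor
          · intro h
            exact absurd h (hd i (Finset.mem_insert_self _ _))
          · rintro ⟨j, hj, h⟩
            exact absurd h.symm (hji j hj)
        · have h1 : dslope G (x i) y = 0 ↔ G y = 0 := by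
            rw [hfac y, mul_eq_zero, sub_eq_zero]
            simp [hyi]
          rw [h1, hz y hy]
          simp [hyi])
      (by
        intro j hj h
        have hjb : x j ∈ Metric.ball (0 : ℂ) 1 := by
          simpa using hx j (Finset.mem_insert_of_mem hj)
        have hdj : DifferentiableAt ℂ (dslope G (x i)) (x j) :=
          hdiff.differentiableAt Metric.isOpen_ball hjb
        have h0 : dslope G (x i) (x j) = 0 := by
          have : G (x j) = 0 :=
            (hz _ (by simpa using (Metric.mem_ball.1 hjb).le)).2
              ⟨j, Finset.mem_insert_of_mem hj, rfl⟩
          rw [hfac] at this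
          exact (mul_eq_zero.1 this).resolve_left (sub_ne_zero.2 (hji j hj))
        have h2 : HasDerivAt G (1 * dslope G (x i) (x j)
            + (x j - x i) * deriv (dslope G (x i)) (x j)) (x j) := by
          exact (((hasDerivAt_id (x j)).sub_const (x i)).mul hdj.hasDerivAt).congr_of_eventuallyEq
            (Eventually.of_forall hfac)
        refine hd j (Finset.mem_insert_of_mem hj) ?_
        rw [h2.deriv, h0, h]
        ring)
    refine ⟨g, hg, hg0, fun y => ?_⟩
    rw [hfac y, hgf y, Finset.prod_insert his]
    ring

/-! ### Contour integrals over the unit circle -/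

open Real in
/-- The mean over the unit circle of a function that is holomorphic inside. -/
theorem circleAverage_unit_of_diffContOnCl {F : ℂ → ℂ} (hF : DiffContOnCl ℂ F (Metric.ball 0 1)) :
    circleAverage F 0 1 = F 0 :=
  DiffContOnCl.circleAverage (by simpa using hF)

open Real in
/-- The Cauchy integral formula, written as a mean over the unit circle. -/
theorem circleAverage_unit_cauchy {F : ℂ → ℂ} (hF : DiffContOnCl ℂ F (Metric.ball 0 1)) {X : ℂ}
    (hX : ‖X‖ < 1) : circleAverage (fun v => v / (v - X) * F v) 0 1 = F X := by
  have := DiffContOnCl.circleAverage_smul_div (c := 0) (R := 1) (w := X) (f := F)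
    (by simpa using hF) (by simpa using hX)
  simpa using this

theorem diffContOnCl_mul {F G : ℂ → ℂ} {s : Set ℂ} (hF : DiffContOnCl ℂ F s)
    (hG : DiffContOnCl ℂ G s) : DiffContOnCl ℂ (fun v => F v * G v) s :=
  hF.smul hG

theorem continuousOn_sphere_of_diffContOnCl {F : ℂ → ℂ} (hF : DiffContOnCl ℂ F (Metric.ball 0 1)) :
    ContinuousOn F (Metric.sphere 0 1) :=
  hF.continuousOn_ball.mono Metric.sphere_subset_closedBall

theorem norm_exp_mul_I (θ : ℝ) : ‖Complex.exp (θ * Complex.I)‖ = 1 :=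
  Complex.norm_exp_ofReal_mul_I θ

theorem continuous_comp_circle {F : ℂ → ℂ} (hF : ContinuousOn F (Metric.sphere 0 1)) :
    Continuous fun θ : ℝ => F (Complex.exp (θ * Complex.I)) :=
  hF.comp_continuous (by fun_prop) fun θ => by simp

open Real in
/-- The double covering `ξ ↦ ξ²` of the unit circle preserves means. -/
theorem integral_comp_sq_circle {F : ℂ → ℂ} (hF : ContinuousOn F (Metric.sphere 0 1)) :
    ∫ θ in (0 : ℝ)..(2 * π), F (Complex.exp (θ * Complex.I) ^ 2)
      = 2 * π * circleAverage F 0 1 := by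
  set g : ℝ → ℂ := fun θ => F (Complex.exp (θ * Complex.I)) with hg
  have hgc : Continuous g := continuous_comp_circle hF
  have hgp : Function.Periodic g (2 * π) := by
    intro θ
    simp only [hg]
    congr 1
    push_cast
    rw [add_mul, Complex.exp_add, Complex.exp_two_pi_mul_I, mul_one]
  have h1 : ∫ θ in (0 : ℝ)..(2 * π), F (Complex.exp (θ * Complex.I) ^ 2)
      = ∫ θ in (0 : ℝ)..(2 * π), g (2 * θ) := by
    refine intervalIntegral.integral_congr fun θ _ => ?_
    simp only [hg]
    rw [← Complex.exp_nat_mul]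
    push_cast
    ring_nf
  rw [h1, intervalIntegral.integral_comp_mul_left _ two_ne_zero]
  have h2 : ∫ θ in (2 * 0 : ℝ)..(2 * (2 * π)), g θ = 2 * ∫ θ in (0 : ℝ)..(2 * π), g θ := by
    have h3 := hgp.intervalIntegral_add_eq (2 * π) 0
    rw [zero_add] at h3
    rw [mul_zero, ← intervalIntegral.integral_add_adjacent_intervals (b := 2 * π)
      (hgc.intervalIntegrable _ _) (hgc.intervalIntegrable _ _)]
    rw [show (2 * (2 * π)) = 2 * π + 2 * π by ring, h3]
    ring
  rw [h2, circleAverage_def]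
  have h4 : ∫ θ in (0 : ℝ)..(2 * π), F (circleMap 0 1 θ) = ∫ θ in (0 : ℝ)..(2 * π), g θ := by
    simp [hg, circleMap]
  rw [h4, Complex.real_smul, Complex.real_smul]
  push_cast
  have : (π : ℂ) ≠ 0 := by exact_mod_cast Real.pi_ne_zero
  field_simp

open Real in
/-- The map `ξ ↦ ξ⁻²` of the unit circle preserves means. -/
theorem integral_comp_inv_sq_circle {F : ℂ → ℂ} (hF : ContinuousOn F (Metric.sphere 0 1)) :
    ∫ θ in (0 : ℝ)..(2 * π), F ((Complex.exp (θ * Complex.I) ^ 2)⁻¹)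
      = 2 * π * circleAverage F 0 1 := by
  rw [← integral_comp_sq_circle hF]
  have h := intervalIntegral.integral_comp_sub_left (a := 0) (b := 2 * π)
    (fun θ : ℝ => F (Complex.exp (θ * Complex.I) ^ 2)) (2 * π)
  rw [sub_self, sub_zero] at h
  rw [← h]
  refine intervalIntegral.integral_congr fun θ _ => ?_
  congr 1
  push_cast
  rw [sub_mul, Complex.exp_sub, Complex.exp_two_pi_mul_I, one_div, inv_pow]

/-- The boundary function `ξ ↦ U(ξ⁻²) + V(ξ²)` as a function of the angle. -/
noncomputable def boundarySum (U V : ℂ → ℂ) (θ : ℝ) : ℂ :=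
  U ((Complex.exp (θ * Complex.I) ^ 2)⁻¹) + V (Complex.exp (θ * Complex.I) ^ 2)

theorem boundarySum_two_pi (U V : ℂ → ℂ) : boundarySum U V (2 * Real.pi) = boundarySum U V 0 := by
  simp [boundarySum]

theorem continuous_boundarySum {U V : ℂ → ℂ} (hU : DiffContOnCl ℂ U (Metric.ball 0 1))
    (hV : DiffContOnCl ℂ V (Metric.ball 0 1)) : Continuous (boundarySum U V) := by
  have h0 : ∀ θ : ℝ, Complex.exp (θ * Complex.I) ^ 2 ≠ 0 := fun θ =>
    pow_ne_zero _ (Complex.exp_ne_zero _)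
  refine Continuous.add ?_ ?_
  · exact (continuousOn_sphere_of_diffContOnCl hU).comp_continuous
      (Continuous.inv₀ (by fun_prop) h0) fun θ => by simp
  · exact (continuousOn_sphere_of_diffContOnCl hV).comp_continuous
      (by fun_prop) fun θ => by simp

open Real in
/-- Evaluation of a contour integral against `U(ξ⁻²) + V(ξ²)` when the weight `ξ w(ξ)` is
expressed through `ξ⁻²` and through `ξ²`. -/
theorem contour_boundarySum {U V w A B : ℂ → ℂ} (hU : DiffContOnCl ℂ U (Metric.ball 0 1))
    (hV : DiffContOnCl ℂ V (Metric.ball 0 1)) (hA : ContinuousOn A (Metric.sphere 0 1))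
    (hB : ContinuousOn B (Metric.sphere 0 1))
    (hwA : ∀ ξ, ‖ξ‖ = 1 → w ξ * ξ = A ((ξ ^ 2)⁻¹)) (hwB : ∀ ξ, ‖ξ‖ = 1 → w ξ * ξ = B (ξ ^ 2)) :
    contour w (boundarySum U V) = 2 * π * Complex.I *
      (circleAverage (fun v => A v * U v) 0 1 + circleAverage (fun v => B v * V v) 0 1) := by
  have hAU : ContinuousOn (fun v => A v * U v) (Metric.sphere 0 1) :=
    hA.mul (continuousOn_sphere_of_diffContOnCl hU)
  have hBV : ContinuousOn (fun v => B v * V v) (Metric.sphere 0 1) :=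
    hB.mul (continuousOn_sphere_of_diffContOnCl hV)
  have h0 : ∀ θ : ℝ, Complex.exp (θ * Complex.I) ^ 2 ≠ 0 := fun θ =>
    pow_ne_zero _ (Complex.exp_ne_zero _)
  have key : contour w (boundarySum U V) = ∫ θ in (0 : ℝ)..(2 * π),
      Complex.I * ((fun v => A v * U v) ((Complex.exp (θ * Complex.I) ^ 2)⁻¹)
        + (fun v => B v * V v) (Complex.exp (θ * Complex.I) ^ 2)) := by
    refine intervalIntegral.integral_congr fun θ _ => ?_
    simp only [boundarySum]
    rw [← hwA _ (norm_exp_mul_I θ), ← hwB _ (norm_exp_mul_I θ)]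
    ring
  rw [key, intervalIntegral.integral_const_mul, intervalIntegral.integral_add,
    integral_comp_sq_circle hBV, integral_comp_inv_sq_circle hAU]
  · ring
  · exact Continuous.intervalIntegrable (hAU.comp_continuous
      (Continuous.inv₀ (by fun_prop) h0) fun θ => by simp) _ _
  · exact Continuous.intervalIntegrable (hBV.comp_continuous
      (by fun_prop) fun θ => by simp) _ _

theorem ne_zero_of_norm_eq_one {v : ℂ} (hv : ‖v‖ = 1) : v ≠ 0 := by
  rintro rfl
  simp at hv

theorem sub_ne_zero_of_norm_lt_one {v X : ℂ} (hv : ‖v‖ = 1) (hX : ‖X‖ < 1) : v - X ≠ 0 := by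
  intro h
  rw [sub_eq_zero] at h
  subst h
  exact hX.ne hv

theorem one_sub_mul_ne_zero {t v : ℂ} (ht : ‖t‖ < 1) (hv : ‖v‖ ≤ 1) : 1 - t * v ≠ 0 := by
  intro h
  have h1 : t * v = 1 := (sub_eq_zero.1 h).symm
  have h2 : ‖t‖ * ‖v‖ = 1 := by rw [← norm_mul, h1, norm_one]
  nlinarith [norm_nonneg t, norm_nonneg v]

theorem contour_cauchy_inside {U V : ℂ → ℂ} (hU : DiffContOnCl ℂ U (Metric.ball 0 1))
    (hV : DiffContOnCl ℂ V (Metric.ball 0 1)) {ζ : ℂ} (hζ : ‖ζ‖ < 1) :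
    contour (fun ξ => ξ / (ξ ^ 2 - ζ ^ 2)) (boundarySum U V)
      = 2 * Real.pi * Complex.I * (U 0 + V (ζ ^ 2)) := by
  have hX : ‖ζ ^ 2‖ < 1 := by
    rw [norm_pow]
    exact pow_lt_one₀ (norm_nonneg _) hζ two_ne_zero
  have hA : DiffContOnCl ℂ (fun v => (1 - ζ ^ 2 * v)⁻¹) (Metric.ball 0 1) := by
    refine DiffContOnCl.inv (Differentiable.diffContOnCl (by fun_prop)) fun v hv => ?_
    rw [closure_ball _ one_ne_zero] at hv
    exact one_sub_mul_ne_zero hX (by simpa using hv)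
  rw [contour_boundarySum (A := fun v => (1 - ζ ^ 2 * v)⁻¹) (B := fun v => v / (v - ζ ^ 2)) hU hV
    (continuousOn_sphere_of_diffContOnCl hA), circleAverage_unit_cauchy hV hX,
    circleAverage_unit_of_diffContOnCl (diffContOnCl_mul hA hU)]
  · simp
  · exact ContinuousOn.div continuousOn_id (by fun_prop) fun v hv =>
      sub_ne_zero_of_norm_lt_one (by simpa using hv) hX
  · intro ξ hξ
    have h0 := ne_zero_of_norm_eq_one hξ
    have h1 : ξ ^ 2 - ζ ^ 2 ≠ 0 := sub_ne_zero_of_norm_lt_one (by simp [hξ]) hX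
    field_simp
  · intro ξ hξ
    ring

theorem contour_cauchy_outside {U V : ℂ → ℂ} (hU : DiffContOnCl ℂ U (Metric.ball 0 1))
    (hV : DiffContOnCl ℂ V (Metric.ball 0 1)) {ζ : ℂ} (hζ : 1 < ‖ζ‖) :
    contour (fun ξ => ξ / (ξ ^ 2 - ζ ^ 2)) (boundarySum U V)
      = 2 * Real.pi * Complex.I * (U 0 - U ((ζ ^ 2)⁻¹)) := by
  have hζ0 : ζ ≠ 0 := by
    rintro rfl
    simp at hζ
    linarith
  have hX : ‖(ζ ^ 2)⁻¹‖ < 1 := by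
    rw [norm_inv, norm_pow]
    exact inv_lt_one_of_one_lt₀ (one_lt_pow₀ hζ two_ne_zero)
  have hB : DiffContOnCl ℂ (fun v => (-(ζ ^ 2)⁻¹) * (v * (1 - (ζ ^ 2)⁻¹ * v)⁻¹))
      (Metric.ball 0 1) := by
    have h1 : DiffContOnCl ℂ (fun v => (1 - (ζ ^ 2)⁻¹ * v)⁻¹) (Metric.ball 0 1) := by
      refine DiffContOnCl.inv (Differentiable.diffContOnCl (by fun_prop)) fun v hv => ?_
      rw [closure_ball _ one_ne_zero] at hv
      exact one_sub_mul_ne_zero hX (by simpa using hv)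
    have h2 : DiffContOnCl ℂ (fun v : ℂ => (-(ζ ^ 2)⁻¹) * v) (Metric.ball 0 1) :=
      Differentiable.diffContOnCl (by fun_prop)
    have h3 := h2.smul h1
    simpa only [smul_eq_mul, mul_assoc] using h3
  have hfrac : ContinuousOn (fun v : ℂ => v / (v - (ζ ^ 2)⁻¹)) (Metric.sphere 0 1) :=
    ContinuousOn.div continuousOn_id (by fun_prop) fun v hv =>
      sub_ne_zero_of_norm_lt_one (by simpa using hv) hX
  rw [contour_boundarySum (A := fun v => 1 - v / (v - (ζ ^ 2)⁻¹))
    (B := fun v => (-(ζ ^ 2)⁻¹) * (v * (1 - (ζ ^ 2)⁻¹ * v)⁻¹)) hU hV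
    (continuousOn_const.sub hfrac) (continuousOn_sphere_of_diffContOnCl hB),
    circleAverage_unit_of_diffContOnCl (diffContOnCl_mul hB hV)]
  · have h1 : (fun v => (1 - v / (v - (ζ ^ 2)⁻¹)) * U v)
        = U - fun v => v / (v - (ζ ^ 2)⁻¹) * U v := by
      funext v
      simp only [Pi.sub_apply]
      ring
    rw [h1, Real.circleAverage_sub, circleAverage_unit_cauchy hU hX,
      circleAverage_unit_of_diffContOnCl hU]
    · simp
    · exact ContinuousOn.circleIntegrable zero_le_one (continuousOn_sphere_of_diffContOnCl hU)
    · exact ContinuousOn.circleIntegrable zero_le_one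
        (hfrac.mul (continuousOn_sphere_of_diffContOnCl hU))
  · intro ξ hξ
    have h0 := ne_zero_of_norm_eq_one hξ
    have h1 : (ξ ^ 2)⁻¹ - (ζ ^ 2)⁻¹ ≠ 0 := sub_ne_zero_of_norm_lt_one (by simp [hξ]) hX
    have h2 : ξ ^ 2 - ζ ^ 2 ≠ 0 := by
      intro h
      apply h1
      rw [sub_eq_zero.1 h, sub_self]
    have h3 : ζ ^ 2 - ξ ^ 2 ≠ 0 := by
      rw [← neg_sub]
      exact neg_ne_zero.2 h2
    field_simp
    ring
  · intro ξ hξ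
    have h1 := one_sub_mul_ne_zero hX (show ‖ξ ^ 2‖ ≤ 1 by simp [hξ])
    have h2 : ξ ^ 2 - ζ ^ 2 ≠ 0 := by
      intro h
      apply h1
      rw [sub_eq_zero.1 h, inv_mul_cancel₀ (pow_ne_zero 2 hζ0), sub_self]
    have h3 : ζ ^ 2 - ξ ^ 2 ≠ 0 := by
      rw [← neg_sub]
      exact neg_ne_zero.2 h2
    field_simp
    ring

/-- The Taylor coefficients at the origin of a function holomorphic in the unit disc, as Fourier
coefficients of its boundary values. -/
noncomputable def boundaryCoeff (U : ℂ → ℂ) (k : ℕ) : ℂ :=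
  Real.circleAverage (fun v => (v ^ k)⁻¹ * U v) 0 1

theorem contour_moment_pos {U V : ℂ → ℂ} (hU : DiffContOnCl ℂ U (Metric.ball 0 1))
    (hV : DiffContOnCl ℂ V (Metric.ball 0 1)) {k : ℕ} (hk : 1 ≤ k) :
    contour (fun ξ => ξ ^ (2 * (k : ℤ) - 1)) (boundarySum U V)
      = 2 * Real.pi * Complex.I * boundaryCoeff U k := by
  have hB : DiffContOnCl ℂ (fun v : ℂ => v ^ k) (Metric.ball 0 1) :=
    Differentiable.diffContOnCl (by fun_prop)
  have hw : ∀ ξ : ℂ, ‖ξ‖ = 1 → ξ ^ (2 * (k : ℤ) - 1) * ξ = (ξ ^ 2) ^ k := by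
    intro ξ hξ
    rw [zpow_sub_one₀ (ne_zero_of_norm_eq_one hξ),
      inv_mul_cancel_right₀ (ne_zero_of_norm_eq_one hξ), ← pow_mul]
    exact_mod_cast zpow_natCast ξ (2 * k)
  rw [contour_boundarySum (A := fun v => (v ^ k)⁻¹) (B := fun v => v ^ k) hU hV ?_ (by fun_prop),
    circleAverage_unit_of_diffContOnCl (diffContOnCl_mul hB hV), boundaryCoeff]
  · simp [show k ≠ 0 by omega]
  · intro ξ hξ
    rw [hw ξ hξ]
    simp
  · exact hw
  · exact ContinuousOn.inv₀ (by fun_prop) fun v hv =>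
      pow_ne_zero _ (ne_zero_of_norm_eq_one (by simpa using hv))

theorem contour_moment_neg {U V : ℂ → ℂ} (hU : DiffContOnCl ℂ U (Metric.ball 0 1))
    (hV : DiffContOnCl ℂ V (Metric.ball 0 1)) {k : ℕ} (hk : 1 ≤ k) :
    contour (fun ξ => ξ ^ (-(2 * (k : ℤ)) - 1)) (boundarySum U V)
      = 2 * Real.pi * Complex.I * boundaryCoeff V k := by
  have hA : DiffContOnCl ℂ (fun v : ℂ => v ^ k) (Metric.ball 0 1) :=
    Differentiable.diffContOnCl (by fun_prop)
  have hw : ∀ ξ : ℂ, ‖ξ‖ = 1 → ξ ^ (-(2 * (k : ℤ)) - 1) * ξ = ((ξ ^ 2) ^ k)⁻¹ := by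
    intro ξ hξ
    rw [zpow_sub_one₀ (ne_zero_of_norm_eq_one hξ),
      inv_mul_cancel_right₀ (ne_zero_of_norm_eq_one hξ), ← pow_mul, zpow_neg]
    congr 1
  rw [contour_boundarySum (B := fun v => (v ^ k)⁻¹) (A := fun v => v ^ k) hU hV (by fun_prop) ?_,
    circleAverage_unit_of_diffContOnCl (diffContOnCl_mul hA hU), boundaryCoeff]
  · simp [show k ≠ 0 by omega]
  · intro ξ hξ
    rw [hw ξ hξ]
    simp
  · exact hw
  · exact ContinuousOn.inv₀ (by fun_prop) fun v hv =>
      pow_ne_zero _ (ne_zero_of_norm_eq_one (by simpa using hv))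

theorem contour_moment_zero {U V : ℂ → ℂ} (hU : DiffContOnCl ℂ U (Metric.ball 0 1))
    (hV : DiffContOnCl ℂ V (Metric.ball 0 1)) :
    contour (fun ξ => 1 / ξ) (boundarySum U V) = 2 * Real.pi * Complex.I * (U 0 + V 0) := by
  have hw : ∀ ξ : ℂ, ‖ξ‖ = 1 → 1 / ξ * ξ = 1 := fun ξ hξ =>
    one_div_mul_cancel (ne_zero_of_norm_eq_one hξ)
  rw [contour_boundarySum (A := fun _ => 1) (B := fun _ => 1) hU hV continuousOn_const
    continuousOn_const hw hw]
  simp only [one_mul]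
  rw [circleAverage_unit_of_diffContOnCl hU, circleAverage_unit_of_diffContOnCl hV]

theorem intervalIntegrable_contour {w : ℂ → ℂ} {ℓ : ℝ → ℂ}
    (hw : ContinuousOn w (Metric.sphere 0 1)) (hℓ : ContinuousOn ℓ (Set.Icc 0 (2 * Real.pi))) :
    IntervalIntegrable (fun θ : ℝ => w (Complex.exp (θ * Complex.I)) * ℓ θ
      * (Complex.I * Complex.exp (θ * Complex.I))) MeasureTheory.volume 0 (2 * Real.pi) := by
  refine ContinuousOn.intervalIntegrable ?_
  rw [Set.uIcc_of_le Real.two_pi_pos.le]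
  exact ((continuous_comp_circle hw).continuousOn.mul hℓ).mul (by fun_prop)

theorem contour_congr {w : ℂ → ℂ} {ℓ ℓ' : ℝ → ℂ} (h : Set.EqOn ℓ ℓ' (Set.Icc 0 (2 * Real.pi))) :
    contour w ℓ = contour w ℓ' := by
  refine intervalIntegral.integral_congr fun θ hθ => ?_
  rw [Set.uIcc_of_le Real.two_pi_pos.le] at hθ
  simp only [h hθ]

theorem contour_add_angle {w : ℂ → ℂ} {ℓ : ℝ → ℂ} (c : ℂ)
    (hw : ContinuousOn w (Metric.sphere 0 1)) (hℓ : ContinuousOn ℓ (Set.Icc 0 (2 * Real.pi))) :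
    contour w (fun θ => ℓ θ + c * θ) = contour w ℓ + c * contour w (fun θ => (θ : ℂ)) := by
  have h2 := (intervalIntegrable_contour (ℓ := fun θ : ℝ => (θ : ℂ)) hw
    (by fun_prop)).const_mul c
  have h1 := intervalIntegral.integral_add (intervalIntegrable_contour hw hℓ) h2
  rw [intervalIntegral.integral_const_mul] at h1
  unfold contour
  rw [← h1]
  refine intervalIntegral.integral_congr fun θ _ => ?_
  ring

theorem contour_zero_angle : contour (fun ξ => 1 / ξ) (fun θ => (θ : ℂ))
    = 2 * Real.pi ^ 2 * Complex.I := by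
  have h1 : contour (fun ξ => 1 / ξ) (fun θ => (θ : ℂ))
      = ∫ θ in (0 : ℝ)..(2 * Real.pi), Complex.I * ((θ : ℝ) : ℂ) := by
    refine intervalIntegral.integral_congr fun θ _ => ?_
    have := Complex.exp_ne_zero (θ * Complex.I)
    simp only
    field_simp
  rw [h1, intervalIntegral.integral_const_mul, intervalIntegral.integral_ofReal, integral_id]
  push_cast
  ring

/-- `∫₀^{2π} θ e^{2ikθ} dθ = π / (i k)` for `k ≠ 0`. -/
theorem contour_zpow_angle {k : ℤ} (hk : k ≠ 0) :
    contour (fun ξ => ξ ^ (2 * k - 1)) (fun θ => (θ : ℂ)) = Real.pi / k := by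
  have hkc : (k : ℂ) ≠ 0 := by exact_mod_cast hk
  set F : ℝ → ℂ := fun θ => (θ / (2 * k) - 1 / (4 * k ^ 2 * Complex.I))
    * Complex.exp (2 * k * Complex.I * θ) with hF
  have hderiv : ∀ θ : ℝ, HasDerivAt F
      (Complex.I * θ * Complex.exp (2 * k * Complex.I * θ)) θ := by
    intro θ
    have h1 : HasDerivAt (fun x : ℝ => (x : ℂ)) 1 θ := Complex.ofRealCLM.hasDerivAt
    have h2 := ((h1.div_const (2 * (k : ℂ))).sub_const (1 / (4 * k ^ 2 * Complex.I))).mul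
      ((h1.const_mul (2 * k * Complex.I)).cexp)
    refine h2.congr_deriv ?_
    have hI := Complex.I_ne_zero
    field_simp
    ring_nf
  have h1 : contour (fun ξ => ξ ^ (2 * k - 1)) (fun θ => (θ : ℂ))
      = ∫ θ in (0 : ℝ)..(2 * Real.pi),
        Complex.I * θ * Complex.exp (2 * k * Complex.I * θ) := by
    refine intervalIntegral.integral_congr fun θ _ => ?_
    have h0 := Complex.exp_ne_zero (θ * Complex.I)
    simp only
    rw [zpow_sub_one₀ h0, ← Complex.exp_int_mul]
    push_cast
    rw [show (2 : ℂ) * k * (θ * Complex.I) = 2 * k * Complex.I * θ by ring]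
    field_simp
  rw [h1, intervalIntegral.integral_eq_sub_of_hasDerivAt (fun θ _ => hderiv θ)
    (Continuous.intervalIntegrable (by fun_prop) _ _)]
  have h2 : Complex.exp (2 * k * Complex.I * ((2 * Real.pi : ℝ) : ℂ)) = 1 := by
    have := Complex.exp_int_mul_two_pi_mul_I (2 * k)
    rw [← this]
    push_cast
    ring_nf
  simp only [hF, h2]
  push_cast
  simp
  field_simp

/-! ### One-sided infinite matrix products -/

/-- A row `(α_k, β_k)` of the product `B_0 B_1 ⋯ B_{k-1}` of the matrices
`B_j = c_j (1, u_j x; v_j, x)`; the row of the empty product is `s`. -/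
noncomputable def halfLine (c u v : ℕ → ℂ) (s : ℂ × ℂ) (x : ℂ) : ℕ → ℂ × ℂ
  | 0 => s
  | k + 1 => (c k * ((halfLine c u v s x k).1 + v k * (halfLine c u v s x k).2),
      c k * x * (u k * (halfLine c u v s x k).1 + (halfLine c u v s x k).2))

/-- The limit of `α_k` as `k → ∞`, as a telescoping series. -/
noncomputable def halfLineLim (c u v : ℕ → ℂ) (s : ℂ × ℂ) (x : ℂ) : ℂ :=
  s.1 + ∑' k, ((halfLine c u v s x (k + 1)).1 - (halfLine c u v s x k).1)

section halfLine

variable {c u v : ℕ → ℂ} {s : ℂ × ℂ}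

theorem halfLine_norm_le (x : ℂ) (hx : ‖x‖ ≤ 1) (k : ℕ) :
    ‖(halfLine c u v s x k).1‖ + ‖(halfLine c u v s x k).2‖
      ≤ (‖s.1‖ + ‖s.2‖) * Real.exp (∑ j ∈ Finset.range k, (‖c j - 1‖ + ‖u j‖ + ‖v j‖)) := by
  induction k with
  | zero => simp [halfLine]
  | succ k ih =>
    set a := ‖(halfLine c u v s x k).1‖
    set b := ‖(halfLine c u v s x k).2‖
    have ha : 0 ≤ a := norm_nonneg _
    have hb : 0 ≤ b := norm_nonneg _
    have h1 : ‖(halfLine c u v s x (k + 1)).1‖ ≤ ‖c k‖ * (a + ‖v k‖ * b) := by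
      simp only [halfLine, norm_mul]
      gcongr
      refine (norm_add_le _ _).trans ?_
      rw [norm_mul]
    have h2 : ‖(halfLine c u v s x (k + 1)).2‖ ≤ ‖c k‖ * (‖u k‖ * a + b) := by
      simp only [halfLine, norm_mul]
      have : ‖u k * (halfLine c u v s x k).1 + (halfLine c u v s x k).2‖ ≤ ‖u k‖ * a + b := by
        refine (norm_add_le _ _).trans ?_
        rw [norm_mul]
      calc ‖c k‖ * ‖x‖ * ‖u k * (halfLine c u v s x k).1 + (halfLine c u v s x k).2‖
          ≤ ‖c k‖ * 1 * (‖u k‖ * a + b) := by gcongr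
        _ = _ := by ring
    have hc : ‖c k‖ ≤ 1 + ‖c k - 1‖ := by
      have := norm_add_le (1 : ℂ) (c k - 1)
      simpa using this
    have h3 : (1 + ‖c k - 1‖) * (1 + (‖u k‖ + ‖v k‖))
        ≤ Real.exp (‖c k - 1‖ + ‖u k‖ + ‖v k‖) := by
      rw [add_assoc, Real.exp_add]
      have e1 := Real.add_one_le_exp ‖c k - 1‖
      have e2 := Real.add_one_le_exp (‖u k‖ + ‖v k‖)
      have := norm_nonneg (c k - 1)
      have := norm_nonneg (u k)
      have := norm_nonneg (v k)
      gcongr <;> linarith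
    rw [Finset.sum_range_succ, Real.exp_add, ← mul_assoc]
    calc ‖(halfLine c u v s x (k + 1)).1‖ + ‖(halfLine c u v s x (k + 1)).2‖
        ≤ ‖c k‖ * (a + ‖v k‖ * b) + ‖c k‖ * (‖u k‖ * a + b) := add_le_add h1 h2
      _ ≤ ‖c k‖ * ((a + b) * (1 + (‖u k‖ + ‖v k‖))) := by
          rw [← mul_add]
          gcongr
          nlinarith [norm_nonneg (u k), norm_nonneg (v k), mul_nonneg ha (norm_nonneg (v k)),
            mul_nonneg hb (norm_nonneg (u k))]
      _ ≤ (1 + ‖c k - 1‖) * ((a + b) * (1 + (‖u k‖ + ‖v k‖))) := by gcongr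
      _ = (a + b) * ((1 + ‖c k - 1‖) * (1 + (‖u k‖ + ‖v k‖))) := by ring
      _ ≤ _ := by gcongr

theorem halfLine_fst_succ_sub (x : ℂ) (k : ℕ) :
    (halfLine c u v s x (k + 1)).1 - (halfLine c u v s x k).1
      = (c k - 1) * (halfLine c u v s x k).1
        + (c k - 1) * v k * (halfLine c u v s x k).2 + v k * (halfLine c u v s x k).2 := by
  simp only [halfLine]
  ring

variable (hc : Summable fun k => ‖c k - 1‖) (hu : Summable fun k => ‖u k‖)
  (hv : Summable fun k => ‖v k‖)
include hc hu hv

theorem exists_summable_bound_halfLine (s : ℂ × ℂ) : ∃ b : ℕ → ℝ, Summable b ∧ ∀ k x, ‖x‖ ≤ 1 →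
    ‖(halfLine c u v s x (k + 1)).1 - (halfLine c u v s x k).1‖ ≤ b k := by
  set d : ℕ → ℝ := fun j => ‖c j - 1‖ + ‖u j‖ + ‖v j‖ with hd
  have hds : Summable d := (hc.add hu).add hv
  set K := (‖s.1‖ + ‖s.2‖) * Real.exp (∑' j, d j) with hK
  have hK0 : 0 ≤ K := by positivity
  have hbd : ∀ k x, ‖x‖ ≤ 1 →
      ‖(halfLine c u v s x k).1‖ + ‖(halfLine c u v s x k).2‖ ≤ K := by
    intro k x hx
    refine (halfLine_norm_le x hx k).trans ?_
    refine mul_le_mul_of_nonneg_left (Real.exp_le_exp.2 ?_) (by positivity)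
    exact hds.sum_le_tsum _ fun j _ => by positivity
  set V := ∑' j, ‖v j‖ with hV
  have hvV : ∀ k, ‖v k‖ ≤ V := fun k => hv.le_tsum k fun j _ => norm_nonneg _
  refine ⟨fun k => ‖c k - 1‖ * K + ‖c k - 1‖ * (V * K) + ‖v k‖ * K,
    ((hc.mul_right _).add (hc.mul_right _)).add (hv.mul_right _), fun k x hx => ?_⟩
  have h1 := hbd k x hx
  have ha : ‖(halfLine c u v s x k).1‖ ≤ K := by
    linarith [norm_nonneg (halfLine c u v s x k).2]
  have hb : ‖(halfLine c u v s x k).2‖ ≤ K := by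
    linarith [norm_nonneg (halfLine c u v s x k).1]
  rw [halfLine_fst_succ_sub]
  refine (norm_add₃_le).trans ?_
  rw [norm_mul, norm_mul, norm_mul, norm_mul, mul_assoc]
  have hV0 : 0 ≤ V := (norm_nonneg _).trans (hvV k)
  have e1 : ‖v k‖ * ‖(halfLine c u v s x k).2‖ ≤ V * K :=
    mul_le_mul (hvV k) hb (norm_nonneg _) hV0
  exact add_le_add (add_le_add (mul_le_mul_of_nonneg_left ha (norm_nonneg _))
    (mul_le_mul_of_nonneg_left e1 (norm_nonneg _))) (mul_le_mul_of_nonneg_left hb (norm_nonneg _))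

theorem tendsto_halfLine {x : ℂ} (hx : ‖x‖ ≤ 1) :
    Tendsto (fun k => (halfLine c u v s x k).1) atTop (𝓝 (halfLineLim c u v s x)) := by
  obtain ⟨b, hb, hle⟩ := exists_summable_bound_halfLine hc hu hv s
  have hs : Summable fun k => (halfLine c u v s x (k + 1)).1 - (halfLine c u v s x k).1 :=
    Summable.of_norm_bounded hb fun k => hle k x hx
  have h1 := hs.hasSum.tendsto_sum_nat.const_add s.1
  refine h1.congr fun n => ?_
  rw [Finset.sum_range_sub (fun k => (halfLine c u v s x k).1)]
  simp [halfLine]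

omit hc hu hv in
theorem differentiable_halfLine (k : ℕ) :
    Differentiable ℂ (fun x => (halfLine c u v s x k).1) ∧
      Differentiable ℂ (fun x => (halfLine c u v s x k).2) := by
  induction k with
  | zero => simp [halfLine]
  | succ k ih =>
    obtain ⟨h1, h2⟩ := ih
    simp only [halfLine]
    constructor <;> fun_prop

theorem diffContOnCl_halfLineLim :
    DiffContOnCl ℂ (halfLineLim c u v s) (Metric.ball 0 1) := by
  obtain ⟨b, hb, hle⟩ := exists_summable_bound_halfLine hc hu hv s
  have hd : ∀ k, Differentiable ℂ
      (fun x => (halfLine c u v s x (k + 1)).1 - (halfLine c u v s x k).1) := fun k =>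
    (differentiable_halfLine (k + 1)).1.sub (differentiable_halfLine k).1
  refine DiffContOnCl.const_add ⟨?_, ?_⟩ s.1
  · refine Complex.differentiableOn_tsum_of_summable_norm hb (fun k => (hd k).differentiableOn)
      Metric.isOpen_ball fun k x hx => hle k x ?_
    simpa using (Metric.mem_ball.1 hx).le
  · refine continuousOn_tsum (fun k => (hd k).continuous.continuousOn) hb fun k x hx => hle k x ?_
    rw [closure_ball _ one_ne_zero] at hx
    simpa using hx

end halfLine

/-! ### Jost solutions in the variable `x = z⁻²` -/

/-- The row of the identity matrix with index `i`. -/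
def unitRow : Fin 2 → ℂ × ℂ := ![(1, 0), (0, 1)]

/-- The left half-line product of the reduced Lax matrices, sites `-1, -2, …`. -/
noncomputable def leftRow (q p : ℤ → ℂ) (i : Fin 2) : ℂ → ℕ → ℂ × ℂ :=
  halfLine (fun k => (normF q p (-1 - k))⁻¹) (fun k => q (-1 - k)) (fun k => p (-1 - k))
    (unitRow i)

/-- The right half-line product of the transposed reduced Lax matrices, sites `0, 1, …`. -/
noncomputable def rightRow (q p : ℤ → ℂ) (i : Fin 2) : ℂ → ℕ → ℂ × ℂ :=
  halfLine (fun k => (normF q p k)⁻¹) (fun k => p k) (fun k => q k) (unitRow i)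

/-- The components of `T₋⁽¹⁾(0)` as functions of `x = z⁻²` (up to powers of `z`). -/
noncomputable def leftJost (q p : ℤ → ℂ) (i : Fin 2) : ℂ → ℂ :=
  halfLineLim (fun k => (normF q p (-1 - k))⁻¹) (fun k => q (-1 - k)) (fun k => p (-1 - k))
    (unitRow i)

/-- The components of `T₊⁽²⁾(0)` as functions of `x = z⁻²` (up to powers of `z`, sign and
order). -/
noncomputable def rightJost (q p : ℤ → ℂ) (i : Fin 2) : ℂ → ℂ :=
  halfLineLim (fun k => (normF q p k)⁻¹) (fun k => p k) (fun k => q k) (unitRow i)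

/-- The transmission coefficient as a function of `x = z⁻²`. -/
noncomputable def transm (q p : ℤ → ℂ) (x : ℂ) : ℂ :=
  leftJost q p 0 x * rightJost q p 0 x + x * (leftJost q p 1 x * rightJost q p 1 x)

section potentials

variable {q p : ℤ → ℂ} (hq : Summable fun n => ‖q n‖) (hp : Summable fun n => ‖p n‖)
  (hqp : ∀ n, 1 - q n * p n ≠ 0)

theorem normF_ne_zero (hqp : ∀ n, 1 - q n * p n ≠ 0) (n : ℤ) : normF q p n ≠ 0 := by
  simp [normF, Complex.cpow_eq_zero_iff, hqp n]

theorem normF_sq (n : ℤ) : normF q p n ^ 2 = 1 - q n * p n := by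
  rw [normF, ← Complex.cpow_mul_nat]
  norm_num

theorem normF_swap (n : ℤ) : normF q p n = normF p q n := by
  simp [normF, mul_comm]

/-- Taking the principal square root halves the principal logarithm. -/
theorem log_normF (n : ℤ) : Complex.log (normF q p n) = 1 / 2 * Complex.log (1 - q n * p n) := by
  rcases eq_or_ne (1 - q n * p n) 0 with h | h
  · simp [normF, h]
  rw [normF, Complex.cpow_def_of_ne_zero h, Complex.log_exp, mul_comm]
  · have := Complex.neg_pi_lt_log_im (1 - q n * p n)
    have h2 : (Complex.log (1 - q n * p n) * (1 / 2)).im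
        = (Complex.log (1 - q n * p n)).im / 2 := by
      rw [show (1 / 2 : ℂ) = ((1 / 2 : ℝ) : ℂ) by push_cast; rfl, Complex.im_mul_ofReal]
      ring
    rw [h2]
    linarith [Real.pi_pos]
  · have := Complex.log_im_le_pi (1 - q n * p n)
    have h2 : (Complex.log (1 - q n * p n) * (1 / 2)).im
        = (Complex.log (1 - q n * p n)).im / 2 := by
      rw [show (1 / 2 : ℂ) = ((1 / 2 : ℝ) : ℂ) by push_cast; rfl, Complex.im_mul_ofReal]
      ring
    rw [h2]
    linarith [Real.pi_pos]

include hq hp in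
theorem summable_log_one_sub : Summable fun n => Complex.log (1 - q n * p n) := by
  have h1 : Summable fun n => -(q n * p n) := by
    refine Summable.neg (Summable.of_norm_bounded (hq.mul_right (∑' k, ‖p k‖)) fun n => ?_)
    rw [norm_mul]
    exact mul_le_mul_of_nonneg_left (hp.le_tsum n fun j _ => norm_nonneg _) (norm_nonneg _)
  simpa [sub_eq_add_neg] using Complex.summable_log_one_add_of_summable h1

include hq hp in
theorem summable_log_normF : Summable fun n => Complex.log (normF q p n) := by
  simp only [log_normF]
  exact (summable_log_one_sub hq hp).mul_left _

include hq hp hqp in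
theorem summable_normF_inv_sub_one : Summable fun n => ‖(normF q p n)⁻¹ - 1‖ := by
  have hs := (summable_log_normF hq hp).norm
  refine Summable.of_norm_bounded_eventually (hs.mul_left 2) ?_
  have h0 := hs.tendsto_cofinite_zero
  filter_upwards [h0.eventually (ge_mem_nhds one_pos)] with n hn
  have h1 : (normF q p n)⁻¹ = Complex.exp (-Complex.log (normF q p n)) := by
    rw [Complex.exp_neg, Complex.exp_log (normF_ne_zero hqp n)]
  have h2 := Complex.norm_exp_sub_one_le (x := -Complex.log (normF q p n)) (by simpa using hn)
  rw [h1, norm_norm]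
  simpa using h2

theorem injective_natCast_int : Function.Injective (fun k : ℕ => (k : ℤ)) :=
  Nat.cast_injective

theorem injective_neg_one_sub : Function.Injective (fun k : ℕ => (-1 - k : ℤ)) := by
  intro a b h
  simpa using h

include hq hp hqp

theorem tendsto_leftRow (i : Fin 2) {x : ℂ} (hx : ‖x‖ ≤ 1) :
    Tendsto (fun k => (leftRow q p i x k).1) atTop (𝓝 (leftJost q p i x)) :=
  tendsto_halfLine ((summable_normF_inv_sub_one hq hp hqp).comp_injective injective_neg_one_sub)
    (hq.comp_injective injective_neg_one_sub) (hp.comp_injective injective_neg_one_sub) hx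

theorem tendsto_rightRow (i : Fin 2) {x : ℂ} (hx : ‖x‖ ≤ 1) :
    Tendsto (fun k => (rightRow q p i x k).1) atTop (𝓝 (rightJost q p i x)) :=
  tendsto_halfLine ((summable_normF_inv_sub_one hq hp hqp).comp_injective injective_natCast_int)
    (hp.comp_injective injective_natCast_int) (hq.comp_injective injective_natCast_int) hx

theorem diffContOnCl_leftJost (i : Fin 2) : DiffContOnCl ℂ (leftJost q p i) (Metric.ball 0 1) :=
  diffContOnCl_halfLineLim
    ((summable_normF_inv_sub_one hq hp hqp).comp_injective injective_neg_one_sub)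
    (hq.comp_injective injective_neg_one_sub) (hp.comp_injective injective_neg_one_sub)

theorem diffContOnCl_rightJost (i : Fin 2) : DiffContOnCl ℂ (rightJost q p i) (Metric.ball 0 1) :=
  diffContOnCl_halfLineLim
    ((summable_normF_inv_sub_one hq hp hqp).comp_injective injective_natCast_int)
    (hp.comp_injective injective_natCast_int) (hq.comp_injective injective_natCast_int)

theorem diffContOnCl_transm : DiffContOnCl ℂ (transm q p) (Metric.ball 0 1) :=
  (diffContOnCl_mul (diffContOnCl_leftJost hq hp hqp 0) (diffContOnCl_rightJost hq hp hqp 0)).add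
    (diffContOnCl_mul differentiable_id.diffContOnCl
      (diffContOnCl_mul (diffContOnCl_leftJost hq hp hqp 1) (diffContOnCl_rightJost hq hp hqp 1)))

end potentials

/-! ### The transition matrix -/

section transition

variable {q p : ℤ → ℂ}

theorem laxProd_succ_right (m : ℤ) (z : ℂ) (k : ℕ) :
    laxProd q p m z (k + 1) = laxProd q p (m + 1) z k * lax q p m z := by
  induction k with
  | zero => simp [laxProd]
  | succ k ih =>
    rw [laxProd, ih, ← mul_assoc, laxProd]
    congr 3
    push_cast
    ring

theorem det_lax (hqp : ∀ n, 1 - q n * p n ≠ 0) (n : ℤ) {z : ℂ} (hz : z ≠ 0) :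
    (lax q p n z).det = 1 := by
  have h := normF_ne_zero hqp n
  rw [lax, Matrix.det_smul, Matrix.det_fin_two_of, mul_inv_cancel₀ hz, ← normF_sq n]
  simp [h]

theorem det_laxProd (hqp : ∀ n, 1 - q n * p n ≠ 0) (m : ℤ) {z : ℂ} (hz : z ≠ 0) (k : ℕ) :
    (laxProd q p m z k).det = 1 := by
  induction k with
  | zero => simp [laxProd]
  | succ k ih => rw [laxProd, Matrix.det_mul, det_lax hqp _ hz, ih, one_mul]

theorem isUnit_det_of_eq_one {M : Matrix (Fin 2) (Fin 2) ℂ} (h : M.det = 1) : IsUnit M.det := by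
  rw [h]
  exact isUnit_one

theorem det_transition (hqp : ∀ n, 1 - q n * p n ≠ 0) (n m : ℤ) {z : ℂ} (hz : z ≠ 0) :
    (transition q p n m z).det = 1 := by
  unfold transition
  split_ifs
  · exact det_laxProd hqp _ hz _
  · rw [Matrix.det_nonsing_inv, det_laxProd hqp _ hz, Ring.inverse_one]

theorem transition_succ_zero (hqp : ∀ n, 1 - q n * p n ≠ 0) (n : ℤ) {z : ℂ} (hz : z ≠ 0) :
    transition q p (n + 1) 0 z = lax q p n z * transition q p n 0 z := by
  rcases le_or_gt 0 n with hn | hn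
  · rw [transition, transition, if_pos (by omega), if_pos hn]
    rw [show (n + 1 - 0).toNat = (n - 0).toNat + 1 by omega, laxProd]
    rw [show (0 + ((n - 0).toNat : ℤ)) = n by omega]
  · have h1 : transition q p (n + 1) 0 z = (laxProd q p (n + 1) z (0 - (n + 1)).toNat)⁻¹ := by
      unfold transition
      split_ifs with h
      · rw [show n + 1 = 0 by omega]
        simp [laxProd]
      · rfl
    rw [h1, transition, if_neg (by omega)]
    rw [show (0 - n).toNat = (0 - (n + 1)).toNat + 1 by omega, laxProd_succ_right,
      Matrix.mul_inv_rev,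
      Matrix.mul_nonsing_inv_cancel_left _ _ (isUnit_det_of_eq_one (det_lax hqp n hz))]

theorem laxProd_eq_transition (hqp : ∀ n, 1 - q n * p n ≠ 0) (m : ℤ) {z : ℂ} (hz : z ≠ 0)
    (k : ℕ) :
    laxProd q p m z k = transition q p (m + k) 0 z * (transition q p m 0 z)⁻¹ := by
  induction k with
  | zero =>
    rw [laxProd, Nat.cast_zero, add_zero,
      Matrix.mul_nonsing_inv _ (isUnit_det_of_eq_one (det_transition hqp m 0 hz))]
  | succ k ih =>
    rw [laxProd, ih, ← mul_assoc, ← transition_succ_zero hqp _ hz]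
    push_cast
    rw [add_assoc]

theorem transition_eq_mul_inv (hqp : ∀ n, 1 - q n * p n ≠ 0) (n m : ℤ) {z : ℂ} (hz : z ≠ 0) :
    transition q p n m z = transition q p n 0 z * (transition q p m 0 z)⁻¹ := by
  conv_lhs => unfold transition
  split_ifs with h
  · rw [laxProd_eq_transition hqp m hz, show m + ((n - m).toNat : ℤ) = n by omega]
  · rw [laxProd_eq_transition hqp n hz, show n + ((m - n).toNat : ℤ) = m by omega,
      Matrix.mul_inv_rev,
      Matrix.nonsing_inv_nonsing_inv _ (isUnit_det_of_eq_one (det_transition hqp n 0 hz))]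

theorem transition_eq_mul (hqp : ∀ n, 1 - q n * p n ≠ 0) (n m : ℤ) {z : ℂ} (hz : z ≠ 0) :
    transition q p n m z = transition q p n 0 z * transition q p 0 m z := by
  rw [transition_eq_mul_inv hqp n m hz, transition_eq_mul_inv hqp 0 m hz]
  simp [transition, laxProd]

/-- The conjugation `L(n, z) = z D B D⁻¹`, `D = diag(1, z⁻¹)`, turns products of Lax matrices to
the left of the origin into products of matrices that depend on `z⁻²` only. -/
theorem laxProd_neg_eq {z : ℂ} (hz : z ≠ 0) (k : ℕ) :
    laxProd q p (-k) z k = z ^ k •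
      !![(leftRow q p 0 (z ^ 2)⁻¹ k).1, z * (leftRow q p 0 (z ^ 2)⁻¹ k).2;
        z⁻¹ * (leftRow q p 1 (z ^ 2)⁻¹ k).1, (leftRow q p 1 (z ^ 2)⁻¹ k).2] := by
  induction k with
  | zero =>
    ext i j
    fin_cases i <;> fin_cases j <;> simp [laxProd, leftRow, halfLine, unitRow]
  | succ k ih =>
    rw [laxProd_succ_right, show (-((k + 1 : ℕ) : ℤ) + 1) = -k by push_cast; ring, ih,
      show (-((k + 1 : ℕ) : ℤ)) = -1 - k by push_cast; ring]
    ext i j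
    fin_cases i <;> fin_cases j <;>
      simp [lax, leftRow, halfLine, Matrix.mul_apply, Fin.sum_univ_two, pow_succ] <;>
      field_simp

/-- To the right of the origin it is the product of the transposed matrices, with `q` and `p`
exchanged, that is built up from the left. -/
theorem laxProd_zero_eq {z : ℂ} (hz : z ≠ 0) (k : ℕ) :
    laxProd q p 0 z k = z ^ k •
      !![(rightRow q p 0 (z ^ 2)⁻¹ k).1, z⁻¹ * (rightRow q p 1 (z ^ 2)⁻¹ k).1;
        z * (rightRow q p 0 (z ^ 2)⁻¹ k).2, (rightRow q p 1 (z ^ 2)⁻¹ k).2] := by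
  induction k with
  | zero =>
    ext i j
    fin_cases i <;> fin_cases j <;> simp [laxProd, rightRow, halfLine, unitRow]
  | succ k ih =>
    rw [laxProd, ih, zero_add]
    ext i j
    fin_cases i <;> fin_cases j <;>
      simp [lax, rightRow, halfLine, Matrix.mul_apply, Fin.sum_univ_two, pow_succ] <;>
      field_simp

/-! ### Existence of the Jost solutions -/

theorem tendsto_int_atTop_of_nat {α : Type*} {l : Filter α} {F : ℤ → α}
    (h : Tendsto (fun k : ℕ => F k) atTop l) : Tendsto F atTop l := by
  have h1 : Tendsto Int.toNat atTop atTop := tendsto_atTop.2 fun b => by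
    filter_upwards [eventually_ge_atTop (b : ℤ)] with m hm
    omega
  refine (h.comp h1).congr' ?_
  filter_upwards [eventually_ge_atTop 0] with m hm
  simp [Int.toNat_of_nonneg hm]

theorem tendsto_int_atBot_of_nat {α : Type*} {l : Filter α} {F : ℤ → α}
    (h : Tendsto (fun k : ℕ => F (-k)) atTop l) : Tendsto F atBot l := by
  have h1 := (tendsto_int_atTop_of_nat (F := fun m => F (-m)) h).comp tendsto_neg_atBot_atTop
  simpa [Function.comp_def] using h1

theorem mul_freeE_col_zero (M : Matrix (Fin 2) (Fin 2) ℂ) (m : ℤ) (z : ℂ) (i : Fin 2) :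
    (M * freeE m z) i 0 = M i 0 * z ^ m := by
  simp [Matrix.mul_apply, Fin.sum_univ_two, freeE]

theorem mul_freeE_col_one (M : Matrix (Fin 2) (Fin 2) ℂ) (m : ℤ) (z : ℂ) (i : Fin 2) :
    (M * freeE m z) i 1 = M i 1 * z ^ (-m) := by
  simp [Matrix.mul_apply, Fin.sum_univ_two, freeE]

theorem transition_zero_neg (k : ℕ) (z : ℂ) :
    transition q p 0 (-k) z = laxProd q p (-k) z k := by
  rw [transition, if_pos (by omega)]
  simp

theorem transition_zero_natCast (k : ℕ) (z : ℂ) :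
    transition q p 0 k z = (laxProd q p 0 z k)⁻¹ := by
  unfold transition
  split_ifs with h
  · obtain rfl : k = 0 := by omega
    simp [laxProd]
  · simp

/-- The index swap `0 ↔ 1`. -/
def flip : Fin 2 ≃ Fin 2 := Equiv.swap 0 1

theorem lax_flip (n : ℤ) (z : ℂ) : lax q p n z = (lax p q n z⁻¹).submatrix flip flip := by
  ext i j
  fin_cases i <;> fin_cases j <;> simp [lax, normF_swap (q := q), flip]

theorem laxProd_flip (m : ℤ) (z : ℂ) (k : ℕ) :
    laxProd q p m z k = (laxProd p q m z⁻¹ k).submatrix flip flip := by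
  induction k with
  | zero => simp [laxProd]
  | succ k ih => rw [laxProd, laxProd, ih, lax_flip, Matrix.submatrix_mul_equiv]

theorem transition_flip (n m : ℤ) (z : ℂ) :
    transition q p n m z = (transition p q n m z⁻¹).submatrix flip flip := by
  unfold transition
  split_ifs
  · exact laxProd_flip _ _ _
  · rw [laxProd_flip, Matrix.inv_submatrix_equiv]

theorem freeE_flip (m : ℤ) (z : ℂ) : freeE m z = (freeE m z⁻¹).submatrix flip flip := by
  ext i j
  fin_cases i <;> fin_cases j <;> simp [freeE, flip]

/-- Exchanging `q` with `p` and `z` with `z⁻¹` exchanges the two rows and the two columns. -/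
theorem transition_mul_freeE_flip (n m : ℤ) (z : ℂ) (i j : Fin 2) :
    (transition q p n m z * freeE m z) i j
      = (transition p q n m z⁻¹ * freeE m z⁻¹) (flip i) (flip j) := by
  rw [transition_flip, freeE_flip, Matrix.submatrix_mul_equiv, Matrix.submatrix_apply]

theorem jost_flip (l : Filter ℤ) (n : ℤ) (z : ℂ) (i j : Fin 2) :
    jost q p l n z i j = jost p q l n z⁻¹ (flip i) (flip j) := by
  simp only [jost, Matrix.of_apply, transition_mul_freeE_flip (q := q)]

theorem norm_inv_sq_le {z : ℂ} (hz : 1 ≤ ‖z‖) : ‖(z ^ 2)⁻¹‖ ≤ 1 := by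
  rw [norm_inv, norm_pow]
  exact inv_le_one_of_one_le₀ (one_le_pow₀ hz)

theorem ne_zero_of_one_le_norm {z : ℂ} (hz : 1 ≤ ‖z‖) : z ≠ 0 := by
  rintro rfl
  simp at hz
  linarith

end transition

section jost

variable {q p : ℤ → ℂ} (hq : Summable fun n => ‖q n‖) (hp : Summable fun n => ‖p n‖)
  (hqp : ∀ n, 1 - q n * p n ≠ 0)
include hq hp hqp

/-- The first column of `T₋(0, z)`. -/
theorem tendsto_left_zero {z : ℂ} (hz : 1 ≤ ‖z‖) (i : Fin 2) :
    Tendsto (fun m : ℤ => (transition q p 0 m z * freeE m z) i 0) atBot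
      (𝓝 (![leftJost q p 0 (z ^ 2)⁻¹, z⁻¹ * leftJost q p 1 (z ^ 2)⁻¹] i)) := by
  have hz0 := ne_zero_of_one_le_norm hz
  refine tendsto_int_atBot_of_nat ?_
  have h : ∀ k : ℕ, (transition q p 0 (-k) z * freeE (-k) z) i 0
      = ![(leftRow q p 0 (z ^ 2)⁻¹ k).1, z⁻¹ * (leftRow q p 1 (z ^ 2)⁻¹ k).1] i := by
    intro k
    have hzk : z ^ k ≠ 0 := pow_ne_zero _ hz0
    rw [mul_freeE_col_zero, transition_zero_neg, laxProd_neg_eq hz0]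
    fin_cases i <;> simp <;> field_simp
  simp only [h]
  have h0 := tendsto_leftRow hq hp hqp 0 (norm_inv_sq_le hz)
  have h1 := tendsto_leftRow hq hp hqp 1 (norm_inv_sq_le hz)
  fin_cases i
  · simpa using h0
  · simpa using h1.const_mul z⁻¹

/-- The second column of `T₊(0, z)`. -/
theorem tendsto_right_zero {z : ℂ} (hz : 1 ≤ ‖z‖) (i : Fin 2) :
    Tendsto (fun m : ℤ => (transition q p 0 m z * freeE m z) i 1) atTop
      (𝓝 (![-(z⁻¹ * rightJost q p 1 (z ^ 2)⁻¹), rightJost q p 0 (z ^ 2)⁻¹] i)) := by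
  have hz0 := ne_zero_of_one_le_norm hz
  refine tendsto_int_atTop_of_nat ?_
  have h : ∀ k : ℕ, (transition q p 0 k z * freeE k z) i 1
      = ![-(z⁻¹ * (rightRow q p 1 (z ^ 2)⁻¹ k).1), (rightRow q p 0 (z ^ 2)⁻¹ k).1] i := by
    intro k
    have hzk : z ^ k ≠ 0 := pow_ne_zero _ hz0
    rw [mul_freeE_col_one, transition_zero_natCast, Matrix.inv_def, det_laxProd hqp _ hz0,
      Ring.inverse_one, one_smul, Matrix.adjugate_fin_two, laxProd_zero_eq hz0]
    fin_cases i <;> simp <;> field_simp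
  simp only [h]
  have h0 := tendsto_rightRow hq hp hqp 0 (norm_inv_sq_le hz)
  have h1 := tendsto_rightRow hq hp hqp 1 (norm_inv_sq_le hz)
  fin_cases i
  · simpa using (h1.const_mul z⁻¹).neg
  · simpa using h0

omit hq hp in
theorem tendsto_transition_of_zero {z : ℂ} (hz : z ≠ 0) {l : Filter ℤ} {j : Fin 2} {a : Fin 2 → ℂ}
    (h : ∀ i, Tendsto (fun m : ℤ => (transition q p 0 m z * freeE m z) i j) l (𝓝 (a i)))
    (n : ℤ) (i : Fin 2) :
    Tendsto (fun m : ℤ => (transition q p n m z * freeE m z) i j) l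
      (𝓝 (∑ k, transition q p n 0 z i k * a k)) := by
  have h1 := tendsto_finsetSum Finset.univ fun k _ =>
    (h k).const_mul (transition q p n 0 z i k)
  refine h1.congr fun m => ?_
  rw [transition_eq_mul hqp n m hz, mul_assoc, Matrix.mul_apply]

theorem tendsto_jost_left (n : ℤ) {z : ℂ} (hz : 1 ≤ ‖z‖) (i : Fin 2) :
    Tendsto (fun m : ℤ => (transition q p n m z * freeE m z) i 0) atBot
      (𝓝 (jost q p atBot n z i 0)) :=
  tendsto_nhds_limUnder ⟨_, tendsto_transition_of_zero hqp (ne_zero_of_one_le_norm hz)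
    (tendsto_left_zero hq hp hqp hz) n i⟩

theorem tendsto_jost_right (n : ℤ) {z : ℂ} (hz : 1 ≤ ‖z‖) (i : Fin 2) :
    Tendsto (fun m : ℤ => (transition q p n m z * freeE m z) i 1) atTop
      (𝓝 (jost q p atTop n z i 1)) :=
  tendsto_nhds_limUnder ⟨_, tendsto_transition_of_zero hqp (ne_zero_of_one_le_norm hz)
    (tendsto_right_zero hq hp hqp hz) n i⟩

end jost

section jost'

variable {q p : ℤ → ℂ}

theorem one_sub_swap (hqp : ∀ n, 1 - q n * p n ≠ 0) (n : ℤ) : 1 - p n * q n ≠ 0 := by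
  rw [mul_comm]
  exact hqp n

variable (hq : Summable fun n => ‖q n‖) (hp : Summable fun n => ‖p n‖)
  (hqp : ∀ n, 1 - q n * p n ≠ 0)
include hq hp hqp

theorem tendsto_jost_left' (n : ℤ) {z : ℂ} (hz0 : z ≠ 0) (hz : ‖z‖ ≤ 1) (i : Fin 2) :
    Tendsto (fun m : ℤ => (transition q p n m z * freeE m z) i 1) atBot
      (𝓝 (jost q p atBot n z i 1)) := by
  have hz' : 1 ≤ ‖z⁻¹‖ := by
    rw [norm_inv]
    exact (one_le_inv₀ (norm_pos_iff.2 hz0)).2 hz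
  have := tendsto_jost_left hp hq (one_sub_swap hqp) n hz' (flip i)
  simp only [transition_mul_freeE_flip (q := q), jost_flip (q := q)]
  simpa [flip] using this

theorem tendsto_jost_right' (n : ℤ) {z : ℂ} (hz0 : z ≠ 0) (hz : ‖z‖ ≤ 1) (i : Fin 2) :
    Tendsto (fun m : ℤ => (transition q p n m z * freeE m z) i 0) atTop
      (𝓝 (jost q p atTop n z i 0)) := by
  have hz' : 1 ≤ ‖z⁻¹‖ := by
    rw [norm_inv]
    exact (one_le_inv₀ (norm_pos_iff.2 hz0)).2 hz
  have := tendsto_jost_right hp hq (one_sub_swap hqp) n hz' (flip i)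
  simp only [transition_mul_freeE_flip (q := q), jost_flip (q := q)]
  simpa [flip] using this

/-! ### The transmission and reflection coefficients -/

theorem aCoef_eq_transm {z : ℂ} (hz : 1 ≤ ‖z‖) : aCoef q p z = transm q p (z ^ 2)⁻¹ := by
  have hz0 := ne_zero_of_one_le_norm hz
  have h1 : ∀ i, jost q p atBot 0 z i 0 = _ := fun i =>
    (tendsto_left_zero hq hp hqp hz i).limUnder_eq
  have h2 : ∀ i, jost q p atTop 0 z i 1 = _ := fun i =>
    (tendsto_right_zero hq hp hqp hz i).limUnder_eq
  rw [aCoef, h1, h1, h2, h2, Matrix.det_fin_two_of, transm]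
  simp
  field_simp

omit hq hp hqp in
theorem aTildeAux_eq_aCoef (z : ℂ) : aTildeAux q p z = aCoef p q z⁻¹ := by
  rw [aTildeAux, aCoef, Matrix.det_fin_two_of, Matrix.det_fin_two_of]
  simp only [jost_flip (q := q)]
  simp [flip]
  ring

theorem aTildeAux_eq_transm {z : ℂ} (hz0 : z ≠ 0) (hz : ‖z‖ ≤ 1) :
    aTildeAux q p z = transm p q (z ^ 2) := by
  have hz' : 1 ≤ ‖z⁻¹‖ := by
    rw [norm_inv]
    exact (one_le_inv₀ (norm_pos_iff.2 hz0)).2 hz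
  rw [aTildeAux_eq_aCoef, aCoef_eq_transm hp hq (one_sub_swap hqp) hz']
  congr 1
  simp

theorem aTilde_eq_transm {z : ℂ} (hz : ‖z‖ ≤ 1) : aTilde q p z = transm p q (z ^ 2) := by
  unfold aTilde
  split_ifs with h0
  · subst h0
    refine Tendsto.limUnder_eq ?_
    have hc : ContinuousAt (fun z : ℂ => transm p q (z ^ 2)) 0 := by
      have h1 : ContinuousAt (transm p q) ((0 : ℂ) ^ 2) :=
        ((diffContOnCl_transm hp hq (one_sub_swap hqp)).differentiableAt Metric.isOpen_ball
          (by simp)).continuousAt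
      exact ContinuousAt.comp (f := fun z : ℂ => z ^ 2) h1 (by fun_prop)
    refine (hc.tendsto.mono_left nhdsWithin_le_nhds).congr' ?_
    filter_upwards [self_mem_nhdsWithin,
      nhdsWithin_le_nhds (Metric.ball_mem_nhds (0 : ℂ) one_pos)] with y hy hy1
    exact (aTildeAux_eq_transm hq hp hqp hy (by simpa using (Metric.mem_ball.1 hy1).le)).symm
  · exact aTildeAux_eq_transm hq hp hqp h0 hz

theorem det_jost (l : Filter ℤ) (hl : l = atBot ∨ l = atTop) (n : ℤ) {z : ℂ} (hz : ‖z‖ = 1) :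
    (jost q p l n z).det = 1 := by
  have hz0 := ne_zero_of_norm_eq_one hz
  have hlim : ∀ i j, Tendsto (fun m : ℤ => (transition q p n m z * freeE m z) i j) l
      (𝓝 (jost q p l n z i j)) := by
    intro i j
    rcases hl with rfl | rfl <;> fin_cases j
    · exact tendsto_jost_left hq hp hqp n hz.ge i
    · exact tendsto_jost_left' hq hp hqp n hz0 hz.le i
    · exact tendsto_jost_right' hq hp hqp n hz0 hz.le i
    · exact tendsto_jost_right hq hp hqp n hz.ge i
  have hne : l.NeBot := by
    rcases hl with rfl | rfl <;> infer_instance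
  have h1 : Tendsto (fun m : ℤ => (transition q p n m z * freeE m z).det) l
      (𝓝 (jost q p l n z).det) := by
    simp only [Matrix.det_fin_two]
    exact ((hlim 0 0).mul (hlim 1 1)).sub ((hlim 0 1).mul (hlim 1 0))
  refine tendsto_nhds_unique h1 ?_
  have h2 : ∀ m : ℤ, (transition q p n m z * freeE m z).det = 1 := by
    intro m
    rw [Matrix.det_mul, det_transition hqp n m hz0, freeE, Matrix.det_fin_two_of]
    rw [← zpow_add₀ hz0]
    simp
  simp only [h2]
  exact tendsto_const_nhds

theorem jost_eq_transition_mul (l : Filter ℤ) (hl : l = atBot ∨ l = atTop) (n : ℤ) {z : ℂ}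
    (hz : ‖z‖ = 1) : jost q p l n z = transition q p n 0 z * jost q p l 0 z := by
  have hz0 := ne_zero_of_norm_eq_one hz
  have hlim : ∀ i j, Tendsto (fun m : ℤ => (transition q p 0 m z * freeE m z) i j) l
      (𝓝 (jost q p l 0 z i j)) := by
    intro i j
    rcases hl with rfl | rfl <;> fin_cases j
    · exact tendsto_jost_left hq hp hqp 0 hz.ge i
    · exact tendsto_jost_left' hq hp hqp 0 hz0 hz.le i
    · exact tendsto_jost_right' hq hp hqp 0 hz0 hz.le i
    · exact tendsto_jost_right hq hp hqp 0 hz.ge i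
  have hne : l.NeBot := by
    rcases hl with rfl | rfl <;> infer_instance
  ext i j
  rw [Matrix.mul_apply]
  exact (tendsto_transition_of_zero hqp hz0 (fun i => hlim i j) n i).limUnder_eq

theorem monodromy_eq_zero (n : ℤ) {z : ℂ} (hz : ‖z‖ = 1) :
    monodromy q p n z = monodromy q p 0 z := by
  have hz0 := ne_zero_of_norm_eq_one hz
  rw [monodromy, jost_eq_transition_mul hq hp hqp atTop (Or.inr rfl) n hz,
    jost_eq_transition_mul hq hp hqp atBot (Or.inl rfl) n hz, Matrix.mul_inv_rev, monodromy,
    mul_assoc, Matrix.nonsing_inv_mul_cancel_left _ _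
      (isUnit_det_of_eq_one (det_transition hqp n 0 hz0))]

theorem monodromy_eq (n : ℤ) {z : ℂ} (hz : ‖z‖ = 1) :
    monodromy q p n z = !![aCoef q p z, bTilde q p z; bCoef q p z, aTilde q p z] := by
  have hz0 := ne_zero_of_norm_eq_one hz
  rw [monodromy_eq_zero hq hp hqp n hz]
  have hinv : (jost q p atTop 0 z)⁻¹ = (jost q p atTop 0 z).adjugate := by
    rw [Matrix.inv_def, det_jost hq hp hqp atTop (Or.inr rfl) 0 hz, Ring.inverse_one, one_smul]
  ext i j
  fin_cases i <;> fin_cases j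
  · simp only [monodromy, hinv, Matrix.adjugate_fin_two, aCoef, Matrix.det_fin_two_of]
    simp [Matrix.mul_apply, Fin.sum_univ_two]
    ring
  · simp [bTilde]
  · simp [bCoef]
  · simp only [monodromy, hinv, Matrix.adjugate_fin_two, aTilde, if_neg hz0, aTildeAux,
      Matrix.det_fin_two_of]
    simp [Matrix.mul_apply, Fin.sum_univ_two]
    ring

/-- Unimodularity of the monodromy matrix: `1 + b b̃ = a ã` on the unit circle. -/
theorem onePlusBB_eq {z : ℂ} (hz : ‖z‖ = 1) :
    onePlusBB q p z = transm q p (z ^ 2)⁻¹ * transm p q (z ^ 2) := by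
  have h1 : (monodromy q p 0 z).det = 1 := by
    rw [monodromy, Matrix.det_mul, Matrix.det_nonsing_inv,
      det_jost hq hp hqp atTop (Or.inr rfl) 0 hz, det_jost hq hp hqp atBot (Or.inl rfl) 0 hz]
    simp
  rw [monodromy_eq hq hp hqp 0 hz, Matrix.det_fin_two_of] at h1
  rw [onePlusBB, ← aCoef_eq_transm hq hp hqp hz.ge, ← aTilde_eq_transm hq hp hqp hz.le, ← h1]
  ring

theorem continuousOn_aCoef : ContinuousOn (aCoef q p) {ζ : ℂ | 1 ≤ ‖ζ‖} := by
  have h : ContinuousOn (fun ζ : ℂ => transm q p (ζ ^ 2)⁻¹) {ζ : ℂ | 1 ≤ ‖ζ‖} := by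
    refine (diffContOnCl_transm hq hp hqp).continuousOn_ball.comp
      (ContinuousOn.inv₀ (by fun_prop) fun ζ hζ => pow_ne_zero 2 (ne_zero_of_one_le_norm hζ)) ?_
    intro ζ hζ
    simpa using norm_inv_sq_le hζ
  exact h.congr fun ζ hζ => aCoef_eq_transm hq hp hqp hζ

theorem hasDerivAt_aCoef {z : ℂ} (hz : 1 < ‖z‖) :
    HasDerivAt (aCoef q p) (deriv (transm q p) (z ^ 2)⁻¹ * (-(2 * z) / (z ^ 2) ^ 2)) z := by
  have hz0 := ne_zero_of_one_le_norm hz.le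
  have hmem : (z ^ 2)⁻¹ ∈ Metric.ball (0 : ℂ) 1 := by
    have : ‖(z ^ 2)⁻¹‖ < 1 := by
      rw [norm_inv, norm_pow]
      exact inv_lt_one_of_one_lt₀ (one_lt_pow₀ hz two_ne_zero)
    simpa using this
  have h1 := ((diffContOnCl_transm hq hp hqp).differentiableAt Metric.isOpen_ball hmem).hasDerivAt
  have h2 : HasDerivAt (fun y : ℂ => (y ^ 2)⁻¹) (-(2 * z) / (z ^ 2) ^ 2) z := by
    exact ((hasDerivAt_pow 2 z).fun_inv (pow_ne_zero 2 hz0)).congr_deriv (by simp)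
  refine (h1.comp z h2).congr_of_eventuallyEq ?_
  filter_upwards [(isOpen_lt continuous_const continuous_norm).mem_nhds hz] with y hy
  exact aCoef_eq_transm hq hp hqp (le_of_lt hy)

theorem differentiableOn_aCoef : DifferentiableOn ℂ (aCoef q p) {ζ : ℂ | 1 < ‖ζ‖} := fun _ hζ =>
  (hasDerivAt_aCoef hq hp hqp hζ).differentiableAt.differentiableWithinAt

theorem continuousOn_aTilde : ContinuousOn (aTilde q p) {ζ : ℂ | ‖ζ‖ ≤ 1} := by
  have h : ContinuousOn (fun ζ : ℂ => transm p q (ζ ^ 2)) {ζ : ℂ | ‖ζ‖ ≤ 1} := by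
    refine (diffContOnCl_transm hp hq (one_sub_swap hqp)).continuousOn_ball.comp
      (by fun_prop) fun ζ hζ => ?_
    simpa using hζ
  exact h.congr fun ζ hζ => aTilde_eq_transm hq hp hqp hζ

theorem hasDerivAt_aTilde {z : ℂ} (hz : ‖z‖ < 1) :
    HasDerivAt (aTilde q p) (deriv (transm p q) (z ^ 2) * (2 * z)) z := by
  have hmem : z ^ 2 ∈ Metric.ball (0 : ℂ) 1 := by
    simpa using pow_lt_one₀ (norm_nonneg z) hz two_ne_zero
  have h1 := ((diffContOnCl_transm hp hq (one_sub_swap hqp)).differentiableAt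
    Metric.isOpen_ball hmem).hasDerivAt
  have h2 : HasDerivAt (fun y : ℂ => y ^ 2) (2 * z) z := by
    simpa using hasDerivAt_pow 2 z
  refine (h1.comp z h2).congr_of_eventuallyEq ?_
  filter_upwards [(isOpen_lt continuous_norm continuous_const).mem_nhds hz] with y hy
  exact aTilde_eq_transm hq hp hqp (le_of_lt hy)

theorem differentiableOn_aTilde : DifferentiableOn ℂ (aTilde q p) {ζ : ℂ | ‖ζ‖ < 1} := fun _ hζ =>
  (hasDerivAt_aTilde hq hp hqp hζ).differentiableAt.differentiableWithinAt

end jost'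

open Asymptotics

/-! ### Asymptotic expansions with uniform remainders -/

section expansions

variable {ι : Type*} {l : Filter ι} {x : ι → ℂ}

/-- `s` has the expansion `∑ a_j x^j` up to order `J`, along the filter `l`. With a principal
filter the remainders are uniform. -/
def ExpandsTo (l : Filter ι) (x s : ι → ℂ) (a : ℕ → ι → ℂ) (J : ℕ) : Prop :=
  (fun i => s i - ∑ j ∈ Finset.range J, a j i * x i ^ j) =O[l] fun i => x i ^ J

/-- The Cauchy product of coefficient sequences. -/
def cauchyProd (a b : ℕ → ι → ℂ) (j : ℕ) (i : ι) : ℂ :=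
  ∑ k ∈ Finset.range (j + 1), a k i * b (j - k) i

theorem sum_range_cauchyProd (a b : ℕ → ι → ℂ) (J : ℕ) (i : ι) (y : ℂ) :
    ∑ j ∈ Finset.range J, cauchyProd a b j i * y ^ j
      = ∑ k ∈ Finset.range J, a k i * y ^ k * ∑ m ∈ Finset.range (J - k), b m i * y ^ m := by
  have h1 : ∀ j, cauchyProd a b j i * y ^ j
      = ∑ k ∈ Finset.range (j + 1), (a k i * y ^ k) * (b (j - k) i * y ^ (j - k)) := by
    intro j
    rw [cauchyProd, Finset.sum_mul]
    refine Finset.sum_congr rfl fun k hk => ?_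
    have : j = k + (j - k) := by
      have := Finset.mem_range.1 hk
      omega
    conv_lhs => rw [this, pow_add]
    rw [show k + (j - k) - k = j - k by omega]
    ring
  simp only [h1, Finset.mul_sum]
  rw [Finset.sum_sigma', Finset.sum_sigma']
  refine Finset.sum_bij' (fun p _ => ⟨p.2, p.1 - p.2⟩) (fun p _ => ⟨p.1 + p.2, p.1⟩)
    ?_ ?_ ?_ ?_ ?_
  · rintro ⟨j, k⟩ h
    simp only [Finset.mem_sigma, Finset.mem_range] at h ⊢
    omega
  · rintro ⟨j, k⟩ h
    simp only [Finset.mem_sigma, Finset.mem_range] at h ⊢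
    omega
  · rintro ⟨j, k⟩ h
    simp only [Finset.mem_sigma, Finset.mem_range] at h
    simp only [Sigma.mk.injEq, heq_eq_eq, and_true]
    omega
  · rintro ⟨j, k⟩ h
    simp
  · rintro ⟨j, k⟩ h
    simp

theorem ExpandsTo.mul {s t : ι → ℂ} {a b : ℕ → ι → ℂ} {J : ℕ}
    (hs : ExpandsTo l x s a J) (ht : ∀ J' ≤ J, ExpandsTo l x t b J')
    (ha : ∀ j, a j =O[l] fun _ => (1 : ℂ)) (htb : t =O[l] fun _ => (1 : ℂ)) :
    ExpandsTo l x (fun i => s i * t i) (cauchyProd a b) J := by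
  have key : (fun i => s i * t i - ∑ j ∈ Finset.range J, cauchyProd a b j i * x i ^ j)
      = fun i => (s i - ∑ j ∈ Finset.range J, a j i * x i ^ j) * t i
        + ∑ k ∈ Finset.range J, a k i * x i ^ k
          * (t i - ∑ m ∈ Finset.range (J - k), b m i * x i ^ m) := by
    funext i
    rw [sum_range_cauchyProd]
    simp only [mul_sub, Finset.sum_sub_distrib, sub_mul, Finset.sum_mul]
    ring
  unfold ExpandsTo
  rw [key]
  refine IsBigO.add ?_ (IsBigO.fun_sum fun k hk => ?_)
  · have h1 := IsBigO.mul hs htb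
    simpa using h1
  · have hk' := Finset.mem_range.1 hk
    have h1 := ((ha k).mul (isBigO_refl (fun i => x i ^ k) l)).mul (ht (J - k) (by omega))
    refine h1.trans (isBigO_of_le _ fun i => ?_)
    simp only [norm_mul, norm_pow, one_mul]
    rw [← pow_add, show k + (J - k) = J by omega]

/-- Coefficients of powers: `∑_{κ₁+⋯+κ_m=n} w_{κ₁} ⋯ w_{κ_m}`. -/
def tuplePow (w : ℕ → ι → ℂ) (m n : ℕ) (i : ι) : ℂ :=
  ∑ κ ∈ Finset.Nat.antidiagonalTuple m n, ∏ r : Fin m, w (κ r) i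

theorem tuplePow_succ (w : ℕ → ι → ℂ) (m n : ℕ) (i : ι) :
    tuplePow w (m + 1) n i = cauchyProd w (tuplePow w m) n i := by
  simp only [tuplePow, cauchyProd, Finset.mul_sum]
  rw [Finset.sum_sigma']
  refine Finset.sum_bij' (fun κ _ => ⟨κ 0, fun r => κ r.succ⟩) (fun p _ => Fin.cons p.1 p.2)
    ?_ ?_ ?_ ?_ ?_
  · intro κ hκ
    rw [Finset.Nat.mem_antidiagonalTuple, Fin.sum_univ_succ] at hκ
    simp only [Finset.mem_sigma, Finset.mem_range, Finset.Nat.mem_antidiagonalTuple]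
    omega
  · rintro ⟨k, κ⟩ h
    simp only [Finset.mem_sigma, Finset.mem_range, Finset.Nat.mem_antidiagonalTuple] at h
    rw [Finset.Nat.mem_antidiagonalTuple, Fin.sum_univ_succ]
    simp only [Fin.cons_zero, Fin.cons_succ]
    omega
  · intro κ _
    exact Fin.cons_self_tail κ
  · rintro ⟨k, κ⟩ _
    simp
  · intro κ _
    rw [Fin.prod_univ_succ]

theorem isBigO_one_tuplePow {w : ℕ → ι → ℂ} (hw : ∀ j, w j =O[l] fun _ => (1 : ℂ)) (m n : ℕ) :
    tuplePow w m n =O[l] fun _ => (1 : ℂ) := by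
  refine IsBigO.fun_sum fun κ _ => ?_
  have := IsBigO.finsetProd (s := Finset.univ) fun (r : Fin m) _ => hw (κ r)
  simpa using this

theorem ExpandsTo.pow {s : ι → ℂ} {a : ℕ → ι → ℂ} (hs : ∀ J, ExpandsTo l x s a J)
    (ha : ∀ j, a j =O[l] fun _ => (1 : ℂ)) (hsb : s =O[l] fun _ => (1 : ℂ)) (m : ℕ) (J : ℕ) :
    ExpandsTo l x (fun i => s i ^ m) (tuplePow a m) J := by
  induction m generalizing J with
  | zero =>
    unfold ExpandsTo
    rcases J with _ | J
    · simpa using isBigO_refl (fun _ : ι => (1 : ℂ)) l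
    · have : (fun i => s i ^ 0 - ∑ j ∈ Finset.range (J + 1), tuplePow a 0 j i * x i ^ j)
          = fun _ => 0 := by
        funext i
        rw [Finset.sum_range_succ']
        simp [tuplePow]
      rw [this]
      exact isBigO_zero _ _
  | succ m ih =>
    have h1 := ExpandsTo.mul (hs J) (fun J' _ => ih J') ha (by simpa using hsb.pow m)
    have h2 : cauchyProd a (tuplePow a m) = tuplePow a (m + 1) := by
      funext n i
      exact (tuplePow_succ a m n i).symm
    rw [h2] at h1
    simpa only [pow_succ'] using h1

/-- The expansion of the solution of a Riccati difference equation
`s = P + x s' - x Q s' s`, where the prime denotes composition with a shift `τ`. -/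
theorem expandsTo_riccati {s Q P : ι → ℂ} {w : ℕ → ι → ℂ} {τ : ι → ι} (hτ : Tendsto τ l l)
    (hxτ : ∀ i, x (τ i) = x i)
    (hs : ∀ᶠ i in l, s i = P (τ i) + x i * s (τ i) - x i * Q (τ i) * (s (τ i) * s i))
    (hw0 : ∀ i, w 0 i = P (τ i))
    (hw : ∀ j i, w (j + 1) i = w j (τ i) - Q (τ i) * cauchyProd (fun j i => w j (τ i)) w j i)
    (hQ : Q =O[l] fun _ => (1 : ℂ)) (hsb : s =O[l] fun _ => (1 : ℂ))
    (hwb : ∀ j, w j =O[l] fun _ => (1 : ℂ)) (J : ℕ) : ExpandsTo l x s w J := by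
  induction J using Nat.strong_induction_on with
  | _ J ih =>
    rcases J with _ | J
    · unfold ExpandsTo
      simp only [Finset.range_zero, Finset.sum_empty, sub_zero, pow_zero]
      exact hsb.trans (isBigO_of_le _ fun _ => by simp)
    · have hτs : ExpandsTo l x (fun i => s (τ i)) (fun j i => w j (τ i)) J := by
        have := IsBigO.comp_tendsto (ih J (by omega)) hτ
        unfold ExpandsTo
        simpa only [Function.comp_def, hxτ] using this
      have hprod := ExpandsTo.mul hτs (fun J' hJ' => ih J' (by omega))
        (fun j => (hwb j).comp_tendsto hτ) hsb
      have key : (fun i => s i - ∑ j ∈ Finset.range (J + 1), w j i * x i ^ j) =ᶠ[l]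
          fun i => x i * (s (τ i) - ∑ j ∈ Finset.range J, w j (τ i) * x i ^ j)
            - Q (τ i) * (x i * (s (τ i) * s i - ∑ j ∈ Finset.range J,
              cauchyProd (fun j i => w j (τ i)) w j i * x i ^ j)) := by
        filter_upwards [hs] with i hi
        rw [Finset.sum_range_succ', hw0]
        have h1 : ∑ j ∈ Finset.range J, w (j + 1) i * x i ^ (j + 1)
            = x i * ∑ j ∈ Finset.range J, w j (τ i) * x i ^ j
              - Q (τ i) * (x i * ∑ j ∈ Finset.range J,
                cauchyProd (fun j i => w j (τ i)) w j i * x i ^ j) := by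
          simp only [Finset.mul_sum]
          rw [← Finset.sum_sub_distrib]
          refine Finset.sum_congr rfl fun j _ => ?_
          rw [hw]
          ring
        rw [h1]
        conv_lhs => rw [hi]
        ring
      have hx1 : ∀ i, x i ^ (J + 1) = x i * x i ^ J := fun i => pow_succ' _ _
      unfold ExpandsTo
      simp only [hx1]
      refine IsBigO.congr' (IsBigO.sub ((isBigO_refl x l).mul hτs) ?_) key.symm EventuallyEq.rfl
      have h2 := (hQ.comp_tendsto hτ).mul ((isBigO_refl x l).mul hprod)
      refine h2.trans (isBigO_of_le _ fun i => ?_)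
      simp

/-- The expansion of `log (1 + x Q s)`; the remainder keeps a factor `Q`. -/
theorem isBigO_log_one_add {s Q : ι → ℂ} {w : ℕ → ι → ℂ} (hs : ∀ J, ExpandsTo l x s w J)
    (hQ : Q =O[l] fun _ => (1 : ℂ)) (hsb : s =O[l] fun _ => (1 : ℂ))
    (hwb : ∀ j, w j =O[l] fun _ => (1 : ℂ)) (hsmall : ∀ᶠ i in l, ‖x i * Q i * s i‖ ≤ 1 / 2)
    (J : ℕ) :
    (fun i => Complex.log (1 + x i * Q i * s i) - ∑ k ∈ Finset.Icc 1 J,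
      (∑ m ∈ Finset.Icc 1 k, (-1 : ℂ) ^ (m - 1) / (m : ℂ) * Q i ^ m * tuplePow w m (k - m) i)
        * x i ^ k) =O[l] fun i => Q i * x i ^ (J + 1) := by
  have hlog : (fun i => Complex.log (1 + x i * Q i * s i)
      - Complex.logTaylor (J + 1) (x i * Q i * s i)) =O[l] fun i => Q i * x i ^ (J + 1) := by
    have h1 : (fun i => Complex.log (1 + x i * Q i * s i)
        - Complex.logTaylor (J + 1) (x i * Q i * s i)) =O[l]
        fun i => (x i * Q i * s i) ^ (J + 1) := by
      refine IsBigO.of_bound 2 ?_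
      filter_upwards [hsmall] with i hi
      refine (Complex.norm_log_sub_logTaylor_le J (by linarith)).trans ?_
      have h2 : (1 - ‖x i * Q i * s i‖)⁻¹ ≤ 2 := by
        rw [inv_le_comm₀ (by linarith) two_pos]
        linarith
      have h3 : (1 : ℝ) ≤ J + 1 := by
        have : (0 : ℝ) ≤ J := Nat.cast_nonneg _
        linarith
      have h4 : 0 ≤ (1 - ‖x i * Q i * s i‖)⁻¹ := inv_nonneg.2 (by linarith)
      rw [norm_pow]
      calc ‖x i * Q i * s i‖ ^ (J + 1) * (1 - ‖x i * Q i * s i‖)⁻¹ / (J + 1)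
          ≤ ‖x i * Q i * s i‖ ^ (J + 1) * (1 - ‖x i * Q i * s i‖)⁻¹ :=
            div_le_self (by positivity) h3
        _ ≤ ‖x i * Q i * s i‖ ^ (J + 1) * 2 := by gcongr
        _ = _ := by ring
    have h5 := (((isBigO_refl Q l).mul (isBigO_refl (fun i => x i ^ (J + 1)) l)).mul
      (hQ.pow J)).mul (hsb.pow (J + 1))
    refine h1.trans ((h5.congr_left fun i => ?_).trans (isBigO_of_le _ fun i => ?_))
    · ring
    · simp
  have hterm : ∀ m ∈ Finset.Icc 1 J, (fun i => (-1 : ℂ) ^ (m - 1) / (m : ℂ) *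
      ((x i * Q i * s i) ^ m - ∑ j ∈ Finset.range (J + 1 - m),
        Q i ^ m * tuplePow w m j i * x i ^ (m + j))) =O[l] fun i => Q i * x i ^ (J + 1) := by
    intro m hm
    obtain ⟨hm1, hm2⟩ := Finset.mem_Icc.1 hm
    refine IsBigO.const_mul_left ?_ _
    have h1 := (((isBigO_refl Q l).mul (hQ.pow (m - 1))).mul
      (isBigO_refl (fun i => x i ^ m) l)).mul (ExpandsTo.pow hs hwb hsb m (J + 1 - m))
    refine (h1.congr_left fun i => ?_).trans (isBigO_of_le _ fun i => ?_)
    · rw [mul_sub]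
      congr 1
      · rw [mul_pow, mul_pow]
        conv_rhs => rw [show m = (m - 1) + 1 by omega]
        conv_lhs => rw [show m = (m - 1) + 1 by omega]
        rw [show m - 1 + 1 - 1 = m - 1 by omega]
        ring
      · rw [Finset.mul_sum]
        refine Finset.sum_congr rfl fun j _ => ?_
        have : Q i ^ m = Q i * Q i ^ (m - 1) := by
          rw [← pow_succ', show m - 1 + 1 = m by omega]
        rw [this, pow_add]
        ring
    · have : J + 1 = m + (J + 1 - m) := by omega
      conv_rhs => rw [this, pow_add]
      simp
      ring_nf
      exact le_rfl
  have hsum := hlog.add (IsBigO.fun_sum hterm)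
  refine hsum.congr_left fun i => ?_
  have htaylor : Complex.logTaylor (J + 1) (x i * Q i * s i)
      = ∑ m ∈ Finset.Icc 1 J, (-1 : ℂ) ^ (m - 1) / (m : ℂ) * (x i * Q i * s i) ^ m := by
    rw [Complex.logTaylor, Finset.range_eq_Ico, Finset.sum_eq_sum_Ico_succ_bot (by omega)]
    simp only [Nat.cast_zero, div_zero, zero_add]
    refine Finset.sum_congr (by ext; simp) fun m hm => ?_
    have hm1 := (Finset.mem_Icc.1 hm).1
    have : (-1 : ℂ) ^ (m + 1) = (-1) ^ (m - 1) := by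
      conv_lhs => rw [show m + 1 = (m - 1) + 2 by omega, pow_add]
      simp
    rw [this]
    ring
  have hre : ∑ k ∈ Finset.Icc 1 J, (∑ m ∈ Finset.Icc 1 k,
        (-1 : ℂ) ^ (m - 1) / (m : ℂ) * Q i ^ m * tuplePow w m (k - m) i) * x i ^ k
      = ∑ m ∈ Finset.Icc 1 J, (-1 : ℂ) ^ (m - 1) / (m : ℂ) *
        ∑ j ∈ Finset.range (J + 1 - m), Q i ^ m * tuplePow w m j i * x i ^ (m + j) := by
    simp only [Finset.sum_mul, Finset.mul_sum]
    rw [Finset.sum_sigma', Finset.sum_sigma']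
    refine Finset.sum_bij' (fun a _ => ⟨a.2, a.1 - a.2⟩) (fun a _ => ⟨a.1 + a.2, a.1⟩)
      ?_ ?_ ?_ ?_ ?_
    · rintro ⟨k, m⟩ h
      simp only [Finset.mem_sigma, Finset.mem_range, Finset.mem_Icc] at h ⊢
      omega
    · rintro ⟨k, m⟩ h
      simp only [Finset.mem_sigma, Finset.mem_range, Finset.mem_Icc] at h ⊢
      omega
    · rintro ⟨k, m⟩ h
      simp only [Finset.mem_sigma, Finset.mem_Icc] at h
      simp only [Sigma.mk.injEq, heq_eq_eq, and_true]
      omega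
    · rintro ⟨k, m⟩ h
      simp
    · rintro ⟨k, m⟩ h
      simp only [Finset.mem_sigma, Finset.mem_Icc] at h
      simp only
      rw [show m + (k - m) = k by omega]
      ring
  rw [htaylor, hre]
  simp only [mul_sub, Finset.sum_sub_distrib]
  ring

end expansions

/-! ### Bounds for the conserved densities -/

theorem wCoef_zero (u v : ℤ → ℂ) (n : ℤ) : wCoef u v 0 n = v (n - 1) := by
  rw [wCoef]

theorem wCoef_succ (u v : ℤ → ℂ) (j : ℕ) (n : ℤ) :
    wCoef u v (j + 1) n = wCoef u v j (n - 1) - u (n - 1) *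
      ∑ k ∈ Finset.range (j + 1), wCoef u v k (n - 1) * wCoef u v (j - k) n := by
  rw [wCoef, Fin.sum_univ_eq_sum_range (fun k => wCoef u v k (n - 1) * wCoef u v (j - k) n)]

theorem exists_bound_wCoef (K : ℝ) (hK : 0 ≤ K) (J : ℕ) : ∃ M : ℝ, ∀ u v : ℤ → ℂ,
    (∀ n, ‖u n‖ ≤ K) → (∀ n, ‖v n‖ ≤ K) → ∀ j ≤ J, ∀ n, ‖wCoef u v j n‖ ≤ M := by
  induction J with
  | zero =>
    refine ⟨K, fun u v _ hv j hj n => ?_⟩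
    obtain rfl : j = 0 := by omega
    rw [wCoef_zero]
    exact hv _
  | succ J ih =>
    obtain ⟨M, hM⟩ := ih
    refine ⟨max M (M + K * ((J + 1) * (M * M))), fun u v hu hv j hj n => ?_⟩
    rcases Nat.lt_or_ge j (J + 1) with h | h
    · exact (hM u v hu hv j (by omega) n).trans (le_max_left _ _)
    · obtain rfl : j = J + 1 := by omega
      have hb := hM u v hu hv
      have hM0 : 0 ≤ M := (norm_nonneg _).trans (hb 0 (by omega) 0)
      refine le_trans ?_ (le_max_right _ _)
      rw [wCoef_succ]
      refine (norm_sub_le _ _).trans (add_le_add (hb J le_rfl _) ?_)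
      rw [norm_mul]
      refine mul_le_mul (hu _) ?_ (norm_nonneg _) hK
      refine (norm_sum_le _ _).trans ?_
      refine (Finset.sum_le_card_nsmul _ _ (M * M) fun k hk => ?_).trans ?_
      · have := Finset.mem_range.1 hk
        rw [norm_mul]
        exact mul_le_mul (hb k (by omega) _) (hb (J - k) (by omega) _) (norm_nonneg _) hM0
      · rw [Finset.card_range, nsmul_eq_mul]
        push_cast
        exact le_rfl

/-- The density in terms of coefficients of powers of the generating function of `wCoef`. -/
theorem density_eq_sum_tuplePow {ι : Type*} (u v : ℤ → ℂ) (k : ℕ) (n : ℤ) {w : ℕ → ι → ℂ} {i : ι}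
    (hw : ∀ j, w j i = wCoef u v j n) :
    density u v k n = ∑ m ∈ Finset.Icc 1 k,
      (-1 : ℂ) ^ (m - 1) / (m : ℂ) * u n ^ m * tuplePow w m (k - m) i := by
  simp only [density, tuplePow, hw]

theorem exists_bound_density (K : ℝ) (hK : 0 ≤ K) (k : ℕ) : ∃ M : ℝ, ∀ u v : ℤ → ℂ,
    (∀ n, ‖u n‖ ≤ K) → (∀ n, ‖v n‖ ≤ K) → ∀ n, ‖density u v k n‖ ≤ M * ‖u n‖ := by
  let S : Set ((ℤ → ℂ) × (ℤ → ℂ) × ℤ) := {i | (∀ n, ‖i.1 n‖ ≤ K) ∧ ∀ n, ‖i.2.1 n‖ ≤ K}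
  let w : ℕ → (ℤ → ℂ) × (ℤ → ℂ) × ℤ → ℂ := fun j i => wCoef i.1 i.2.1 j i.2.2
  have hw : ∀ j, w j =O[𝓟 S] fun _ => (1 : ℂ) := by
    intro j
    obtain ⟨M, hM⟩ := exists_bound_wCoef K hK j
    refine isBigO_principal.2 ⟨M, fun i hi => ?_⟩
    simpa using hM i.1 i.2.1 hi.1 hi.2 j le_rfl i.2.2
  have hQ : (fun i : (ℤ → ℂ) × (ℤ → ℂ) × ℤ => i.1 i.2.2) =O[𝓟 S] fun _ => (1 : ℂ) :=
    isBigO_principal.2 ⟨K, fun i hi => by simpa using hi.1 i.2.2⟩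
  have h : (fun i : (ℤ → ℂ) × (ℤ → ℂ) × ℤ => density i.1 i.2.1 k i.2.2) =O[𝓟 S]
      fun i => i.1 i.2.2 := by
    have e : (fun i : (ℤ → ℂ) × (ℤ → ℂ) × ℤ => density i.1 i.2.1 k i.2.2) = fun i =>
        ∑ m ∈ Finset.Icc 1 k, (-1 : ℂ) ^ (m - 1) / (m : ℂ) * i.1 i.2.2 ^ m
          * tuplePow w m (k - m) i :=
      funext fun i => density_eq_sum_tuplePow i.1 i.2.1 k i.2.2 fun j => rfl
    rw [e]
    refine IsBigO.fun_sum fun m hm => ?_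
    have hm1 := (Finset.mem_Icc.1 hm).1
    have h1 := (((isBigO_refl (fun i : (ℤ → ℂ) × (ℤ → ℂ) × ℤ => i.1 i.2.2) (𝓟 S)).mul
      (hQ.pow (m - 1))).const_mul_left ((-1 : ℂ) ^ (m - 1) / (m : ℂ))).mul
      (isBigO_one_tuplePow hw m (k - m))
    refine (h1.congr_left fun i => ?_).trans (isBigO_of_le _ fun i => by simp)
    rw [← pow_succ', show m - 1 + 1 = m by omega]
  obtain ⟨M, hM⟩ := isBigO_principal.1 h
  exact ⟨M, fun u v hu hv n => hM (u, v, n) ⟨hu, hv⟩⟩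

/-- For a solution `s` of the Riccati equation the logarithm of `1 + x u s` is expanded by the
densities, uniformly in the potentials and the site. -/
theorem exists_bound_log_sub_density (K B : ℝ) (hK : 0 ≤ K) (J : ℕ) :
    ∃ M : ℝ, ∀ (u v s : ℤ → ℂ) (x : ℂ),
    (∀ n, ‖u n‖ ≤ K) → (∀ n, ‖v n‖ ≤ K) → (∀ n, ‖s n‖ ≤ B) →
    (∀ n, s n = v (n - 1) + x * s (n - 1) - x * u (n - 1) * (s (n - 1) * s n)) →
    (∀ n, ‖x * u n * s n‖ ≤ 1 / 2) → ∀ n,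
    ‖Complex.log (1 + x * u n * s n) - ∑ k ∈ Finset.Icc 1 J, density u v k n * x ^ k‖
      ≤ M * ‖u n * x ^ (J + 1)‖ := by
  let I := ((ℤ → ℂ) × (ℤ → ℂ) × (ℤ → ℂ) × ℂ) × ℤ
  let u : I → ℤ → ℂ := fun i => i.1.1
  let v : I → ℤ → ℂ := fun i => i.1.2.1
  let s : I → ℤ → ℂ := fun i => i.1.2.2.1
  let x : I → ℂ := fun i => i.1.2.2.2
  let τ : I → I := fun i => (i.1, i.2 - 1)
  let S : Set I := {i | (∀ n, ‖u i n‖ ≤ K) ∧ (∀ n, ‖v i n‖ ≤ K) ∧ (∀ n, ‖s i n‖ ≤ B) ∧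
    (∀ n, s i n = v i (n - 1) + x i * s i (n - 1) - x i * u i (n - 1) * (s i (n - 1) * s i n)) ∧
    ∀ n, ‖x i * u i n * s i n‖ ≤ 1 / 2}
  let w : ℕ → I → ℂ := fun j i => wCoef (u i) (v i) j i.2
  have hτ : Tendsto τ (𝓟 S) (𝓟 S) := tendsto_principal_principal.2 fun i hi => hi
  have hw : ∀ j, w j =O[𝓟 S] fun _ => (1 : ℂ) := by
    intro j
    obtain ⟨M, hM⟩ := exists_bound_wCoef K hK j
    refine isBigO_principal.2 ⟨M, fun i hi => ?_⟩
    simpa using hM (u i) (v i) hi.1 hi.2.1 j le_rfl i.2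
  have hQ : (fun i : I => u i i.2) =O[𝓟 S] fun _ => (1 : ℂ) :=
    isBigO_principal.2 ⟨K, fun i hi => by simpa using hi.1 i.2⟩
  have hs : (fun i : I => s i i.2) =O[𝓟 S] fun _ => (1 : ℂ) :=
    isBigO_principal.2 ⟨B, fun i hi => by simpa using hi.2.2.1 i.2⟩
  have hexp : ∀ J, ExpandsTo (𝓟 S) x (fun i => s i i.2) w J :=
    expandsTo_riccati (Q := fun i => u i i.2) (P := fun i => v i i.2) hτ (fun _ => rfl)
      (eventually_principal.2 fun i hi => hi.2.2.2.1 i.2)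
      (fun i => wCoef_zero _ _ _) (fun j i => wCoef_succ _ _ _ _) hQ hs hw
  have hlog := isBigO_log_one_add hexp hQ hs hw
    (eventually_principal.2 fun i hi => hi.2.2.2.2 i.2) J
  obtain ⟨M, hM⟩ := isBigO_principal.1 hlog
  refine ⟨M, fun u' v' s' x' h1 h2 h3 h4 h5 n => ?_⟩
  have := hM ((u', v', s', x'), n) ⟨h1, h2, h3, h4, h5⟩
  simp only [u, x, s] at this
  convert this using 4
  rename_i k _
  exact congrArg (· * x' ^ k) (density_eq_sum_tuplePow u' v' k n fun j => rfl)

/-! ### Potentials cut off on the left -/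

/-- The potential set to zero to the left of the site `-R`. -/
noncomputable def cutoff (R : ℕ) (u : ℤ → ℂ) (n : ℤ) : ℂ := if -(R : ℤ) ≤ n then u n else 0

theorem norm_cutoff_le (R : ℕ) (u : ℤ → ℂ) (n : ℤ) : ‖cutoff R u n‖ ≤ ‖u n‖ := by
  unfold cutoff
  split_ifs <;> simp

theorem wCoef_cutoff (R : ℕ) (u v : ℤ → ℂ) (j : ℕ) : ∀ n : ℤ, -(R : ℤ) + j + 1 ≤ n →
    wCoef (cutoff R u) (cutoff R v) j n = wCoef u v j n := by
  induction j using Nat.strong_induction_on with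
  | _ j ih =>
    intro n hn
    rcases j with _ | j
    · rw [wCoef_zero, wCoef_zero, cutoff, if_pos (by push_cast at hn; omega)]
    · push_cast at hn
      rw [wCoef_succ, wCoef_succ, ih j (by omega) (n - 1) (by omega), cutoff,
        if_pos (by omega)]
      congr 2
      refine Finset.sum_congr rfl fun k hk => ?_
      have hk' := Finset.mem_range.1 hk
      rw [ih k (by omega) (n - 1) (by omega), ih (j - k) (by omega) n (by omega)]

theorem density_cutoff (R : ℕ) (u v : ℤ → ℂ) (k : ℕ) (n : ℤ) (hn : -(R : ℤ) + k + 1 ≤ n) :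
    density (cutoff R u) (cutoff R v) k n = density u v k n := by
  unfold density
  refine Finset.sum_congr rfl fun m hm => ?_
  have hm' := Finset.mem_Icc.1 hm
  rw [show cutoff R u n = u n from if_pos (by omega)]
  congr 1
  refine Finset.sum_congr rfl fun κ hκ => Finset.prod_congr rfl fun r _ => ?_
  refine wCoef_cutoff R u v _ n ?_
  have h1 : κ r ≤ ∑ i, κ i := Finset.single_le_sum (fun _ _ => Nat.zero_le _) (Finset.mem_univ r)
  rw [Finset.Nat.mem_antidiagonalTuple.1 hκ] at h1
  omega

/-- The first column of the product of the reduced Lax matrices over the sites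
`-R, …, -R + k - 1`. -/
noncomputable def cutColumn (q p : ℤ → ℂ) (R : ℕ) (x : ℂ) : ℕ → ℂ × ℂ
  | 0 => (1, 0)
  | k + 1 =>
    ((normF q p (-R + k))⁻¹ * ((cutColumn q p R x k).1 + x * q (-R + k) * (cutColumn q p R x k).2),
      (normF q p (-R + k))⁻¹ * (p (-R + k) * (cutColumn q p R x k).1 + x * (cutColumn q p R x k).2))

theorem laxProd_col_zero (q p : ℤ → ℂ) (R : ℕ) {z : ℂ} (hz : z ≠ 0) (k : ℕ) :
    laxProd q p (-R) z k 0 0 = z ^ k * (cutColumn q p R (z ^ 2)⁻¹ k).1 ∧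
      laxProd q p (-R) z k 1 0 = z ^ k * (z⁻¹ * (cutColumn q p R (z ^ 2)⁻¹ k).2) := by
  induction k with
  | zero => simp [laxProd, cutColumn]
  | succ k ih =>
    obtain ⟨h1, h2⟩ := ih
    constructor <;>
      simp only [laxProd, lax, Matrix.mul_apply, Fin.sum_univ_two, h1, h2, cutColumn,
        Matrix.smul_apply, smul_eq_mul, pow_succ] <;> simp <;> field_simp

theorem laxProd_add (q p : ℤ → ℂ) (m : ℤ) (z : ℂ) (k l : ℕ) :
    laxProd q p m z (k + l) = laxProd q p (m + k) z l * laxProd q p m z k := by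
  induction l with
  | zero => simp [laxProd]
  | succ l ih =>
    rw [← add_assoc, laxProd, ih, laxProd, mul_assoc]
    push_cast
    rw [add_assoc]

/-- Over the symmetric window `-R, …, R - 1` the corner entry of the product is the bilinear
expression in the half-line products that converges to the transmission coefficient. -/
theorem cutColumn_two_mul (q p : ℤ → ℂ) (R : ℕ) {x : ℂ} (hx : x ≠ 0) :
    (cutColumn q p R x (R + R)).1 = (leftRow q p 0 x R).1 * (rightRow q p 0 x R).1
      + x * ((leftRow q p 1 x R).1 * (rightRow q p 1 x R).1) := by
  obtain ⟨y, hy⟩ := IsAlgClosed.exists_pow_nat_eq x (n := 2) two_pos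
  have hy0 : y ≠ 0 := by
    rintro rfl
    exact hx (by rw [← hy]; simp)
  have hz0 : y⁻¹ ≠ 0 := inv_ne_zero hy0
  have hxz : ((y⁻¹) ^ 2)⁻¹ = x := by rw [inv_pow, inv_inv, hy]
  have h1 := (laxProd_col_zero q p R hz0 (R + R)).1
  rw [laxProd_add, neg_add_cancel, laxProd_neg_eq hz0, laxProd_zero_eq hz0, hxz] at h1
  have hzR : (y⁻¹) ^ R ≠ 0 := pow_ne_zero _ hz0
  simp only [Matrix.mul_apply, Fin.sum_univ_two, Matrix.smul_apply, smul_eq_mul, pow_add] at h1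
  simp at h1
  have hyR : y ^ R ≠ 0 := pow_ne_zero _ hy0
  field_simp at h1
  rw [← h1, ← hy]
  ring

section cutRatio

variable {q p : ℤ → ℂ} {K : ℝ} (hK : 1 ≤ K) (hqK : ∀ n, ‖q n‖ ≤ K) (hpK : ∀ n, ‖p n‖ ≤ K)
  (hqp : ∀ n, 1 - q n * p n ≠ 0) {x : ℂ} (hx : ‖x‖ ≤ 1 / (8 * K ^ 2))
include hK hqK hpK hqp hx

omit hpK hqp in
theorem norm_mul_mul_le_half {n : ℤ} {s : ℂ} (hs : ‖s‖ ≤ 4 * K) : ‖x * q n * s‖ ≤ 1 / 2 := by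
  rw [norm_mul, norm_mul]
  have hK0 : (0 : ℝ) < K := by linarith
  calc ‖x‖ * ‖q n‖ * ‖s‖ ≤ 1 / (8 * K ^ 2) * K * (4 * K) := by
        gcongr
        exact hqK n
    _ = 1 / 2 := by
        field_simp
        norm_num

theorem cutColumn_bound (R k : ℕ) : (cutColumn q p R x k).1 ≠ 0 ∧
    ‖(cutColumn q p R x k).2 / (cutColumn q p R x k).1‖ ≤ 4 * K := by
  have hK0 : (0 : ℝ) < K := by linarith
  induction k with
  | zero =>
    simp only [cutColumn]
    simp
    linarith
  | succ k ih =>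
    obtain ⟨h1, h2⟩ := ih
    set a := (cutColumn q p R x k).1
    set b := (cutColumn q p R x k).2
    set n : ℤ := -R + k
    have hc := inv_ne_zero (normF_ne_zero hqp n)
    have hsmall := norm_mul_mul_le_half hK hqK hx (n := n) h2
    have hden : 1 / 2 ≤ ‖1 + x * q n * (b / a)‖ := by
      have := norm_sub_le (1 + x * q n * (b / a)) (x * q n * (b / a))
      rw [add_sub_cancel_right, norm_one] at this
      linarith
    have hden0 : 1 + x * q n * (b / a) ≠ 0 := by
      intro h
      rw [h, norm_zero] at hden
      linarith
    have e1 : a + x * q n * b = a * (1 + x * q n * (b / a)) := by field_simp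
    have e2 : p n * a + x * b = a * (p n + x * (b / a)) := by field_simp
    have ha' : (cutColumn q p R x (k + 1)).1
        = (normF q p n)⁻¹ * (a * (1 + x * q n * (b / a))) := by
      rw [← e1, cutColumn]
    have hb' : (cutColumn q p R x (k + 1)).2 = (normF q p n)⁻¹ * (a * (p n + x * (b / a))) := by
      rw [← e2, cutColumn]
    refine ⟨by rw [ha']; exact mul_ne_zero hc (mul_ne_zero h1 hden0), ?_⟩
    rw [ha', hb', mul_div_mul_left _ _ hc, mul_div_mul_left _ _ h1, norm_div,
      div_le_iff₀ (by linarith)]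
    have hnum : ‖p n + x * (b / a)‖ ≤ 2 * K := by
      refine (norm_add_le _ _).trans ?_
      rw [norm_mul]
      have h3 : ‖x‖ * ‖b / a‖ ≤ 1 / (8 * K ^ 2) * (4 * K) := by gcongr
      have h4 : 1 / (8 * K ^ 2) * (4 * K) ≤ K := by
        rw [div_mul_eq_mul_div, div_le_iff₀ (by positivity)]
        nlinarith [mul_pos hK0 hK0]
      linarith [hpK n]
    nlinarith

omit hK hqK hpK hqp hx in
/-- The ratio of the components of the cut-off solution at the site `n`. -/
noncomputable def cutRatio (q p : ℤ → ℂ) (R : ℕ) (x : ℂ) (n : ℤ) : ℂ :=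
  (cutColumn q p R x (n + R).toNat).2 / (cutColumn q p R x (n + R).toNat).1

theorem cutRatio_riccati (R : ℕ) (n : ℤ) :
    cutRatio q p R x n = cutoff R p (n - 1) + x * cutRatio q p R x (n - 1)
      - x * cutoff R q (n - 1) * (cutRatio q p R x (n - 1) * cutRatio q p R x n) := by
  by_cases h : -(R : ℤ) ≤ n - 1
  · obtain ⟨k, hk⟩ : ∃ k : ℕ, n - 1 = -R + k := ⟨(n - 1 + R).toNat, by omega⟩
    have e1 : (n + R).toNat = k + 1 := by omega
    have e2 : (n - 1 + R).toNat = k := by omega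
    obtain ⟨h1, -⟩ := cutColumn_bound hK hqK hpK hqp hx R k
    obtain ⟨h2, -⟩ := cutColumn_bound hK hqK hpK hqp hx R (k + 1)
    rw [cutoff, cutoff, if_pos h, if_pos h, cutRatio, cutRatio, e1, e2]
    rw [hk]
    rw [cutColumn] at h2 ⊢
    simp only at h2 ⊢
    have hc := normF_ne_zero hqp (-R + k)
    have h3 := right_ne_zero_of_mul h2
    rw [mul_div_mul_left _ _ (inv_ne_zero hc)]
    generalize (cutColumn q p R x k).1 = a at *
    generalize (cutColumn q p R x k).2 = b at *
    generalize hD : a + x * q (-R + k) * b = D at *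
    field_simp
    rw [← hD]
    ring
  · have e1 : (n + R).toNat = 0 := by omega
    have e2 : (n - 1 + R).toNat = 0 := by omega
    rw [cutoff, cutoff, if_neg h, if_neg h, cutRatio, cutRatio, e1, e2]
    simp [cutColumn]

theorem cutColumn_eq_exp (R k : ℕ) : (cutColumn q p R x k).1
    = Complex.exp (∑ j ∈ Finset.range k, (-Complex.log (normF q p (-R + j))
        + Complex.log (1 + x * q (-R + j) * cutRatio q p R x (-R + j)))) := by
  induction k with
  | zero => simp [cutColumn]
  | succ k ih =>
    obtain ⟨h1, h2⟩ := cutColumn_bound hK hqK hpK hqp hx R k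
    have hr : cutRatio q p R x (-R + k)
        = (cutColumn q p R x k).2 / (cutColumn q p R x k).1 := by
      rw [cutRatio, show (-(R : ℤ) + k + R).toNat = k by omega]
    have hsmall := norm_mul_mul_le_half hK hqK hx (n := -R + k) h2
    rw [← hr] at hsmall
    have hne : 1 + x * q (-R + k) * cutRatio q p R x (-R + k) ≠ 0 := by
      intro h
      have : x * q (-R + k) * cutRatio q p R x (-R + k) = -1 := by linear_combination h
      rw [this] at hsmall
      norm_num at hsmall
    rw [Finset.sum_range_succ, Complex.exp_add, ← ih, Complex.exp_add, Complex.exp_neg,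
      Complex.exp_log (normF_ne_zero hqp _), Complex.exp_log hne, hr, cutColumn]
    field_simp

end cutRatio

/-! ### The logarithm of the transmission coefficient generates the conserved quantities -/

/-- Dominated convergence for sums over the windows `-R, …, R - 1`. -/
theorem tendsto_sum_window {F : ℕ → ℤ → ℂ} {g : ℤ → ℂ} {b : ℤ → ℝ} (hb : Summable b)
    (hF : ∀ R n, ‖F R n‖ ≤ b n) (hg : ∀ n, ∀ᶠ R in atTop, F R n = g n) :
    Tendsto (fun R : ℕ => ∑ j ∈ Finset.range (R + R), F R (-R + j)) atTop (𝓝 (∑' n, g n)) := by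
  have h1 : ∀ R : ℕ, ∑ j ∈ Finset.range (R + R), F R (-R + j)
      = ∑' n : ℤ, if n ∈ Finset.Ico (-R : ℤ) R then F R n else 0 := by
    intro R
    rw [tsum_eq_sum (s := Finset.Ico (-R : ℤ) R) fun n hn => if_neg hn,
      Finset.sum_congr rfl fun n hn => if_pos hn]
    refine Finset.sum_bij' (fun j _ => -(R : ℤ) + j) (fun n _ => (n + R).toNat) ?_ ?_ ?_ ?_ ?_
    · intro j hj
      have := Finset.mem_range.1 hj
      rw [Finset.mem_Ico]
      omega
    · intro n hn
      have := Finset.mem_Ico.1 hn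
      rw [Finset.mem_range]
      omega
    · intro j hj
      omega
    · intro n hn
      have := Finset.mem_Ico.1 hn
      omega
    · intro j hj
      rfl
  simp only [h1]
  refine tendsto_tsum_of_dominated_convergence hb (fun n => ?_) (Eventually.of_forall fun R n => ?_)
  · refine tendsto_const_nhds.congr' ?_
    filter_upwards [hg n, eventually_ge_atTop (n.natAbs + 1)] with R hR hR'
    rw [if_pos (by rw [Finset.mem_Ico]; omega), hR]
  · split_ifs
    · exact hF R n
    · simpa using (norm_nonneg _).trans (hF R n)

section

variable {q p : ℤ → ℂ} (hq : Summable fun n => ‖q n‖) (hp : Summable fun n => ‖p n‖)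

include hq hp in
theorem exists_uniform_bound : ∃ K : ℝ, 1 ≤ K ∧ (∀ n, ‖q n‖ ≤ K) ∧ ∀ n, ‖p n‖ ≤ K := by
  refine ⟨1 + ∑' n, ‖q n‖ + ∑' n, ‖p n‖, ?_, fun n => ?_, fun n => ?_⟩
  · have h1 : 0 ≤ ∑' n, ‖q n‖ := tsum_nonneg fun n => norm_nonneg _
    have h2 : 0 ≤ ∑' n, ‖p n‖ := tsum_nonneg fun n => norm_nonneg _
    linarith
  · have h1 := hq.le_tsum n fun j _ => norm_nonneg _
    have h2 : 0 ≤ ∑' n, ‖p n‖ := tsum_nonneg fun n => norm_nonneg _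
    linarith
  · have h1 := hp.le_tsum n fun j _ => norm_nonneg _
    have h2 : 0 ≤ ∑' n, ‖q n‖ := tsum_nonneg fun n => norm_nonneg _
    linarith

include hq hp in
theorem summable_density (k : ℕ) : Summable (density q p k) := by
  obtain ⟨K, hK, hqK, hpK⟩ := exists_uniform_bound hq hp
  obtain ⟨M, hM⟩ := exists_bound_density K (by linarith) k
  exact Summable.of_norm_bounded (hq.mul_left M) (hM q p hqK hpK)

variable (hqp : ∀ n, 1 - q n * p n ≠ 0)
include hq hp hqp

/-- `ln a = I₀ + ∑_{k ≥ 1} I_{2k} x^k` as `x = z⁻² → 0`, in exponentiated form. -/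
theorem transm_mul_exp_isBigO (J : ℕ) :
    (fun x => transm q p x * Complex.exp (-conservedI0 q p
        - ∑ k ∈ Finset.Icc 1 J, conservedI q p k * x ^ k) - 1)
      =O[𝓝[≠] 0] fun x => x ^ (J + 1) := by
  obtain ⟨K, hK, hqK, hpK⟩ := exists_uniform_bound hq hp
  obtain ⟨M, hM⟩ := exists_bound_log_sub_density K (4 * K) (by linarith) J
  set M' := max M 0 * ∑' n, ‖q n‖ with hM'
  have hK0 : 0 < K := by linarith
  have hsmall : ∀ᶠ x : ℂ in 𝓝 0, M' * ‖x ^ (J + 1)‖ ≤ 1 := by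
    have h1 : Tendsto (fun x : ℂ => M' * ‖x ^ (J + 1)‖) (𝓝 0) (𝓝 (M' * ‖(0 : ℂ) ^ (J + 1)‖)) :=
      Continuous.tendsto (by fun_prop) 0
    refine h1.eventually (ge_mem_nhds ?_)
    simp
  have hρ : ∀ᶠ x : ℂ in 𝓝 0, ‖x‖ ≤ 1 / (8 * K ^ 2) := by
    have h1 : Tendsto (fun x : ℂ => ‖x‖) (𝓝 0) (𝓝 ‖(0 : ℂ)‖) := continuous_norm.tendsto 0
    refine h1.eventually (ge_mem_nhds ?_)
    rw [norm_zero]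
    positivity
  refine IsBigO.of_bound (2 * M') ?_
  filter_upwards [self_mem_nhdsWithin, nhdsWithin_le_nhds hsmall, nhdsWithin_le_nhds hρ,
    nhdsWithin_le_nhds (Metric.ball_mem_nhds (0 : ℂ) one_pos)] with x hx0 hxM hxρ hx1
  have hx1' : ‖x‖ ≤ 1 := by simpa using (Metric.mem_ball.1 hx1).le
  -- the cut-off logarithms and their expansions
  let E : ℕ → ℂ := fun R => ∑ j ∈ Finset.range (R + R),
    Complex.log (1 + x * q (-R + j) * cutRatio q p R x (-R + j))
  let D : ℕ → ℕ → ℂ := fun k R => ∑ j ∈ Finset.range (R + R),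
    density (cutoff R q) (cutoff R p) k (-R + j)
  let F : ℕ → ℂ := fun R => ∑ j ∈ Finset.range (R + R), Complex.log (normF q p (-R + j))
  have hED : ∀ R, ‖E R - ∑ k ∈ Finset.Icc 1 J, D k R * x ^ k‖ ≤ M' * ‖x ^ (J + 1)‖ := by
    intro R
    have hbq : ∀ n, ‖cutoff R q n‖ ≤ K := fun n => (norm_cutoff_le R q n).trans (hqK n)
    have hbp : ∀ n, ‖cutoff R p n‖ ≤ K := fun n => (norm_cutoff_le R p n).trans (hpK n)
    have hbs : ∀ n, ‖cutRatio q p R x n‖ ≤ 4 * K := fun n =>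
      (cutColumn_bound hK hqK hpK hqp hxρ R _).2
    have hrem := hM (cutoff R q) (cutoff R p) (cutRatio q p R x) x hbq hbp hbs
      (cutRatio_riccati hK hqK hpK hqp hxρ R)
      (fun n => norm_mul_mul_le_half hK hbq hxρ (hbs n))
    have e1 : E R - ∑ k ∈ Finset.Icc 1 J, D k R * x ^ k
        = ∑ j ∈ Finset.range (R + R),
          (Complex.log (1 + x * cutoff R q (-R + j) * cutRatio q p R x (-R + j))
            - ∑ k ∈ Finset.Icc 1 J, density (cutoff R q) (cutoff R p) k (-R + j) * x ^ k) := by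
      rw [Finset.sum_sub_distrib, Finset.sum_comm]
      simp only [E, D, Finset.sum_mul]
      congr 1
      refine Finset.sum_congr rfl fun j _ => ?_
      rw [show cutoff R q (-R + j) = q (-R + j) from if_pos (by omega)]
    rw [e1]
    refine (norm_sum_le _ _).trans ?_
    have e2 : ∀ j ∈ Finset.range (R + R),
        ‖Complex.log (1 + x * cutoff R q (-R + j) * cutRatio q p R x (-R + j))
          - ∑ k ∈ Finset.Icc 1 J, density (cutoff R q) (cutoff R p) k (-R + j) * x ^ k‖
        ≤ max M 0 * ‖x ^ (J + 1)‖ * ‖q (-R + j)‖ := by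
      intro j _
      refine (hrem _).trans ?_
      rw [norm_mul]
      calc M * (‖cutoff R q (-R + j)‖ * ‖x ^ (J + 1)‖)
          ≤ max M 0 * (‖q (-R + j)‖ * ‖x ^ (J + 1)‖) := by
            refine mul_le_mul (le_max_left _ _) ?_ (by positivity) (le_max_right _ _)
            exact mul_le_mul_of_nonneg_right (norm_cutoff_le R q _) (norm_nonneg _)
        _ = _ := by ring
    refine (Finset.sum_le_sum e2).trans ?_
    rw [← Finset.mul_sum]
    have e3 : ∑ j ∈ Finset.range (R + R), ‖q (-R + j)‖ ≤ ∑' n, ‖q n‖ := by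
      have hinj : Function.Injective (fun j : ℕ => (-(R : ℤ) + j)) := by
        intro a b h
        simpa using h
      refine ((hq.comp_injective hinj).sum_le_tsum _ fun j _ => norm_nonneg _).trans ?_
      exact tsum_comp_le_tsum_of_inj hq (fun n => norm_nonneg _) hinj
    calc max M 0 * ‖x ^ (J + 1)‖ * ∑ j ∈ Finset.range (R + R), ‖q (-R + j)‖
        ≤ max M 0 * ‖x ^ (J + 1)‖ * ∑' n, ‖q n‖ := by gcongr
      _ = _ := by
          rw [hM']
          ring
  have hD : ∀ k, Tendsto (D k) atTop (𝓝 (conservedI q p k)) := by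
    intro k
    obtain ⟨C, hC⟩ := exists_bound_density K hK0.le k
    refine tendsto_sum_window (F := fun R n => density (cutoff R q) (cutoff R p) k n)
      (hq.mul_left (max C 0)) (fun R n => ?_) fun n => ?_
    · refine (hC (cutoff R q) (cutoff R p) (fun n => (norm_cutoff_le R q n).trans (hqK n))
        (fun n => (norm_cutoff_le R p n).trans (hpK n)) n).trans ?_
      exact mul_le_mul (le_max_left _ _) (norm_cutoff_le R q n) (norm_nonneg _) (le_max_right _ _)
    · filter_upwards [eventually_ge_atTop (n.natAbs + k + 1)] with R hR
      exact density_cutoff R q p k n (by omega)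
  have hF : Tendsto F atTop (𝓝 (-conservedI0 q p)) := by
    rw [conservedI0, neg_neg]
    exact tendsto_sum_window (F := fun _ n => Complex.log (normF q p n))
      (summable_log_normF hq hp).norm (fun R n => le_rfl) fun n => Eventually.of_forall fun _ => rfl
  have ha : Tendsto (fun R => (cutColumn q p R x (R + R)).1) atTop (𝓝 (transm q p x)) := by
    have h1 := ((tendsto_leftRow hq hp hqp 0 hx1').mul (tendsto_rightRow hq hp hqp 0 hx1')).add
      (((tendsto_leftRow hq hp hqp 1 hx1').mul
        (tendsto_rightRow hq hp hqp 1 hx1')).const_mul x)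
    exact h1.congr fun R => (cutColumn_two_mul q p R hx0).symm
  have hlim : Tendsto (fun R => Complex.exp (E R - ∑ k ∈ Finset.Icc 1 J, D k R * x ^ k)) atTop
      (𝓝 (transm q p x * Complex.exp (-conservedI0 q p
        - ∑ k ∈ Finset.Icc 1 J, conservedI q p k * x ^ k))) := by
    have h1 := hF.sub (tendsto_finsetSum (Finset.Icc 1 J) fun k _ => (hD k).mul_const (x ^ k))
    refine (ha.mul h1.cexp).congr fun R => ?_
    rw [cutColumn_eq_exp hK hqK hpK hqp hxρ, Finset.sum_add_distrib, ← Complex.exp_add]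
    congr 1
    simp only [E, F, Finset.sum_neg_distrib]
    ring
  refine le_of_tendsto (hlim.sub_const 1).norm (Eventually.of_forall fun R => ?_)
  refine (Complex.norm_exp_sub_one_le ((hED R).trans hxM)).trans ?_
  have := hED R
  rw [mul_assoc]
  gcongr

theorem transm_zero : transm q p 0 = Complex.exp (conservedI0 q p) := by
  have h1 := transm_mul_exp_isBigO hq hp hqp 0
  have h0 : Tendsto (fun x : ℂ => x ^ (0 + 1)) (𝓝[≠] 0) (𝓝 0) := by
    have : Tendsto (fun x : ℂ => x ^ (0 + 1)) (𝓝 0) (𝓝 ((0 : ℂ) ^ (0 + 1))) :=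
      Continuous.tendsto (by fun_prop) 0
    simpa using this.mono_left nhdsWithin_le_nhds
  have h2 := h1.trans_tendsto h0
  have hc : ContinuousAt (transm q p) 0 :=
    ((diffContOnCl_transm hq hp hqp).differentiableAt Metric.isOpen_ball (by simp)).continuousAt
  have h3 : Tendsto (fun x => transm q p x * Complex.exp (-conservedI0 q p
      - ∑ k ∈ Finset.Icc 1 0, conservedI q p k * x ^ k) - 1) (𝓝[≠] 0)
      (𝓝 (transm q p 0 * Complex.exp (-conservedI0 q p) - 1)) := by
    simp only [Finset.Icc_eq_empty_of_lt zero_lt_one, Finset.sum_empty, sub_zero]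
    exact ((hc.tendsto.mono_left nhdsWithin_le_nhds).mul_const _).sub_const 1
  have h4 := tendsto_nhds_unique h3 h2
  rw [Complex.exp_neg, sub_eq_zero, mul_inv_eq_one₀ (Complex.exp_ne_zero _)] at h4
  exact h4

omit hq hp hqp in
theorem conservedI0_swap : conservedI0 q p = conservedI0 p q := by
  simp only [conservedI0, normF_swap (q := q)]

omit hqp in
theorem multipliable_normF : Multipliable (normF q p) :=
  Complex.multipliable_of_summable_log (summable_log_normF hq hp)

theorem prodC_eq_exp : prodC q p = Complex.exp (-conservedI0 q p) := by
  rw [prodC, conservedI0, neg_neg]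
  exact (Complex.cexp_tsum_eq_tprod (normF_ne_zero hqp) (summable_log_normF hq hp)).symm

end

/-! ### Comparison of Taylor coefficients -/

theorem coeff_eq_zero_of_isBigO (n : ℕ) : ∀ d : ℕ → ℂ,
    (fun x : ℂ => ∑ k ∈ Finset.range n, d k * x ^ k) =O[𝓝[≠] 0] (fun x => x ^ n) →
    ∀ k < n, d k = 0 := by
  induction n with
  | zero => intro d _ k hk; omega
  | succ n ih =>
    intro d hd
    have hlim : Tendsto (fun x : ℂ => x ^ (n + 1)) (𝓝[≠] 0) (𝓝 0) := by
      have : Tendsto (fun x : ℂ => x ^ (n + 1)) (𝓝 0) (𝓝 ((0 : ℂ) ^ (n + 1))) :=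
        Continuous.tendsto (by fun_prop) 0
      simpa using this.mono_left nhdsWithin_le_nhds
    have hlim2 : Tendsto (fun x : ℂ => ∑ k ∈ Finset.range (n + 1), d k * x ^ k) (𝓝[≠] 0)
        (𝓝 (d 0)) := by
      have : Tendsto (fun x : ℂ => ∑ k ∈ Finset.range (n + 1), d k * x ^ k) (𝓝 0)
          (𝓝 (∑ k ∈ Finset.range (n + 1), d k * (0 : ℂ) ^ k)) :=
        Continuous.tendsto (by fun_prop) 0
      rw [Finset.sum_range_succ'] at this
      simpa using this.mono_left nhdsWithin_le_nhds
    have h0 : d 0 = 0 := tendsto_nhds_unique hlim2 (hd.trans_tendsto hlim)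
    have hd' : (fun x : ℂ => ∑ k ∈ Finset.range n, d (k + 1) * x ^ k) =O[𝓝[≠] 0]
        (fun x => x ^ n) := by
      have h1 := (isBigO_refl (fun x : ℂ => x⁻¹) (𝓝[≠] 0)).mul hd
      refine h1.congr' ?_ ?_
      · filter_upwards [self_mem_nhdsWithin] with x hx
        have hx' : x ≠ 0 := hx
        rw [Finset.sum_range_succ', h0, zero_mul, add_zero, Finset.mul_sum]
        refine Finset.sum_congr rfl fun k _ => ?_
        rw [pow_succ]
        field_simp
      · filter_upwards [self_mem_nhdsWithin] with x hx
        have hx' : x ≠ 0 := hx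
        rw [pow_succ]
        field_simp
    intro k hk
    rcases k with _ | k
    · exact h0
    · exact ih (fun k => d (k + 1)) hd' k (by omega)

/-- A function with a limit at `0` is constant up to order `n` as soon as its exponential equals
one up to order `n`. -/
theorem isBigO_sub_of_exp {h : ℂ → ℂ} {c : ℂ} {n : ℕ} (hn : 1 ≤ n)
    (hc : Tendsto h (𝓝[≠] 0) (𝓝 c))
    (he : (fun x => Complex.exp (h x) - 1) =O[𝓝[≠] 0] fun x => x ^ n) :
    (fun x => h x - c) =O[𝓝[≠] 0] fun x => x ^ n := by
  have hlim : Tendsto (fun x : ℂ => x ^ n) (𝓝[≠] 0) (𝓝 0) := by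
    have : Tendsto (fun x : ℂ => x ^ n) (𝓝 0) (𝓝 ((0 : ℂ) ^ n)) :=
      Continuous.tendsto (by fun_prop) 0
    simpa [show n ≠ 0 by omega] using this.mono_left nhdsWithin_le_nhds
  have hexp : Complex.exp c = 1 :=
    sub_eq_zero.1 (tendsto_nhds_unique (hc.cexp.sub_const 1) (he.trans_tendsto hlim))
  have h1 := (HasDerivAtFilter.isTheta_sub (Complex.hasDerivAt_exp c)
    (Complex.exp_ne_zero c)).isBigO_symm.comp_tendsto (hc.prodMk tendsto_const_pure)
  simp only [Function.comp_def, hexp] at h1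
  exact h1.trans he

/-- Taylor's formula, the coefficients being Fourier coefficients of the boundary values. -/
theorem isBigO_sub_boundaryCoeff {U : ℂ → ℂ} (hU : DiffContOnCl ℂ U (Metric.ball 0 1)) (n : ℕ) :
    (fun x => U x - ∑ k ∈ Finset.range n, boundaryCoeff U k * x ^ k) =O[𝓝 0] fun x => x ^ n := by
  have h1 : HasFPowerSeriesOnBall U (cauchyPowerSeries U 0 ((1 : NNReal) : ℝ)) 0 (1 : NNReal) :=
    DiffContOnCl.hasFPowerSeriesOnBall (by simpa using hU) one_pos
  have h2 := h1.hasFPowerSeriesAt.isBigO_sub_partialSum_pow n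
  have h3 : ∀ x : ℂ, (cauchyPowerSeries U 0 ((1 : NNReal) : ℝ)).partialSum n x
      = ∑ k ∈ Finset.range n, boundaryCoeff U k * x ^ k := by
    intro x
    rw [FormalMultilinearSeries.partialSum]
    refine Finset.sum_congr rfl fun k _ => ?_
    rw [cauchyPowerSeries_apply, boundaryCoeff, Real.circleAverage_eq_circleIntegral one_ne_zero,
      smul_mul_assoc]
    congr 1
    rw [mul_comm, ← circleIntegral.integral_const_mul]
    refine circleIntegral.integral_congr zero_le_one fun z _ => ?_
    simp only [sub_zero, smul_eq_mul]
    rw [div_pow]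
    ring
  simp only [h3, zero_add] at h2
  refine h2.trans (isBigO_of_le _ fun x => by simp)

theorem isBigO_log_one_sub (t : ℂ) (n : ℕ) :
    (fun x => Complex.log (1 - t * x) - ∑ k ∈ Finset.range n, (-(t ^ k / k)) * x ^ k)
      =O[𝓝 0] fun x => x ^ n := by
  rcases n with _ | n
  · have hc : ContinuousAt (fun x => Complex.log (1 - t * x)) 0 := by
      refine ContinuousAt.clog (by fun_prop) ?_
      simp
    have h1 := hc.tendsto.isBigO_one ℂ
    simpa using h1
  · have h0 : Tendsto (fun x : ℂ => -(t * x)) (𝓝 0) (𝓝 0) := by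
      have : Tendsto (fun x : ℂ => -(t * x)) (𝓝 0) (𝓝 (-(t * 0))) :=
        Continuous.tendsto (by fun_prop) 0
      simpa using this
    have h1 := (Complex.log_sub_logTaylor_isBigO n).comp_tendsto h0
    refine (h1.congr_left fun x => ?_).trans ?_
    · simp only [Function.comp_apply, Complex.logTaylor]
      rw [← sub_eq_add_neg]
      congr 1
      refine Finset.sum_congr rfl fun k _ => ?_
      rw [neg_pow (t * x), mul_pow, pow_succ]
      have : (-1 : ℂ) ^ k * (-1) ^ k = 1 := by rw [← mul_pow]; simp
      linear_combination (-(t ^ k * x ^ k / k)) * this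
    · refine IsBigO.of_bound (‖t‖ ^ (n + 1)) (Eventually.of_forall fun x => ?_)
      simp [mul_pow]

/-- The coefficients of the logarithm of `exp U · ∏ (1 - t x) / ∏ (1 - t' x)`. -/
theorem conservedI_eq_of_factorization {q p : ℤ → ℂ} (hq : Summable fun n => ‖q n‖)
    (hp : Summable fun n => ‖p n‖) (hqp : ∀ n, 1 - q n * p n ≠ 0) {U : ℂ → ℂ}
    (hU : DiffContOnCl ℂ U (Metric.ball 0 1)) {N Nt : ℕ} (t : Fin N → ℂ) (t' : Fin Nt → ℂ) {c : ℂ}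
    (hc : c ≠ 0)
    (hfac : ∀ x, ‖x‖ ≤ 1 → transm q p x * ∏ l, (1 - t' l * x)
      = c * Complex.exp (U x) * ∏ j, (1 - t j * x)) {k : ℕ} (hk : 1 ≤ k) :
    conservedI q p k = boundaryCoeff U k - (∑ j, t j ^ k) / k + (∑ l, t' l ^ k) / k := by
  obtain ⟨γ, rfl⟩ : ∃ γ, Complex.exp γ = c := ⟨Complex.log c, Complex.exp_log hc⟩
  -- a logarithm of the transmission coefficient near the origin
  let Y : ℂ → ℂ := fun x => U x + ∑ j, Complex.log (1 - t j * x) - ∑ l, Complex.log (1 - t' l * x)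
  let y : ℕ → ℂ := fun m => boundaryCoeff U m - (∑ j, t j ^ m) / m + (∑ l, t' l ^ m) / m
  have hY : (fun x => Y x - ∑ m ∈ Finset.range (k + 1), y m * x ^ m) =O[𝓝 0]
      fun x => x ^ (k + 1) := by
    have h1 := ((isBigO_sub_boundaryCoeff hU (k + 1)).add (IsBigO.fun_sum (s := Finset.univ)
      fun j _ => isBigO_log_one_sub (t j) (k + 1))).sub (IsBigO.fun_sum (s := Finset.univ)
      fun l _ => isBigO_log_one_sub (t' l) (k + 1))
    refine h1.congr_left fun x => ?_
    have e : ∀ {n : ℕ} (s : Fin n → ℂ),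
        ∑ j, ∑ m ∈ Finset.range (k + 1), (-(s j ^ m / m)) * x ^ m
          = -∑ m ∈ Finset.range (k + 1), (∑ j, s j ^ m) / m * x ^ m := by
      intro n s
      rw [Finset.sum_comm, ← Finset.sum_neg_distrib]
      refine Finset.sum_congr rfl fun m _ => ?_
      rw [Finset.sum_div, Finset.sum_mul, ← Finset.sum_neg_distrib]
      refine Finset.sum_congr rfl fun j _ => ?_
      ring
    simp only [Finset.sum_sub_distrib, e, Y, y, sub_mul, add_mul, Finset.sum_add_distrib]
    ring
  have hne : ∀ s : ℂ, ∀ᶠ x in 𝓝 (0 : ℂ), 1 - s * x ≠ 0 := by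
    intro s
    have h1 : ContinuousAt (fun x : ℂ => 1 - s * x) 0 := by fun_prop
    exact h1.eventually_ne (by simp)
  have hexpY : ∀ᶠ x in 𝓝 (0 : ℂ), transm q p x = Complex.exp (γ + Y x) := by
    have hne1 : ∀ᶠ x in 𝓝 (0 : ℂ), ∀ j, 1 - t j * x ≠ 0 := eventually_all.2 fun j => hne _
    have hne2 : ∀ᶠ x in 𝓝 (0 : ℂ), ∀ l, 1 - t' l * x ≠ 0 := eventually_all.2 fun l => hne _
    filter_upwards [hne1, hne2, Metric.ball_mem_nhds (0 : ℂ) one_pos] with x h1 h2 h3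
    have h4 := hfac x (by simpa using (Metric.mem_ball.1 h3).le)
    have h5 : ∏ l, (1 - t' l * x) ≠ 0 := Finset.prod_ne_zero_iff.2 fun l _ => h2 l
    simp only [Y, Complex.exp_add, Complex.exp_sub, Complex.exp_sum]
    rw [Finset.prod_congr rfl fun j _ => Complex.exp_log (h1 j),
      Finset.prod_congr rfl fun l _ => Complex.exp_log (h2 l)]
    rw [eq_comm, mul_div_assoc', ← mul_assoc, ← h4, mul_div_assoc, div_self h5, mul_one]
  set I₀ := conservedI0 q p
  let h : ℂ → ℂ := fun x => γ + Y x - I₀ - ∑ m ∈ Finset.Icc 1 k, conservedI q p m * x ^ m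
  have hexp : (fun x => Complex.exp (h x) - 1) =O[𝓝[≠] 0] fun x => x ^ (k + 1) := by
    refine (transm_mul_exp_isBigO hq hp hqp k).congr' ?_ EventuallyEq.rfl
    filter_upwards [nhdsWithin_le_nhds hexpY] with x hx
    rw [hx, ← Complex.exp_add]
    congr 2
    simp only [h, I₀]
    ring
  have hlimY : Tendsto Y (𝓝 0) (𝓝 (U 0)) := by
    have hUc : ContinuousAt U 0 :=
      (hU.differentiableAt Metric.isOpen_ball (by simp)).continuousAt
    have hl : ∀ s : ℂ, Tendsto (fun x => Complex.log (1 - s * x)) (𝓝 0) (𝓝 0) := by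
      intro s
      have h1 : ContinuousAt (fun x => Complex.log (1 - s * x)) 0 :=
        ContinuousAt.clog (by fun_prop) (by simp)
      simpa using h1.tendsto
    have h1 := (hUc.tendsto.add (tendsto_finsetSum Finset.univ fun j _ => hl (t j))).sub
      (tendsto_finsetSum Finset.univ fun l _ => hl (t' l))
    simpa using h1
  have hlim : Tendsto h (𝓝[≠] 0) (𝓝 (γ + U 0 - I₀)) := by
    have h1 : Tendsto (fun x : ℂ => ∑ m ∈ Finset.Icc 1 k, conservedI q p m * x ^ m) (𝓝 0) (𝓝 0) := by
      have h2 : Tendsto (fun x : ℂ => ∑ m ∈ Finset.Icc 1 k, conservedI q p m * x ^ m) (𝓝 0)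
          (𝓝 (∑ m ∈ Finset.Icc 1 k, conservedI q p m * (0 : ℂ) ^ m)) :=
        Continuous.tendsto (by fun_prop) 0
      rw [Finset.sum_eq_zero] at h2
      · exact h2
      · intro m hm
        have := (Finset.mem_Icc.1 hm).1
        simp [show m ≠ 0 by omega]
    have h3 := ((hlimY.const_add γ).sub_const I₀).sub h1
    rw [sub_zero] at h3
    exact h3.mono_left nhdsWithin_le_nhds
  have hO := isBigO_sub_of_exp (by omega) hlim hexp
  have hO2 := hO.sub (hY.mono nhdsWithin_le_nhds)
  -- the difference of the two expansions is a polynomial that vanishes to order `k + 1`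
  let d : ℕ → ℂ := fun m => if m = 0 then y 0 - U 0 else y m - conservedI q p m
  have hd := coeff_eq_zero_of_isBigO (k + 1) d (hO2.congr_left fun x => by
    have e1 : ∑ m ∈ Finset.Icc 1 k, conservedI q p m * x ^ m
        = ∑ m ∈ Finset.range k, conservedI q p (m + 1) * x ^ (m + 1) := by
      rw [Finset.range_eq_Ico, Finset.sum_Ico_add' (fun m => conservedI q p m * x ^ m) 0 k 1]
      rfl
    simp only [h]
    rw [e1, Finset.sum_range_succ', Finset.sum_range_succ']
    simp only [d, if_true, Nat.succ_ne_zero, if_false, sub_mul, Finset.sum_sub_distrib]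
    ring) k (by omega)
  simp only [d, show k ≠ 0 by omega, if_false] at hd
  exact (sub_eq_zero.1 hd).symm

/-! ### Factorization of the transmission coefficients and branches of the logarithm -/

/-- `U` and `V` are logarithms, holomorphic in the unit disc and continuous up to the boundary, of
the transmission coefficients divided by Blaschke-type factors carrying their zeros. -/
structure SpectralLogs (q p : ℤ → ℂ) {N Nt : ℕ} (z : Fin N → ℂ) (zt : Fin Nt → ℂ)
    (U V : ℂ → ℂ) : Prop where
  diffU : DiffContOnCl ℂ U (Metric.ball 0 1)
  diffV : DiffContOnCl ℂ V (Metric.ball 0 1)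
  expU : ∀ x, ‖x‖ ≤ 1 → transm q p x * ∏ l, (1 - zt l ^ 2 * x)
    = Complex.exp (U x) * ∏ j, (1 - z j ^ 2 * x)
  expV : ∀ y, ‖y‖ ≤ 1 → transm p q y * ∏ j, (y - z j ^ 2)
    = Complex.exp (V y) * ∏ l, (y - zt l ^ 2)

theorem IsLogBranch.exists_eq_add {g : ℂ → ℂ} {ℓ ℓ' : ℝ → ℂ} (h : IsLogBranch g ℓ)
    (h' : IsLogBranch g ℓ') : ∃ m : ℤ, ∀ θ ∈ Set.Icc (0 : ℝ) (2 * Real.pi),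
      ℓ θ = ℓ' θ + m * (2 * Real.pi * Complex.I) := by
  have hex : ∀ θ ∈ Set.Icc (0 : ℝ) (2 * Real.pi), ∃ m : ℤ,
      ℓ θ = ℓ' θ + m * (2 * Real.pi * Complex.I) := fun θ hθ =>
    Complex.exp_eq_exp_iff_exists_int.1 ((h.2 θ hθ).trans (h'.2 θ hθ).symm)
  have hpi : (2 * Real.pi * Complex.I : ℂ) ≠ 0 := Complex.two_pi_I_ne_zero
  -- the integer is a continuous function of the angle
  let f : ℝ → ℝ := fun θ => ((ℓ θ - ℓ' θ) / (2 * Real.pi * Complex.I)).re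
  have hf : ContinuousOn f (Set.Icc 0 (2 * Real.pi)) :=
    Complex.continuous_re.comp_continuousOn ((h.1.sub h'.1).div_const _)
  have hfm : ∀ θ ∈ Set.Icc (0 : ℝ) (2 * Real.pi), ∀ m : ℤ,
      ℓ θ = ℓ' θ + m * (2 * Real.pi * Complex.I) → f θ = m := by
    intro θ _ m hm
    simp only [f]
    rw [hm, add_sub_cancel_left, mul_div_assoc, div_self hpi, mul_one, Complex.intCast_re]
  have hdisc : DiscreteTopology (Set.range ((↑) : ℤ → ℝ)) :=
    Int.isClosedEmbedding_coe_real.isEmbedding.toHomeomorph.symm.isEmbedding.discreteTopology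
  have h0 : (0 : ℝ) ∈ Set.Icc (0 : ℝ) (2 * Real.pi) := ⟨le_rfl, Real.two_pi_pos.le⟩
  obtain ⟨m, hm⟩ := hex 0 h0
  refine ⟨m, fun θ hθ => ?_⟩
  obtain ⟨m', hm'⟩ := hex θ hθ
  have heq : f θ = f 0 := isPreconnected_Icc.constant_of_mapsTo
    (T := Set.range ((↑) : ℤ → ℝ)) ⟨hdisc⟩ hf (fun θ hθ => by
      obtain ⟨k, hk⟩ := hex θ hθ
      exact ⟨k, (hfm θ hθ k hk).symm⟩) hθ h0
  rw [hfm θ hθ m' hm', hfm 0 h0 m hm] at heq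
  rw [hm', show m' = m from by exact_mod_cast heq]

theorem prod_one_sub_mul_inv {n : ℕ} (s : Fin n → ℂ) {y : ℂ} (hy : y ≠ 0) :
    ∏ j, (1 - s j * y⁻¹) = (∏ j, (y - s j)) / y ^ n := by
  rw [eq_div_iff (pow_ne_zero _ hy)]
  calc (∏ j, (1 - s j * y⁻¹)) * y ^ n = (∏ j, (1 - s j * y⁻¹)) * ∏ _j : Fin n, y := by simp
    _ = ∏ j, (1 - s j * y⁻¹) * y := Finset.prod_mul_distrib.symm
    _ = _ := Finset.prod_congr rfl fun j _ => by field_simp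

theorem prod_sub_eq {n : ℕ} (s : Fin n → ℂ) (hs : ∀ j, s j ≠ 0) (y : ℂ) :
    ∏ j, (y - s j) = (∏ j, (-s j)) * ∏ j, (1 - (s j)⁻¹ * y) := by
  rw [← Finset.prod_mul_distrib]
  refine Finset.prod_congr rfl fun j _ => ?_
  have := hs j
  field_simp
  ring

section

variable {q p : ℤ → ℂ} (hq : Summable fun n => ‖q n‖) (hp : Summable fun n => ‖p n‖)
  (hqp : ∀ n, 1 - q n * p n ≠ 0) {N Nt : ℕ} {z : Fin N → ℂ} {zt : Fin Nt → ℂ}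
include hq hp hqp

theorem transm_zero_ne_zero : transm q p 0 ≠ 0 := by
  rw [transm_zero hq hp hqp]
  exact Complex.exp_ne_zero _

theorem exists_factor_transm (hz : ∀ j, 1 < ‖z j‖)
    (hz_ne : ∀ j k, j ≠ k → z j ≠ z k ∧ z j ≠ -z k)
    (hz_zeros : ∀ ζ : ℂ, 1 ≤ ‖ζ‖ → (aCoef q p ζ = 0 ↔ ∃ j, ζ = z j ∨ ζ = -z j))
    (hz_simple : ∀ j, deriv (aCoef q p) (z j) ≠ 0) :
    ∃ g : ℂ → ℂ, DiffContOnCl ℂ g (Metric.ball 0 1) ∧ (∀ x, ‖x‖ ≤ 1 → g x ≠ 0) ∧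
      ∀ x, transm q p x = g x * ∏ j, (x - (z j ^ 2)⁻¹) := by
  have hz0 : ∀ j, z j ≠ 0 := fun j => ne_zero_of_one_le_norm (hz j).le
  refine exists_factor_simple_zeros Finset.univ (fun j => (z j ^ 2)⁻¹) (fun j _ => ?_)
    (fun j _ k _ h => ?_) _ (diffContOnCl_transm hq hp hqp) (fun x hx => ?_) fun j _ h => ?_
  · rw [norm_inv, norm_pow]
    exact inv_lt_one_of_one_lt₀ (one_lt_pow₀ (hz j) two_ne_zero)
  · by_contra hjk
    rcases (sq_eq_sq_iff_eq_or_eq_neg).1 (inv_injective h) with h1 | h1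
    · exact (hz_ne j k hjk).1 h1
    · exact (hz_ne j k hjk).2 h1
  · rcases eq_or_ne x 0 with rfl | hx0
    · constructor
      · intro h
        exact absurd h (transm_zero_ne_zero hq hp hqp)
      · rintro ⟨j, -, h⟩
        exact absurd h.symm (inv_ne_zero (pow_ne_zero 2 (hz0 j)))
    · obtain ⟨ζ, hζ⟩ := IsAlgClosed.exists_pow_nat_eq x⁻¹ (n := 2) two_pos
      have hζ1 : 1 ≤ ‖ζ‖ := by
        have h1 : 1 ≤ ‖ζ‖ ^ 2 := by
          rw [← norm_pow, hζ, norm_inv]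
          exact (one_le_inv₀ (norm_pos_iff.2 hx0)).2 hx
        by_contra h
        exact absurd h1 (not_le.2 (pow_lt_one₀ (norm_nonneg _) (not_le.1 h) two_ne_zero))
      have hxζ : x = (ζ ^ 2)⁻¹ := by rw [hζ, inv_inv]
      rw [hxζ, ← aCoef_eq_transm hq hp hqp hζ1, hz_zeros ζ hζ1]
      simp only [Finset.mem_univ, true_and, inv_inj]
      exact exists_congr fun j => (sq_eq_sq_iff_eq_or_eq_neg).symm
  · refine hz_simple j ?_
    rw [(hasDerivAt_aCoef hq hp hqp (hz j)).deriv, h, zero_mul]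

theorem exists_factor_transm_swap (hzt : ∀ l, ‖zt l‖ < 1)
    (hzt_ne : ∀ l k, l ≠ k → zt l ≠ zt k ∧ zt l ≠ -zt k)
    (hzt_zeros : ∀ ζ : ℂ, ‖ζ‖ ≤ 1 → (aTilde q p ζ = 0 ↔ ∃ l, ζ = zt l ∨ ζ = -zt l))
    (hzt_simple : ∀ l, deriv (aTilde q p) (zt l) ≠ 0) :
    ∃ g : ℂ → ℂ, DiffContOnCl ℂ g (Metric.ball 0 1) ∧ (∀ y, ‖y‖ ≤ 1 → g y ≠ 0) ∧
      ∀ y, transm p q y = g y * ∏ l, (y - zt l ^ 2) := by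
  refine exists_factor_simple_zeros Finset.univ (fun l => zt l ^ 2) (fun l _ => ?_)
    (fun l _ k _ h => ?_) _ (diffContOnCl_transm hp hq (one_sub_swap hqp)) (fun y hy => ?_)
    fun l _ h => ?_
  · rw [norm_pow]
    exact pow_lt_one₀ (norm_nonneg _) (hzt l) two_ne_zero
  · by_contra hlk
    rcases (sq_eq_sq_iff_eq_or_eq_neg).1 h with h1 | h1
    · exact (hzt_ne l k hlk).1 h1
    · exact (hzt_ne l k hlk).2 h1
  · obtain ⟨ζ, rfl⟩ := IsAlgClosed.exists_pow_nat_eq y (n := 2) two_pos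
    have hζ1 : ‖ζ‖ ≤ 1 := by
      by_contra h
      rw [norm_pow] at hy
      exact absurd hy (not_le.2 (one_lt_pow₀ (not_le.1 h) two_ne_zero))
    rw [← aTilde_eq_transm hq hp hqp hζ1, hzt_zeros ζ hζ1]
    simp only [Finset.mem_univ, true_and]
    exact exists_congr fun l => (sq_eq_sq_iff_eq_or_eq_neg).symm
  · refine hzt_simple l ?_
    rw [(hasDerivAt_aTilde hq hp hqp (hzt l)).deriv, h, zero_mul]

theorem exists_spectralLogs (hz : ∀ j, 1 < ‖z j‖) (hzt : ∀ l, ‖zt l‖ < 1)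
    (hz_ne : ∀ j k, j ≠ k → z j ≠ z k ∧ z j ≠ -z k)
    (hzt_ne : ∀ l k, l ≠ k → zt l ≠ zt k ∧ zt l ≠ -zt k)
    (hz_zeros : ∀ ζ : ℂ, 1 ≤ ‖ζ‖ → (aCoef q p ζ = 0 ↔ ∃ j, ζ = z j ∨ ζ = -z j))
    (hzt_zeros : ∀ ζ : ℂ, ‖ζ‖ ≤ 1 → (aTilde q p ζ = 0 ↔ ∃ l, ζ = zt l ∨ ζ = -zt l))
    (hz_simple : ∀ j, deriv (aCoef q p) (z j) ≠ 0)
    (hzt_simple : ∀ l, deriv (aTilde q p) (zt l) ≠ 0) :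
    ∃ U V, SpectralLogs q p z zt U V := by
  have hz0 : ∀ j, z j ^ 2 ≠ 0 := fun j => pow_ne_zero 2 (ne_zero_of_one_le_norm (hz j).le)
  have hzt2 : ∀ l, ‖zt l ^ 2‖ < 1 := fun l => by
    rw [norm_pow]
    exact pow_lt_one₀ (norm_nonneg _) (hzt l) two_ne_zero
  obtain ⟨g, hg, hg0, hgf⟩ := exists_factor_transm hq hp hqp hz hz_ne hz_zeros hz_simple
  obtain ⟨h, hh, hh0, hhf⟩ :=
    exists_factor_transm_swap hq hp hqp hzt hzt_ne hzt_zeros hzt_simple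
  have hprod : ∏ j, (-z j ^ 2) ≠ 0 := Finset.prod_ne_zero_iff.2 fun j _ => neg_ne_zero.2 (hz0 j)
  obtain ⟨U, hU, hUe⟩ := exists_log_diffContOnCl
    (P := fun x => g x * ((∏ j, (-z j ^ 2))⁻¹ * ∏ l, (1 - zt l ^ 2 * x)))
    (diffContOnCl_mul hg (Differentiable.diffContOnCl (by fun_prop))) fun x hx =>
      mul_ne_zero (hg0 x hx) (mul_ne_zero (inv_ne_zero hprod)
        (Finset.prod_ne_zero_iff.2 fun l _ => one_sub_mul_ne_zero (hzt2 l) hx))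
  obtain ⟨V, hV, hVe⟩ := exists_log_diffContOnCl (P := fun y => h y * ∏ j, (y - z j ^ 2))
    (diffContOnCl_mul hh (Differentiable.diffContOnCl (by fun_prop))) fun y hy =>
      mul_ne_zero (hh0 y hy) (Finset.prod_ne_zero_iff.2 fun j _ hj => by
        rw [sub_eq_zero.1 hj, norm_pow] at hy
        exact absurd hy (not_le.2 (one_lt_pow₀ (hz j) two_ne_zero)))
  refine ⟨U, V, hU, hV, fun x hx => ?_, fun y hy => ?_⟩
  · have h1 := prod_sub_eq (fun j => (z j ^ 2)⁻¹) (fun j => inv_ne_zero (hz0 j)) x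
    simp only [inv_inv] at h1
    have h2 : ∏ j, (-(z j ^ 2)⁻¹) = (∏ j, (-z j ^ 2))⁻¹ := by
      rw [← Finset.prod_inv_distrib]
      exact Finset.prod_congr rfl fun j _ => by rw [inv_neg]
    rw [hUe x hx, hgf x, h1, h2]
    ring
  · rw [hVe y hy, hhf y]
    ring

end

section SpectralLogs

variable {q p : ℤ → ℂ} {N Nt : ℕ} {z : Fin N → ℂ} {zt : Fin Nt → ℂ} {U V : ℂ → ℂ}

theorem SpectralLogs.add_int (h : SpectralLogs q p z zt U V) (m : ℤ) :
    SpectralLogs q p z zt (fun x => U x + m * (2 * Real.pi * Complex.I)) V where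
  diffU := h.diffU.add_const _
  diffV := h.diffV
  expU x hx := by
    rw [Complex.exp_add, Complex.exp_int_mul_two_pi_mul_I, mul_one]
    exact h.expU x hx
  expV := h.expV

variable (hq : Summable fun n => ‖q n‖) (hp : Summable fun n => ‖p n‖)
  (hqp : ∀ n, 1 - q n * p n ≠ 0) (hz : ∀ j, 1 < ‖z j‖) (hzt : ∀ l, ‖zt l‖ < 1)
include hq hp hqp

theorem SpectralLogs.exp_U_zero (h : SpectralLogs q p z zt U V) :
    Complex.exp (U 0) = Complex.exp (conservedI0 q p) := by
  have h1 := h.expU 0 (by simp)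
  simp only [mul_zero, sub_zero, Finset.prod_const_one, mul_one] at h1
  rw [← h1, transm_zero hq hp hqp]

theorem SpectralLogs.exp_V_zero (h : SpectralLogs q p z zt U V) :
    Complex.exp (conservedI0 q p) * ∏ j, (-z j ^ 2) = Complex.exp (V 0) * ∏ l, (-zt l ^ 2) := by
  have h1 := h.expV 0 (by simp)
  simp only [zero_sub] at h1
  rw [← h1, transm_zero hp hq (one_sub_swap hqp), conservedI0_swap]

include hz hzt

omit hzt in
theorem SpectralLogs.zt_ne_zero (h : SpectralLogs q p z zt U V) (l : Fin Nt) : zt l ≠ 0 := by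
  intro hl
  have h1 := h.exp_V_zero hq hp hqp
  rw [Finset.prod_eq_zero (f := fun l => -zt l ^ 2) (Finset.mem_univ l) (by simp [hl]),
    mul_zero] at h1
  refine mul_ne_zero (Complex.exp_ne_zero _) (Finset.prod_ne_zero_iff.2 fun j _ => ?_) h1
  exact neg_ne_zero.2 (pow_ne_zero 2 (ne_zero_of_one_le_norm (hz j).le))

theorem SpectralLogs.exp_boundary (h : SpectralLogs q p z zt U V) {ξ : ℂ} (hξ : ‖ξ‖ = 1) :
    Complex.exp (U ((ξ ^ 2)⁻¹) + V (ξ ^ 2))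
      = ξ ^ (2 * ((N : ℤ) - (Nt : ℤ))) * onePlusBB q p ξ := by
  have hξ0 := ne_zero_of_norm_eq_one hξ
  have hy0 : ξ ^ 2 ≠ 0 := pow_ne_zero 2 hξ0
  have h1 := h.expU (ξ ^ 2)⁻¹ (by simp [hξ])
  have h2 := h.expV (ξ ^ 2) (by simp [hξ])
  rw [prod_one_sub_mul_inv (fun l => zt l ^ 2) hy0,
    prod_one_sub_mul_inv (fun j => z j ^ 2) hy0] at h1
  have hA : ∏ j, (ξ ^ 2 - z j ^ 2) ≠ 0 := Finset.prod_ne_zero_iff.2 fun j _ hj => by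
    have h3 := one_lt_pow₀ (hz j) two_ne_zero
    rw [← norm_pow, ← sub_eq_zero.1 hj, norm_pow, hξ] at h3
    norm_num at h3
  have hB : ∏ l, (ξ ^ 2 - zt l ^ 2) ≠ 0 := Finset.prod_ne_zero_iff.2 fun l _ =>
    sub_ne_zero_of_norm_lt_one (by simp [hξ]) (by
      rw [norm_pow]
      exact pow_lt_one₀ (norm_nonneg _) (hzt l) two_ne_zero)
  have hzp : ξ ^ (2 * ((N : ℤ) - (Nt : ℤ))) = (ξ ^ 2) ^ N / (ξ ^ 2) ^ Nt := by
    rw [zpow_mul, zpow_sub₀ (zpow_ne_zero 2 hξ0)]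
    norm_cast
  rw [onePlusBB_eq hq hp hqp hξ, hzp, Complex.exp_add]
  have hyN : (ξ ^ 2) ^ N ≠ 0 := pow_ne_zero _ hy0
  have hyNt : (ξ ^ 2) ^ Nt ≠ 0 := pow_ne_zero _ hy0
  generalize (ξ ^ 2) ^ N = yN at *
  generalize (ξ ^ 2) ^ Nt = yNt at *
  generalize ∏ j, (ξ ^ 2 - z j ^ 2) = A at *
  generalize ∏ l, (ξ ^ 2 - zt l ^ 2) = B at *
  have h1' : Complex.exp (U ((ξ ^ 2)⁻¹)) = transm q p (ξ ^ 2)⁻¹ * (B / yNt) * yN / A := by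
    rw [h1]
    field_simp
  have h2' : Complex.exp (V (ξ ^ 2)) = transm p q (ξ ^ 2) * A / B := by
    rw [h2]
    field_simp
  rw [h1', h2']
  field_simp

theorem SpectralLogs.isLogBranch (h : SpectralLogs q p z zt U V) :
    IsLogBranch (fun ξ => ξ ^ (2 * ((N : ℤ) - (Nt : ℤ))) * onePlusBB q p ξ) (boundarySum U V) :=
  ⟨(continuous_boundarySum h.diffU h.diffV).continuousOn, fun θ _ =>
    h.exp_boundary hq hp hqp hz hzt (norm_exp_mul_I θ)⟩

/-- Every branch is the boundary function of spectral logarithms. -/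
theorem SpectralLogs.exists_eqOn (h : SpectralLogs q p z zt U V) {L : ℝ → ℂ}
    (hL : IsLogBranch (fun ξ => ξ ^ (2 * ((N : ℤ) - (Nt : ℤ))) * onePlusBB q p ξ) L) :
    ∃ U', SpectralLogs q p z zt U' V ∧
      Set.EqOn L (boundarySum U' V) (Set.Icc 0 (2 * Real.pi)) := by
  obtain ⟨m, hm⟩ := hL.exists_eq_add (h.isLogBranch hq hp hqp hz hzt)
  refine ⟨_, h.add_int m, fun θ hθ => ?_⟩
  rw [hm θ hθ, boundarySum, boundarySum]
  ring

/-! ### Trace formulae -/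

omit hz in
theorem SpectralLogs.aCoef_eq (h : SpectralLogs q p z zt U V) {L : ℝ → ℂ}
    (hL : Set.EqOn L (boundarySum U V) (Set.Icc 0 (2 * Real.pi))) {ζ : ℂ} (hζ : 1 < ‖ζ‖) :
    aCoef q p ζ = 1 / prodC q p
      * ((ζ ^ (2 * Nt) * ∏ j, (ζ ^ 2 - z j ^ 2)) / (ζ ^ (2 * N) * ∏ l, (ζ ^ 2 - zt l ^ 2)))
      * Complex.exp (-(1 / (2 * Real.pi * Complex.I))
          * contour (fun ξ => ξ / (ξ ^ 2 - ζ ^ 2)) L) := by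
  have hζ0 := ne_zero_of_one_le_norm hζ.le
  have hpi : (2 * Real.pi * Complex.I : ℂ) ≠ 0 := Complex.two_pi_I_ne_zero
  have hy0 : ζ ^ 2 ≠ 0 := pow_ne_zero 2 hζ0
  rw [contour_congr hL, contour_cauchy_outside h.diffU h.diffV hζ]
  have e1 : -(1 / (2 * Real.pi * Complex.I)) * (2 * Real.pi * Complex.I * (U 0 - U (ζ ^ 2)⁻¹))
      = U (ζ ^ 2)⁻¹ - U 0 := by
    field_simp
    ring
  have h1 := h.expU (ζ ^ 2)⁻¹ (norm_inv_sq_le hζ.le)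
  rw [prod_one_sub_mul_inv (fun l => zt l ^ 2) hy0,
    prod_one_sub_mul_inv (fun j => z j ^ 2) hy0] at h1
  have hB : ∏ l, (ζ ^ 2 - zt l ^ 2) ≠ 0 := Finset.prod_ne_zero_iff.2 fun l _ hl => by
    have h2 := one_lt_pow₀ hζ two_ne_zero
    rw [← norm_pow, sub_eq_zero.1 hl, norm_pow] at h2
    exact absurd h2 (not_lt.2 (pow_le_one₀ (norm_nonneg _) (hzt l).le))
  rw [e1, Complex.exp_sub, h.exp_U_zero hq hp hqp, prodC_eq_exp hq hp hqp, Complex.exp_neg,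
    aCoef_eq_transm hq hp hqp hζ.le, pow_mul, pow_mul]
  have hI := Complex.exp_ne_zero (conservedI0 q p)
  have hyN : (ζ ^ 2) ^ N ≠ 0 := pow_ne_zero _ hy0
  have hyNt : (ζ ^ 2) ^ Nt ≠ 0 := pow_ne_zero _ hy0
  generalize (ζ ^ 2) ^ N = yN at *
  generalize (ζ ^ 2) ^ Nt = yNt at *
  generalize ∏ j, (ζ ^ 2 - z j ^ 2) = A at *
  generalize ∏ l, (ζ ^ 2 - zt l ^ 2) = B at *
  have h1' : transm q p (ζ ^ 2)⁻¹ = Complex.exp (U (ζ ^ 2)⁻¹) * (A / yN) * yNt / B := by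
    rw [← h1]
    field_simp
  rw [h1']
  field_simp

omit hzt in
theorem SpectralLogs.aTilde_eq (h : SpectralLogs q p z zt U V) {L : ℝ → ℂ}
    (hL : Set.EqOn L (boundarySum U V) (Set.Icc 0 (2 * Real.pi))) {ζ : ℂ} (hζ : ‖ζ‖ < 1) :
    aTilde q p ζ = prodC q p
      * ((∏ l, (ζ ^ 2 - zt l ^ 2)) / (∏ j, (ζ ^ 2 - z j ^ 2)))
      * Complex.exp (1 / (2 * Real.pi * Complex.I)
          * contour (fun ξ => ξ / (ξ ^ 2 - ζ ^ 2)) L) := by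
  have hpi : (2 * Real.pi * Complex.I : ℂ) ≠ 0 := Complex.two_pi_I_ne_zero
  have hζ2 : ‖ζ ^ 2‖ ≤ 1 := by
    rw [norm_pow]
    exact pow_le_one₀ (norm_nonneg _) hζ.le
  rw [contour_congr hL, contour_cauchy_inside h.diffU h.diffV hζ]
  have e1 : 1 / (2 * Real.pi * Complex.I) * (2 * Real.pi * Complex.I * (U 0 + V (ζ ^ 2)))
      = U 0 + V (ζ ^ 2) := by
    field_simp
  have h2 := h.expV (ζ ^ 2) hζ2
  have hA : ∏ j, (ζ ^ 2 - z j ^ 2) ≠ 0 := Finset.prod_ne_zero_iff.2 fun j _ hj => by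
    rw [sub_eq_zero.1 hj, norm_pow] at hζ2
    exact absurd hζ2 (not_le.2 (one_lt_pow₀ (hz j) two_ne_zero))
  rw [e1, Complex.exp_add, h.exp_U_zero hq hp hqp, prodC_eq_exp hq hp hqp, Complex.exp_neg,
    aTilde_eq_transm hq hp hqp hζ.le]
  have hI := Complex.exp_ne_zero (conservedI0 q p)
  field_simp
  rw [h2]
  ring

/-! ### Trace identities -/

/-- A branch of `ln (1 + b b̃)` differs from the boundary function by a linear term. -/
theorem SpectralLogs.exists_eqOn_linear (h : SpectralLogs q p z zt U V) {ℓ : ℝ → ℂ}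
    (hℓ : IsLogBranch (onePlusBB q p) ℓ) :
    ∃ U', SpectralLogs q p z zt U' V ∧
      Set.EqOn ℓ (fun θ => boundarySum U' V θ + (-2 * ((N : ℂ) - Nt) * Complex.I) * θ)
        (Set.Icc 0 (2 * Real.pi)) := by
  obtain ⟨U', hU', hEq⟩ := h.exists_eqOn hq hp hqp hz hzt
    (L := fun θ => ℓ θ + (2 * ((N : ℂ) - Nt) * Complex.I) * θ) ⟨hℓ.1.add (by fun_prop), by
      intro θ hθ
      simp only
      rw [Complex.exp_add, hℓ.2 θ hθ, mul_comm, ← Complex.exp_int_mul]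
      congr 2
      push_cast
      ring⟩
  refine ⟨U', hU', fun θ hθ => ?_⟩
  have := hEq hθ
  simp only at this ⊢
  rw [← this]
  ring

theorem SpectralLogs.isLogBranch_linear (h : SpectralLogs q p z zt U V) :
    IsLogBranch (onePlusBB q p)
      (fun θ => boundarySum U V θ + (-2 * ((N : ℂ) - Nt) * Complex.I) * θ) := by
  have h1 := h.isLogBranch hq hp hqp hz hzt
  refine ⟨h1.1.add (by fun_prop), fun θ hθ => ?_⟩
  rw [Complex.exp_add, h1.2 θ hθ]
  have h2 : Complex.exp (-2 * ((N : ℂ) - Nt) * Complex.I * θ)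
      = (Complex.exp (θ * Complex.I) ^ (2 * ((N : ℤ) - (Nt : ℤ))))⁻¹ := by
    rw [← Complex.exp_int_mul, ← Complex.exp_neg]
    congr 1
    push_cast
    ring
  rw [h2]
  have h3 := zpow_ne_zero (2 * ((N : ℤ) - (Nt : ℤ))) (Complex.exp_ne_zero (θ * Complex.I))
  field_simp

omit hq hp hqp hz hzt in
theorem continuousOn_zpow_sphere (m : ℤ) :
    ContinuousOn (fun ξ : ℂ => ξ ^ m) (Metric.sphere 0 1) := fun ξ hξ =>
  (continuousAt_zpow₀ ξ m (Or.inl (ne_zero_of_norm_eq_one (by simpa using hξ)))).continuousWithinAt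

omit hz hzt in
theorem SpectralLogs.conservedI_eq (h : SpectralLogs q p z zt U V) {ℓ : ℝ → ℂ}
    (hℓ : Set.EqOn ℓ (fun θ => boundarySum U V θ + (-2 * ((N : ℂ) - Nt) * Complex.I) * θ)
      (Set.Icc 0 (2 * Real.pi))) {k : ℕ} (hk : 1 ≤ k) :
    conservedI q p k = traceC z zt ℓ k := by
  have hpi : (Real.pi : ℂ) ≠ 0 := by exact_mod_cast Real.pi_ne_zero
  have hk0 : (k : ℂ) ≠ 0 := by exact_mod_cast (show k ≠ 0 by omega)
  rw [conservedI_eq_of_factorization hq hp hqp h.diffU (fun j => z j ^ 2) (fun l => zt l ^ 2)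
    one_ne_zero (fun x hx => by rw [one_mul]; exact h.expU x hx) hk, traceC, contour_congr hℓ,
    contour_add_angle _ (continuousOn_zpow_sphere _)
      (continuous_boundarySum h.diffU h.diffV).continuousOn,
    contour_moment_pos h.diffU h.diffV hk, contour_zpow_angle (by omega)]
  simp only [← pow_mul]
  push_cast
  field_simp
  ring

omit hzt in
theorem SpectralLogs.conservedITilde_eq (h : SpectralLogs q p z zt U V) {ℓ : ℝ → ℂ}
    (hℓ : Set.EqOn ℓ (fun θ => boundarySum U V θ + (-2 * ((N : ℂ) - Nt) * Complex.I) * θ)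
      (Set.Icc 0 (2 * Real.pi))) {k : ℕ} (hk : 1 ≤ k) :
    conservedITilde q p k = traceCTilde z zt ℓ k := by
  have hpi : (Real.pi : ℂ) ≠ 0 := by exact_mod_cast Real.pi_ne_zero
  have hk0 : (k : ℂ) ≠ 0 := by exact_mod_cast (show k ≠ 0 by omega)
  have hz2 : ∀ j, z j ^ 2 ≠ 0 := fun j => pow_ne_zero 2 (ne_zero_of_one_le_norm (hz j).le)
  have hzt2 : ∀ l, zt l ^ 2 ≠ 0 := fun l => pow_ne_zero 2 (h.zt_ne_zero hq hp hqp hz l)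
  have hA : ∏ j, (-z j ^ 2) ≠ 0 := Finset.prod_ne_zero_iff.2 fun j _ => neg_ne_zero.2 (hz2 j)
  have hB : ∏ l, (-zt l ^ 2) ≠ 0 := Finset.prod_ne_zero_iff.2 fun l _ => neg_ne_zero.2 (hzt2 l)
  have hpow : ∀ w : ℂ, w ^ (-(2 * (k : ℤ))) = ((w ^ 2)⁻¹) ^ k := by
    intro w
    rw [inv_pow, ← pow_mul, zpow_neg]
    norm_cast
  have hfac : ∀ y, ‖y‖ ≤ 1 → transm p q y * ∏ j, (1 - (z j ^ 2)⁻¹ * y)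
      = ((∏ l, (-zt l ^ 2)) / ∏ j, (-z j ^ 2)) * Complex.exp (V y)
        * ∏ l, (1 - (zt l ^ 2)⁻¹ * y) := by
    intro y hy
    have h1 := h.expV y hy
    rw [prod_sub_eq _ hz2, prod_sub_eq _ hzt2] at h1
    rw [div_mul_eq_mul_div, div_mul_eq_mul_div, eq_div_iff hA]
    linear_combination h1
  have hI : conservedITilde q p k = conservedI p q k := rfl
  rw [hI, conservedI_eq_of_factorization hp hq (one_sub_swap hqp) h.diffV
    (fun l => (zt l ^ 2)⁻¹) (fun j => (z j ^ 2)⁻¹) (div_ne_zero hB hA) hfac hk, traceCTilde,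
    contour_congr hℓ, contour_add_angle _ (continuousOn_zpow_sphere _)
      (continuous_boundarySum h.diffU h.diffV).continuousOn,
    contour_moment_neg h.diffU h.diffV hk]
  have hang := contour_zpow_angle (k := -(k : ℤ)) (by omega)
  rw [show (2 * -(k : ℤ) - 1) = -(2 * (k : ℤ)) - 1 by ring] at hang
  rw [hang]
  simp only [hpow]
  push_cast
  field_simp
  ring

omit hq hp hqp hz hzt in
theorem traceC0_eq (hU : DiffContOnCl ℂ U (Metric.ball 0 1))
    (hV : DiffContOnCl ℂ V (Metric.ball 0 1)) (lam : Fin N → ℂ) (lamT : Fin Nt → ℂ) {ℓ : ℝ → ℂ}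
    (hℓ : Set.EqOn ℓ (fun θ => boundarySum U V θ + (-2 * ((N : ℂ) - Nt) * Complex.I) * θ)
      (Set.Icc 0 (2 * Real.pi))) :
    traceC0 lam lamT ℓ = 1 / 2 * (∑ l, lamT l - ∑ j, lam j + U 0 + V 0) := by
  have hpi : (Real.pi : ℂ) ≠ 0 := by exact_mod_cast Real.pi_ne_zero
  have hinv : ContinuousOn (fun ξ : ℂ => 1 / ξ) (Metric.sphere 0 1) :=
    continuousOn_const.div continuousOn_id fun ξ hξ => ne_zero_of_norm_eq_one (by simpa using hξ)
  rw [traceC0, contour_congr hℓ, contour_add_angle _ hinv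
    (continuous_boundarySum hU hV).continuousOn, contour_moment_zero hU hV,
    contour_zero_angle]
  field_simp
  ring

omit hz hzt in
/-- The trace identity of order zero, up to multiples of `π i`. -/
theorem SpectralLogs.conservedI0_eq (h : SpectralLogs q p z zt U V) {lam : Fin N → ℂ}
    {lamT : Fin Nt → ℂ} (hlam : ∀ j, Complex.exp (lam j) = -z j ^ 2)
    (hlamT : ∀ l, Complex.exp (lamT l) = -zt l ^ 2) {ℓ : ℝ → ℂ}
    (hℓ : Set.EqOn ℓ (fun θ => boundarySum U V θ + (-2 * ((N : ℂ) - Nt) * Complex.I) * θ)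
      (Set.Icc 0 (2 * Real.pi))) :
    ∃ m : ℤ, conservedI0 q p = traceC0 lam lamT ℓ + m * Real.pi * Complex.I := by
  obtain ⟨m₁, hm₁⟩ := Complex.exp_eq_exp_iff_exists_int.1 (h.exp_U_zero hq hp hqp)
  have hV0 := h.exp_V_zero hq hp hqp
  simp only [← hlam, ← hlamT, ← Complex.exp_sum, ← Complex.exp_add] at hV0
  obtain ⟨m₂, hm₂⟩ := Complex.exp_eq_exp_iff_exists_int.1 hV0
  refine ⟨m₂ - m₁, ?_⟩
  rw [traceC0_eq h.diffU h.diffV lam lamT hℓ]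
  push_cast
  linear_combination (1 / 2 : ℂ) * hm₂ - (1 / 2 : ℂ) * hm₁

end SpectralLogs

/-! ### The Hamiltonian -/

theorem density_one (u v : ℤ → ℂ) (n : ℤ) : density u v 1 n = u n * v (n - 1) := by
  simp [density, wCoef_zero]

theorem hamDensity_eq (q p : ℤ → ℂ) (n : ℤ) : hamDensity q p n
    = density q p 1 n + density p q 1 (n + 1) + 4 * Complex.log (normF q p n) := by
  rw [hamDensity, density_one, density_one, log_normF, add_sub_cancel_right]
  ring

section

variable {q p : ℤ → ℂ} (hq : Summable fun n => ‖q n‖) (hp : Summable fun n => ‖p n‖)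
include hq hp

theorem summable_density_shift : Summable fun n => density p q 1 (n + 1) :=
  (summable_density hp hq 1).comp_injective (add_left_injective (1 : ℤ))

theorem summable_hamDensity : Summable (hamDensity q p) := by
  simp only [funext (hamDensity_eq q p)]
  exact ((summable_density hq hp 1).add (summable_density_shift hq hp)).add
    ((summable_log_normF hq hp).mul_left 4)

theorem hamiltonian_eq : hamiltonian q p
    = 4 * conservedI0 q p - conservedI q p 1 - conservedITilde q p 1 := by
  have h1 : ∑' n : ℤ, density p q 1 (n + 1) = conservedITilde q p 1 :=
    (Equiv.addRight (1 : ℤ)).tsum_eq (density p q 1)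
  rw [hamiltonian, funext (hamDensity_eq q p), Summable.tsum_add
    ((summable_density hq hp 1).add (summable_density_shift hq hp))
    ((summable_log_normF hq hp).mul_left 4), Summable.tsum_add (summable_density hq hp 1)
    (summable_density_shift hq hp), tsum_mul_left, h1, conservedI0, conservedI]
  ring

end

theorem contour_hamiltonian {ℓ : ℝ → ℂ} (hℓ : ContinuousOn ℓ (Set.Icc 0 (2 * Real.pi))) :
    contour (fun ξ => 2 * ξ⁻¹ - ξ ^ (-3 : ℤ) - ξ) ℓ = 2 * contour (fun ξ => 1 / ξ) ℓ
      - contour (fun ξ => ξ ^ (-(2 * ((1 : ℕ) : ℤ)) - 1)) ℓ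
      - contour (fun ξ => ξ ^ (2 * ((1 : ℕ) : ℤ) - 1)) ℓ := by
  have hinv : ContinuousOn (fun ξ : ℂ => 1 / ξ) (Metric.sphere 0 1) :=
    continuousOn_const.div continuousOn_id fun ξ hξ => ne_zero_of_norm_eq_one (by simpa using hξ)
  have i1 := (intervalIntegrable_contour hinv hℓ).const_mul 2
  have i2 := intervalIntegrable_contour (continuousOn_zpow_sphere (-(2 * ((1 : ℕ) : ℤ)) - 1)) hℓ
  have i3 := intervalIntegrable_contour (continuousOn_zpow_sphere (2 * ((1 : ℕ) : ℤ) - 1)) hℓ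
  have e1 := intervalIntegral.integral_sub (i1.sub i2) i3
  rw [intervalIntegral.integral_sub i1 i2, intervalIntegral.integral_const_mul] at e1
  unfold contour
  rw [← e1]
  refine intervalIntegral.integral_congr fun θ _ => ?_
  have h3 : (-(2 * ((1 : ℕ) : ℤ)) - 1) = -3 := by norm_num
  have h1 : (2 * ((1 : ℕ) : ℤ) - 1) = 1 := by norm_num
  simp only [h3, h1, zpow_one, one_div]
  ring

theorem hamScattering_eq {N Nt : ℕ} (z : Fin N → ℂ) (zt : Fin Nt → ℂ) (lam : Fin N → ℂ)
    (lamT : Fin Nt → ℂ) {ℓ : ℝ → ℂ} (hℓ : ContinuousOn ℓ (Set.Icc 0 (2 * Real.pi))) :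
    hamScattering z zt (fun j => 2 * lam j) (fun l => 2 * lamT l) ℓ
      = 4 * traceC0 lam lamT ℓ - traceC z zt ℓ 1 - traceCTilde z zt ℓ 1 := by
  have hpi : (Real.pi : ℂ) ≠ 0 := by exact_mod_cast Real.pi_ne_zero
  rw [hamScattering, contour_hamiltonian hℓ, traceC0, traceC, traceCTilde]
  simp only [mul_one, Nat.cast_one, ← Finset.mul_sum, Finset.sum_sub_distrib]
  field_simp
  ring

theorem contour_inv_add_const {ℓ : ℝ → ℂ} (hℓ : ContinuousOn ℓ (Set.Icc 0 (2 * Real.pi))) (c : ℂ) :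
    contour (fun ξ => 1 / ξ) (fun θ => ℓ θ + c)
      = contour (fun ξ => 1 / ξ) ℓ + 2 * Real.pi * Complex.I * c := by
  have hinv : ContinuousOn (fun ξ : ℂ => 1 / ξ) (Metric.sphere 0 1) :=
    continuousOn_const.div continuousOn_id fun ξ hξ => ne_zero_of_norm_eq_one (by simpa using hξ)
  have hc := contour_moment_zero (U := fun _ => c) (V := fun _ => 0) diffContOnCl_const
    diffContOnCl_const
  have hb : boundarySum (fun _ => c) (fun _ => 0) = fun _ => c := by
    funext θ
    simp [boundarySum]
  rw [hb, add_zero] at hc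
  rw [← hc]
  unfold contour
  rw [← intervalIntegral.integral_add (intervalIntegrable_contour hinv hℓ)
    (intervalIntegrable_contour hinv continuousOn_const)]
  refine intervalIntegral.integral_congr fun θ _ => ?_
  ring

theorem traceC0_add_const {N Nt : ℕ} (lam : Fin N → ℂ) (lamT : Fin Nt → ℂ) {ℓ : ℝ → ℂ}
    (hℓ : ContinuousOn ℓ (Set.Icc 0 (2 * Real.pi))) (m : ℤ) :
    traceC0 lam lamT (fun θ => ℓ θ + m * (2 * Real.pi * Complex.I))
      = traceC0 lam lamT ℓ + m * Real.pi * Complex.I := by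
  have hpi : (Real.pi : ℂ) ≠ 0 := by exact_mod_cast Real.pi_ne_zero
  rw [traceC0, contour_inv_add_const hℓ, traceC0]
  field_simp
  ring

theorem IsLogBranch.add_int {g : ℂ → ℂ} {ℓ : ℝ → ℂ} (h : IsLogBranch g ℓ) (m : ℤ) :
    IsLogBranch g (fun θ => ℓ θ + m * (2 * Real.pi * Complex.I)) := by
  refine ⟨h.1.add continuousOn_const, fun θ hθ => ?_⟩
  rw [Complex.exp_add, Complex.exp_int_mul_two_pi_mul_I, mul_one, h.2 θ hθ]

/-- Logarithms of `w⁴` are twice those of `-w²` up to multiples of `2π i`. -/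
theorem exists_sum_log_eq {n : ℕ} {w mu lam : Fin n → ℂ} (hmu : ∀ j, Complex.exp (mu j) = w j ^ 4)
    (hlam : ∀ j, Complex.exp (lam j) = -w j ^ 2) :
    ∃ m : ℤ, ∑ j, mu j = ∑ j, 2 * lam j + m * (2 * Real.pi * Complex.I) := by
  have h1 : Complex.exp (∑ j, mu j) = Complex.exp (∑ j, 2 * lam j) := by
    rw [Complex.exp_sum, Complex.exp_sum]
    refine Finset.prod_congr rfl fun j _ => ?_
    rw [hmu, two_mul, Complex.exp_add, hlam]
    ring
  exact Complex.exp_eq_exp_iff_exists_int.1 h1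

end AblowitzLadik

open AblowitzLadik in
theorem mainTheorem10 (q p : ℤ → ℂ)
    (hq : Summable fun n => ‖q n‖) (hp : Summable fun n => ‖p n‖)
    (hqp : ∀ n, 1 - q n * p n ≠ 0)
    (N Nt : ℕ) (z : Fin N → ℂ) (zt : Fin Nt → ℂ)
    (hz : ∀ j, 1 < ‖z j‖) (hzt : ∀ l, ‖zt l‖ < 1)
    (hz_ne : ∀ j k, j ≠ k → z j ≠ z k ∧ z j ≠ -z k)
    (hzt_ne : ∀ l k, l ≠ k → zt l ≠ zt k ∧ zt l ≠ -zt k)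
    (hz_zeros : ∀ ζ : ℂ, 1 ≤ ‖ζ‖ → (aCoef q p ζ = 0 ↔ ∃ j, ζ = z j ∨ ζ = -z j))
    (hzt_zeros : ∀ ζ : ℂ, ‖ζ‖ ≤ 1 → (aTilde q p ζ = 0 ↔ ∃ l, ζ = zt l ∨ ζ = -zt l))
    (hz_simple : ∀ j, deriv (aCoef q p) (z j) ≠ 0)
    (hzt_simple : ∀ l, deriv (aTilde q p) (zt l) ≠ 0) :
    -- the objects are well defined: Jost solutions, transition coefficients, constants
    ((∀ (n : ℤ) (ζ : ℂ) (i : Fin 2), 1 ≤ ‖ζ‖ →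
        Tendsto (fun m : ℤ => (transition q p n m ζ * freeE m ζ) i 0) atBot
          (𝓝 (jost q p atBot n ζ i 0)) ∧
        Tendsto (fun m : ℤ => (transition q p n m ζ * freeE m ζ) i 1) atTop
          (𝓝 (jost q p atTop n ζ i 1))) ∧
      (∀ (n : ℤ) (ζ : ℂ) (i : Fin 2), ζ ≠ 0 → ‖ζ‖ ≤ 1 →
        Tendsto (fun m : ℤ => (transition q p n m ζ * freeE m ζ) i 1) atBot
          (𝓝 (jost q p atBot n ζ i 1)) ∧
        Tendsto (fun m : ℤ => (transition q p n m ζ * freeE m ζ) i 0) atTop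
          (𝓝 (jost q p atTop n ζ i 0))) ∧
      (∀ (n : ℤ) (ζ : ℂ), ‖ζ‖ = 1 → monodromy q p n ζ =
        !![aCoef q p ζ, bTilde q p ζ; bCoef q p ζ, aTilde q p ζ]) ∧
      ContinuousOn (aCoef q p) {ζ : ℂ | 1 ≤ ‖ζ‖} ∧
      DifferentiableOn ℂ (aCoef q p) {ζ : ℂ | 1 < ‖ζ‖} ∧
      ContinuousOn (aTilde q p) {ζ : ℂ | ‖ζ‖ ≤ 1} ∧
      DifferentiableOn ℂ (aTilde q p) {ζ : ℂ | ‖ζ‖ < 1} ∧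
      Multipliable (normF q p) ∧ prodC q p ≠ 0 ∧
      (Summable fun n => Complex.log (normF q p n)) ∧
      (∀ k : ℕ, 1 ≤ k → Summable (density q p k) ∧ Summable (density p q k)) ∧
      Summable (hamDensity q p)) ∧
    -- the trace formulae, for every continuous branch of the logarithm; such branches exist
    -- and are single-valued on the circle
    ((∃ Λ : ℝ → ℂ, IsLogBranch
        (fun ξ => ξ ^ (2 * ((N : ℤ) - (Nt : ℤ))) * onePlusBB q p ξ) Λ) ∧
      ∀ Λ : ℝ → ℂ, IsLogBranch
        (fun ξ => ξ ^ (2 * ((N : ℤ) - (Nt : ℤ))) * onePlusBB q p ξ) Λ →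
      Λ 0 = Λ (2 * Real.pi) ∧
      (∀ ζ : ℂ, 1 < ‖ζ‖ →
        aCoef q p ζ = 1 / prodC q p
          * ((ζ ^ (2 * Nt) * ∏ j, (ζ ^ 2 - z j ^ 2)) / (ζ ^ (2 * N) * ∏ l, (ζ ^ 2 - zt l ^ 2)))
          * Complex.exp (-(1 / (2 * Real.pi * Complex.I))
              * contour (fun ξ => ξ / (ξ ^ 2 - ζ ^ 2)) Λ)) ∧
      (∀ ζ : ℂ, ‖ζ‖ < 1 →
        aTilde q p ζ = prodC q p
          * ((∏ l, (ζ ^ 2 - zt l ^ 2)) / (∏ j, (ζ ^ 2 - z j ^ 2)))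
          * Complex.exp (1 / (2 * Real.pi * Complex.I)
              * contour (fun ξ => ξ / (ξ ^ 2 - ζ ^ 2)) Λ))) ∧
    -- the trace identities of positive order, for every continuous branch
    (∀ ℓ : ℝ → ℂ, IsLogBranch (onePlusBB q p) ℓ → ∀ k : ℕ, 1 ≤ k →
      conservedI q p k = traceC z zt ℓ k ∧ conservedITilde q p k = traceCTilde z zt ℓ k) ∧
    -- the Hamiltonian through the conserved quantities
    hamiltonian q p = 4 * conservedI0 q p - conservedI q p 1 - conservedITilde q p 1 ∧
    -- the trace identity of order zero and the Hamiltonian through the scattering data: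
    -- exact for a suitable branch, and up to the ambiguity of the logarithms for any branch
    (∀ (lam : Fin N → ℂ) (lamT : Fin Nt → ℂ),
      (∀ j, Complex.exp (lam j) = -z j ^ 2) → (∀ l, Complex.exp (lamT l) = -zt l ^ 2) →
      (∃ ℓ : ℝ → ℂ, IsLogBranch (onePlusBB q p) ℓ ∧
        conservedI0 q p = traceC0 lam lamT ℓ ∧
        hamiltonian q p =
          hamScattering z zt (fun j => 2 * lam j) (fun l => 2 * lamT l) ℓ) ∧
      ∀ ℓ : ℝ → ℂ, IsLogBranch (onePlusBB q p) ℓ → ∃ m : ℤ,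
        conservedI0 q p = traceC0 lam lamT ℓ + m * Real.pi * Complex.I ∧
        hamiltonian q p =
          hamScattering z zt (fun j => 2 * lam j) (fun l => 2 * lamT l) ℓ
            + 4 * m * Real.pi * Complex.I) ∧
    (∀ (mu : Fin N → ℂ) (muT : Fin Nt → ℂ) (ℓ : ℝ → ℂ),
      (∀ j, Complex.exp (mu j) = z j ^ 4) → (∀ l, Complex.exp (muT l) = zt l ^ 4) →
      IsLogBranch (onePlusBB q p) ℓ → ∃ m : ℤ,
        hamiltonian q p = hamScattering z zt mu muT ℓ + 2 * m * Real.pi * Complex.I) := by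
  obtain ⟨U, V, hS⟩ := exists_spectralLogs hq hp hqp hz hzt hz_ne hzt_ne hz_zeros hzt_zeros
    hz_simple hzt_simple
  have hz0 : ∀ j, z j ≠ 0 := fun j => ne_zero_of_one_le_norm (hz j).le
  have hzt0 : ∀ l, zt l ≠ 0 := hS.zt_ne_zero hq hp hqp hz
  have hham := hamiltonian_eq hq hp
  have htrace : ∀ ℓ : ℝ → ℂ, IsLogBranch (onePlusBB q p) ℓ → ∀ k : ℕ, 1 ≤ k →
      conservedI q p k = traceC z zt ℓ k ∧ conservedITilde q p k = traceCTilde z zt ℓ k := by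
    intro ℓ hℓ k hk
    obtain ⟨U', hS', hEq⟩ := hS.exists_eqOn_linear hq hp hqp hz hzt hℓ
    exact ⟨hS'.conservedI_eq hq hp hqp hEq hk, hS'.conservedITilde_eq hq hp hqp hz hEq hk⟩
  have hzero : ∀ (lam : Fin N → ℂ) (lamT : Fin Nt → ℂ),
      (∀ j, Complex.exp (lam j) = -z j ^ 2) → (∀ l, Complex.exp (lamT l) = -zt l ^ 2) →
      ∀ ℓ : ℝ → ℂ, IsLogBranch (onePlusBB q p) ℓ → ∃ m : ℤ,
        conservedI0 q p = traceC0 lam lamT ℓ + m * Real.pi * Complex.I := by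
    intro lam lamT hlam hlamT ℓ hℓ
    obtain ⟨U', hS', hEq⟩ := hS.exists_eqOn_linear hq hp hqp hz hzt hℓ
    exact hS'.conservedI0_eq hq hp hqp hlam hlamT hEq
  have hscat : ∀ (lam : Fin N → ℂ) (lamT : Fin Nt → ℂ) (ℓ : ℝ → ℂ) (m : ℤ),
      IsLogBranch (onePlusBB q p) ℓ →
      conservedI0 q p = traceC0 lam lamT ℓ + m * Real.pi * Complex.I →
      hamiltonian q p = hamScattering z zt (fun j => 2 * lam j) (fun l => 2 * lamT l) ℓ
        + 4 * m * Real.pi * Complex.I := by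
    intro lam lamT ℓ m hℓ hm
    obtain ⟨h1, h2⟩ := htrace ℓ hℓ 1 le_rfl
    rw [hham, hm, h1, h2, hamScattering_eq z zt lam lamT hℓ.1]
    ring
  refine ⟨⟨fun n ζ i hζ => ⟨tendsto_jost_left hq hp hqp n hζ i,
      tendsto_jost_right hq hp hqp n hζ i⟩,
    fun n ζ i h0 hζ => ⟨tendsto_jost_left' hq hp hqp n h0 hζ i,
      tendsto_jost_right' hq hp hqp n h0 hζ i⟩,
    fun n ζ hζ => monodromy_eq hq hp hqp n hζ, continuousOn_aCoef hq hp hqp,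
    differentiableOn_aCoef hq hp hqp, continuousOn_aTilde hq hp hqp,
    differentiableOn_aTilde hq hp hqp, multipliable_normF hq hp, ?_, summable_log_normF hq hp,
    fun k _ => ⟨summable_density hq hp k, summable_density hp hq k⟩,
    summable_hamDensity hq hp⟩, ⟨⟨_, hS.isLogBranch hq hp hqp hz hzt⟩, ?_⟩, htrace, hham, ?_, ?_⟩
  · rw [prodC_eq_exp hq hp hqp]
    exact Complex.exp_ne_zero _
  · intro L hL
    obtain ⟨U', hS', hEq⟩ := hS.exists_eqOn hq hp hqp hz hzt hL
    refine ⟨?_, fun ζ hζ => hS'.aCoef_eq hq hp hqp hzt hEq hζ,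
      fun ζ hζ => hS'.aTilde_eq hq hp hqp hz hEq hζ⟩
    rw [hEq ⟨le_rfl, Real.two_pi_pos.le⟩, hEq ⟨Real.two_pi_pos.le, le_rfl⟩, boundarySum_two_pi]
  · intro lam lamT hlam hlamT
    constructor
    · -- shifting any branch by a multiple of `2π i` absorbs the ambiguity
      have hℓ := hS.isLogBranch_linear hq hp hqp hz hzt
      obtain ⟨m, hm⟩ := hzero lam lamT hlam hlamT _ hℓ
      have h0 := hm.trans (traceC0_add_const lam lamT hℓ.1 m).symm
      refine ⟨_, hℓ.add_int m, h0, ?_⟩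
      simpa using hscat lam lamT _ 0 (hℓ.add_int m) (by simpa using h0)
    · intro ℓ hℓ
      obtain ⟨m, hm⟩ := hzero lam lamT hlam hlamT ℓ hℓ
      exact ⟨m, hm, hscat lam lamT ℓ m hℓ hm⟩
  · intro mu muT ℓ hmu hmuT hℓ
    have hlam : ∀ j, Complex.exp (Complex.log (-z j ^ 2)) = -z j ^ 2 := fun j =>
      Complex.exp_log (neg_ne_zero.2 (pow_ne_zero 2 (hz0 j)))
    have hlamT : ∀ l, Complex.exp (Complex.log (-zt l ^ 2)) = -zt l ^ 2 := fun l =>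
      Complex.exp_log (neg_ne_zero.2 (pow_ne_zero 2 (hzt0 l)))
    obtain ⟨m, hm⟩ := hzero _ _ hlam hlamT ℓ hℓ
    obtain ⟨m₁, hm₁⟩ := exists_sum_log_eq hmu hlam
    obtain ⟨m₂, hm₂⟩ := exists_sum_log_eq hmuT hlamT
    refine ⟨2 * m + m₁ - m₂, ?_⟩
    rw [hscat _ _ ℓ m hℓ hm, hamScattering, hamScattering, hm₁, hm₂]
    push_cast
    ring
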